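/- Consider the real RAM with unit-cost comparisons, field operations and square roots on exact real numbers, and with integer arithmetic on $O(\log n)$-bit integers, used among other things as array indices. A convex $n$-gon $P$ ($n\ge 3$), given by the coordinates of its vertices in their cyclic order along the boundary, can be preprocessed in $O(n\log n)$ time and space so that the following queries can be answered, one after another, in $O(\log n)$ time each: given a line $l$ and a choice $H_l^+$ of one of the two closed halfplanes bounded by $l$ (that is, given $(a,b,c)\in\mathbb R^3$ with $(a,b)\neq(0,0)$ and $H_l^+=\{(x,y): ax+by+c\ge 0\}$), find the centre and the radius of a largest circle of positive radius that is internal to $P$ (contained in the closed region bounded by $P$) and lies in $H_l^+$, or report that there is no such circle. -/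

import Mathlib

/-! A uniform real RAM with an explicit step count and memory bound, and largest circles
in convex polygons cut by a halfplane. -/

namespace RealRAM

/-- The memory of the machine: finitely many registers and arrays are used by any one
program, since the names (the first arguments) are fixed in the program text. Integers and
exact reals are kept apart; there is no conversion from reals to integers. -/
structure State where
  natReg : ℕ → ℕ
  realReg : ℕ → ℝ
  natArr : ℕ → ℕ → ℕ
  realArr : ℕ → ℕ → ℝ

/-- Integer expressions; `arr a e` reads entry `e` of the integer array named `a`. -/
inductive NatExp where
  | const (k : ℕ)
  | reg (x : ℕ)
  | arr (a : ℕ) (e : NatExp)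
  | add (e f : NatExp)
  | sub (e f : NatExp)
  | mul (e f : NatExp)
  | div (e f : NatExp)

/-- Real expressions: rational constants, the field operations and square roots. -/
inductive RealExp where
  | const (q : ℚ)
  | reg (x : ℕ)
  | arr (a : ℕ) (e : NatExp)
  | add (e f : RealExp)
  | sub (e f : RealExp)
  | mul (e f : RealExp)
  | div (e f : RealExp)
  | sqrt (e : RealExp)

/-- Tests. -/
inductive Test where
  | natLe (e f : NatExp)
  | realLe (e f : RealExp)
  | neg (b : Test)
  | conj (b c : Test)

/-- Programs. -/
inductive Prog where
  | skip
  | setNatReg (x : ℕ) (e : NatExp)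
  | setRealReg (x : ℕ) (e : RealExp)
  | setNatArr (a : ℕ) (i e : NatExp)
  | setRealArr (a : ℕ) (i : NatExp) (e : RealExp)
  | seq (p q : Prog)
  | ite (b : Test) (p q : Prog)
  | loop (b : Test) (p : Prog)

namespace NatExp

/-- The value of an integer expression (truncated subtraction, integer division). -/
def value (s : State) : NatExp → ℕ
  | const k => k
  | reg x => s.natReg x
  | arr a e => s.natArr a (e.value s)
  | add e f => e.value s + f.value s
  | sub e f => e.value s - f.value s
  | mul e f => e.value s * f.value s
  | div e f => e.value s / f.value s

/-- The number of unit steps taken to evaluate an integer expression. -/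
def cost : NatExp → ℕ
  | const _ => 1
  | reg _ => 1
  | arr _ e => e.cost + 1
  | add e f => e.cost + f.cost + 1
  | sub e f => e.cost + f.cost + 1
  | mul e f => e.cost + f.cost + 1
  | div e f => e.cost + f.cost + 1

end NatExp

namespace RealExp

/-- The value of a real expression. -/
noncomputable def value (s : State) : RealExp → ℝ
  | const q => (q : ℝ)
  | reg x => s.realReg x
  | arr a e => s.realArr a (e.value s)
  | add e f => e.value s + f.value s
  | sub e f => e.value s - f.value s
  | mul e f => e.value s * f.value s
  | div e f => e.value s / f.value s
  | sqrt e => Real.sqrt (e.value s)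

/-- The number of unit steps taken to evaluate a real expression. -/
def cost : RealExp → ℕ
  | const _ => 1
  | reg _ => 1
  | arr _ e => e.cost + 1
  | add e f => e.cost + f.cost + 1
  | sub e f => e.cost + f.cost + 1
  | mul e f => e.cost + f.cost + 1
  | div e f => e.cost + f.cost + 1
  | sqrt e => e.cost + 1

end RealExp

namespace Test

/-- Whether a test succeeds. -/
def Holds (s : State) : Test → Prop
  | natLe e f => e.value s ≤ f.value s
  | realLe e f => e.value s ≤ f.value s
  | neg b => ¬ b.Holds s
  | conj b c => b.Holds s ∧ c.Holds s

/-- The number of unit steps taken by a test. -/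
def cost : Test → ℕ
  | natLe e f => e.cost + f.cost + 1
  | realLe e f => e.cost + f.cost + 1
  | neg b => b.cost + 1
  | conj b c => b.cost + c.cost + 1

end Test

namespace State

/-- Overwrite an integer register. -/
def setNatReg (s : State) (x k : ℕ) : State :=
  { s with natReg := Function.update s.natReg x k }

/-- Overwrite a real register. -/
def setRealReg (s : State) (x : ℕ) (r : ℝ) : State :=
  { s with realReg := Function.update s.realReg x r }

/-- Overwrite an entry of an integer array. -/
def setNatArr (s : State) (a i k : ℕ) : State :=
  { s with natArr := Function.update s.natArr a (Function.update (s.natArr a) i k) }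

/-- Overwrite an entry of a real array. -/
def setRealArr (s : State) (a i : ℕ) (r : ℝ) : State :=
  { s with realArr := Function.update s.realArr a (Function.update (s.realArr a) i r) }

end State

/-- `Exec W p s t s'`: started in `s`, the program `p` halts in `s'` after exactly `t` unit
steps, using only array entries with index below `W` and storing only integers up to `W`
(a program that tries to write outside an array, or to store a larger integer, is stuck).
So a run uses `O(W)` memory cells, and its integers have `O(log W)` bits. -/
inductive Exec (W : ℕ) : Prog → State → ℕ → State → Prop
  | skip (s : State) : Exec W .skip s 1 s
  | setNatReg (s : State) (x : ℕ) (e : NatExp) (h : e.value s ≤ W) :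
      Exec W (.setNatReg x e) s (e.cost + 1) (s.setNatReg x (e.value s))
  | setRealReg (s : State) (x : ℕ) (e : RealExp) :
      Exec W (.setRealReg x e) s (e.cost + 1) (s.setRealReg x (e.value s))
  | setNatArr (s : State) (a : ℕ) (i e : NatExp) (hi : i.value s < W) (h : e.value s ≤ W) :
      Exec W (.setNatArr a i e) s (i.cost + e.cost + 1)
        (s.setNatArr a (i.value s) (e.value s))
  | setRealArr (s : State) (a : ℕ) (i : NatExp) (e : RealExp) (hi : i.value s < W) :
      Exec W (.setRealArr a i e) s (i.cost + e.cost + 1)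
        (s.setRealArr a (i.value s) (e.value s))
  | seq {p q : Prog} {s s' s'' : State} {t t' : ℕ} (hp : Exec W p s t s')
      (hq : Exec W q s' t' s'') : Exec W (.seq p q) s (t + t') s''
  | iteTrue {b : Test} {p q : Prog} {s s' : State} {t : ℕ} (hb : b.Holds s)
      (hp : Exec W p s t s') : Exec W (.ite b p q) s (b.cost + 1 + t) s'
  | iteFalse {b : Test} {p q : Prog} {s s' : State} {t : ℕ} (hb : ¬ b.Holds s)
      (hq : Exec W q s t s') : Exec W (.ite b p q) s (b.cost + 1 + t) s'
  | loopTrue {b : Test} {p : Prog} {s s' s'' : State} {t t' : ℕ} (hb : b.Holds s)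
      (hp : Exec W p s t s') (hl : Exec W (.loop b p) s' t' s'') :
      Exec W (.loop b p) s (b.cost + 1 + t + t') s''
  | loopFalse {b : Test} {p : Prog} {s : State} (hb : ¬ b.Holds s) :
      Exec W (.loop b p) s (b.cost + 1) s

/-- The machine is deterministic: a program has at most one halting run from a state. -/
theorem Exec.deterministic {W : ℕ} {p : Prog} {s s₁ s₂ : State} {t₁ t₂ : ℕ}
    (h₁ : Exec W p s t₁ s₁) (h₂ : Exec W p s t₂ s₂) : t₁ = t₂ ∧ s₁ = s₂ := by
  induction h₁ generalizing t₂ s₂ with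
  | skip | setNatReg | setRealReg | setNatArr | setRealArr => cases h₂; exact ⟨rfl, rfl⟩
  | seq _ _ ihp ihq =>
    cases h₂ with
    | seq hp hq =>
      obtain ⟨rfl, rfl⟩ := ihp hp
      obtain ⟨rfl, rfl⟩ := ihq hq
      exact ⟨rfl, rfl⟩
  | iteTrue hb _ ih =>
    cases h₂ with
    | iteTrue _ hp => obtain ⟨rfl, rfl⟩ := ih hp; exact ⟨rfl, rfl⟩
    | iteFalse hb' _ => exact absurd hb hb'
  | iteFalse hb _ ih =>
    cases h₂ with
    | iteTrue hb' _ => exact absurd hb' hb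
    | iteFalse _ hp => obtain ⟨rfl, rfl⟩ := ih hp; exact ⟨rfl, rfl⟩
  | loopTrue hb _ _ ihp ihl =>
    cases h₂ with
    | loopTrue _ hp hl =>
      obtain ⟨rfl, rfl⟩ := ihp hp
      obtain ⟨rfl, rfl⟩ := ihl hl
      exact ⟨rfl, rfl⟩
    | loopFalse hb' => exact absurd hb hb'
  | loopFalse hb =>
    cases h₂ with
    | loopTrue hb' _ _ => exact absurd hb' hb
    | loopFalse _ => exact ⟨rfl, rfl⟩

end RealRAM

namespace CircleQuery

open RealRAM

/-- The Euclidean plane. -/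
abbrev Plane : Type := EuclideanSpace ℝ (Fin 2)

/-- Twice the signed area of the triangle `p q r`; positive iff `p, q, r` is a strict left turn. -/
def turn (p q r : Plane) : ℝ :=
  (q 0 - p 0) * (r 1 - p 1) - (q 1 - p 1) * (r 0 - p 0)

/-- `v` lists the vertices of a convex `n`-gon in their cyclic order along its boundary,
in counterclockwise (first alternative) or clockwise (second alternative) direction. -/
def IsConvexPolygon {n : ℕ} (v : Fin n → Plane) : Prop :=
  3 ≤ n ∧
    ((∀ i j k : Fin n, i < j → j < k → 0 < turn (v i) (v j) (v k)) ∨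
      (∀ i j k : Fin n, i < j → j < k → turn (v i) (v j) (v k) < 0))

/-- The closed region bounded by the convex polygon with vertices `v`. -/
def region {n : ℕ} (v : Fin n → Plane) : Set Plane :=
  convexHull ℝ (Set.range v)

/-- The closed halfplane `a x + b y + c ≥ 0`, bounded by the line `a x + b y + c = 0`
when `(a, b) ≠ (0, 0)`. -/
def halfplane (a b c : ℝ) : Set Plane :=
  {p | 0 ≤ a * p 0 + b * p 1 + c}

/-- The circle with centre `o` and radius `r` is a (nondegenerate) circle contained in `S`. -/
def IsCircleIn (S : Set Plane) (o : Plane) (r : ℝ) : Prop :=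
  0 < r ∧ Metric.sphere o r ⊆ S

/-- The circle with centre `o` and radius `r` is contained in `S`, and no circle contained
in `S` is larger. -/
def IsLargestCircleIn (S : Set Plane) (o : Plane) (r : ℝ) : Prop :=
  IsCircleIn S o r ∧ ∀ (o' : Plane) (r' : ℝ), IsCircleIn S o' r' → r' ≤ r

/-- The initial memory for preprocessing: `n` in integer register `0`, the coordinates of the
vertices in the real arrays `0` and `1`, and zeros elsewhere. -/
noncomputable def inputState {n : ℕ} (v : Fin n → Plane) : State where
  natReg x := if x = 0 then n else 0
  realReg _ := 0
  natArr _ _ := 0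
  realArr a i :=
    if h : i < n then (if a = 0 then v ⟨i, h⟩ 0 else if a = 1 then v ⟨i, h⟩ 1 else 0) else 0

/-- Put the coefficients of a query halfplane into the real registers `0`, `1`, `2`. -/
def loadQuery (s : State) (a b c : ℝ) : State :=
  ((s.setRealReg 0 a).setRealReg 1 b).setRealReg 2 c

/-- The memory `s` holds a correct answer for the set `S`: either integer register `1` is `1`
and the real registers `0`, `1`, `2` hold the centre and the radius of a largest circle
contained in `S`, or it is `0` and `S` contains no circle. -/
def IsAnswer (S : Set Plane) (s : State) : Prop :=
  (s.natReg 1 = 1 ∧ IsLargestCircleIn S !₂[s.realReg 0, s.realReg 1] (s.realReg 2)) ∨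
    (s.natReg 1 = 0 ∧ ∀ (o : Plane) (r : ℝ), ¬ IsCircleIn S o r)

/-- Started in `s` with memory bound `W`, the program `query` answers every halfplane query for
the convex polygon `v` within `T` steps and ends in a memory satisfying `Ready`. -/
def AnswersFrom {n : ℕ} (v : Fin n → Plane) (query : Prog) (W T : ℕ) (Ready : State → Prop)
    (s : State) : Prop :=
  ∀ a b c : ℝ, (a, b) ≠ (0, 0) → ∃ (t : ℕ) (s' : State),
    Exec W query (loadQuery s a b c) t s' ∧ t ≤ T ∧
      IsAnswer (region v ∩ halfplane a b c) s' ∧ Ready s'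

end CircleQuery

/-! Write the polygon as the set of `x` with `dot (N i) x ≤ d i` for all sides `i`, where the `N i`
are the outer unit normals, and let `w` be the inner unit normal of the query halfplane. A circle
with centre `o` and radius `r > 0` is admissible iff `dot (N i) o + r ≤ d i` for all `i` and `r ≤
dot w o + e`. A largest circle thus solves a linear program in three variables, and duality
certifies it (`le_of_inCone`): a circle that touches the query line and two sides whose normals span
a cone containing `w` is optimal, because a nonnegative combination of these three constraints
eliminates the centre.

Such circles lie on the medial axis. Move all sides inwards at unit speed. The corner between two
neighbouring sides is then the centre of a circle touching both. When a side vanishes, its two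
corners meet in a new node, and the cone of the two sides that become neighbours contains the cones
of both old pairs (`Shrunk.remove`, `Forest.remove`). When the neighbours of a vanishing side turn
by at least a half turn, the current radius is the largest possible one
(`Shrunk.le_of_cross_nonpos`). The result is a forest with the polygon vertices as leaves, of radius
`0`, and largest circles of the polygon as roots.

The vector `w` lies in the cone of one leaf, hence in the cones of all its ancestors. Consider the
gap `dot w (P c) + e - R c` along the path from this leaf to its root. If it is nonpositive at the
leaf, there is no circle (`Climb.nonpos_of_leaf`); if it is positive at the root, the root is the
answer (`Climb.isBest_root`); otherwise it changes sign along some edge, and the point of that edge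
with gap zero is the answer (`Climb.isBest_between`).

For the running time, a max-tree over the reciprocals of the vanishing radii yields each event and
its updates in `O(log n)`. A table of the ancestors at distances `2 ^ k` takes `O(n log n)` time and
space. A query finds its leaf by binary search and the edge with the sign change by binary lifting.
Both searches keep only one sign at each end, so no monotonicity is needed. -/

namespace RealRAM

/-! ### A calculus of running times for programs. -/

/-- The running time of one pass over the program, which enters every branch and loop once. -/
def Prog.time : Prog → ℕ
  | .skip => 1
  | .setNatReg _ e => e.cost + 1
  | .setRealReg _ e => e.cost + 1
  | .setNatArr _ i e => i.cost + e.cost + 1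
  | .setRealArr _ i e => i.cost + e.cost + 1
  | .seq p q => p.time + q.time
  | .ite b p q => b.cost + 1 + (p.time + q.time)
  | .loop b p => b.cost + 1 + p.time

/-- `p` started in `s` halts within the time of `k` passes in a state satisfying `Q`. -/
def Runs (W : ℕ) (p : Prog) (s : State) (k : ℕ) (Q : State → Prop) : Prop :=
  ∃ t s', Exec W p s t s' ∧ t ≤ p.time * k ∧ Q s'

theorem Runs.mono {W : ℕ} {p : Prog} {s : State} {k k' : ℕ} {Q Q' : State → Prop}
    (h : Runs W p s k Q) (hk : k ≤ k') (hQ : ∀ s', Q s' → Q' s') : Runs W p s k' Q' := by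
  obtain ⟨t, s', h1, h2, h3⟩ := h
  exact ⟨t, s', h1, h2.trans (Nat.mul_le_mul_left _ hk), hQ _ h3⟩

/-- `time` is additive, so both halves can be charged the same number of passes; constants never
have to be tracked. -/
theorem Runs.seq {W : ℕ} {p q : Prog} {s : State} {k : ℕ} {Q Q' : State → Prop}
    (hp : Runs W p s k Q) (hq : ∀ s', Q s' → Runs W q s' k Q') :
    Runs W (.seq p q) s k Q' := by
  obtain ⟨t, s', h1, h2, h3⟩ := hp
  obtain ⟨t', s'', k1, k2, k3⟩ := hq _ h3
  refine ⟨t + t', s'', .seq h1 k1, ?_, k3⟩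
  rw [Prog.time, Nat.add_mul]
  omega

theorem Runs.ite {W : ℕ} {b : Test} {p q : Prog} {s : State} {k : ℕ} {Q : State → Prop}
    (hk : 1 ≤ k) (hp : b.Holds s → Runs W p s k Q) (hq : ¬ b.Holds s → Runs W q s k Q) :
    Runs W (.ite b p q) s k Q := by
  have hb : b.cost + 1 ≤ (b.cost + 1) * k := Nat.le_mul_of_pos_right _ hk
  by_cases hb : b.Holds s
  · obtain ⟨t, s', h1, h2, h3⟩ := hp hb
    refine ⟨_, s', .iteTrue hb h1, ?_, h3⟩
    rw [Prog.time, Nat.add_mul, Nat.add_mul p.time]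
    omega
  · obtain ⟨t, s', h1, h2, h3⟩ := hq hb
    refine ⟨_, s', .iteFalse hb h1, ?_, h3⟩
    rw [Prog.time, Nat.add_mul, Nat.add_mul p.time]
    omega

/-- Total correctness of loops: `I m` is the invariant with at most `m` iterations to go. -/
theorem Runs.loop {W : ℕ} {b : Test} {p : Prog} {k : ℕ} (hk : 1 ≤ k) (I : ℕ → State → Prop)
    (hI : ∀ m s, I m s → b.Holds s → Runs W p s k fun s' => ∃ m' < m, I m' s') {m : ℕ}
    {s : State} (hs : I m s) : Runs W (.loop b p) s (k * (m + 1))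
      fun s' => ∃ m', I m' s' ∧ ¬ b.Holds s' := by
  have hbk : b.cost + 1 ≤ (b.cost + 1) * k := Nat.le_mul_of_pos_right _ hk
  induction m using Nat.strong_induction_on generalizing s with
  | _ m ih =>
    by_cases hb : b.Holds s
    · obtain ⟨t, s', h1, h2, m', hm', h3⟩ := hI m s hs hb
      obtain ⟨t', s'', k1, k2, k3⟩ := ih m' hm' h3
      refine ⟨_, s'', .loopTrue hb h1 k1, ?_, k3⟩
      -- As `m' < m`, the remaining iterations fit into `k * m` passes; the other `k` passes pay for
      -- the present one.
      have h4 : (Prog.loop b p).time * (k * (m' + 1)) ≤ (Prog.loop b p).time * (k * m) :=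
        Nat.mul_le_mul_left _ (Nat.mul_le_mul_left _ hm')
      have h5 : (Prog.loop b p).time * k = (b.cost + 1) * k + p.time * k := by
        rw [Prog.time, Nat.add_mul]
      rw [Nat.mul_add k, Nat.mul_add _ (k * m), Nat.mul_one, h5]
      omega
    · refine ⟨_, s, .loopFalse hb, ?_, m, hs, hb⟩
      have h5 : (Prog.loop b p).time * k = (b.cost + 1) * k + p.time * k := by
        rw [Prog.time, Nat.add_mul]
      rw [Nat.mul_add k, Nat.mul_add _ (k * m), Nat.mul_one, h5]
      omega

/-- The weakest precondition of a loop-free program. -/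
def Prog.wp (W : ℕ) : Prog → (State → Prop) → State → Prop
  | .skip, Q, s => Q s
  | .setNatReg x e, Q, s => e.value s ≤ W ∧ Q (s.setNatReg x (e.value s))
  | .setRealReg x e, Q, s => Q (s.setRealReg x (e.value s))
  | .setNatArr a i e, Q, s =>
      (i.value s < W ∧ e.value s ≤ W) ∧ Q (s.setNatArr a (i.value s) (e.value s))
  | .setRealArr a i e, Q, s => i.value s < W ∧ Q (s.setRealArr a (i.value s) (e.value s))
  | .seq p q, Q, s => p.wp W (q.wp W Q) s
  | .ite b p q, Q, s => (b.Holds s → p.wp W Q s) ∧ (¬ b.Holds s → q.wp W Q s)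
  | .loop _ _, _, _ => False

theorem Runs.of_wp {W : ℕ} {p : Prog} {s : State} {k : ℕ} {Q : State → Prop} (hk : 1 ≤ k)
    (h : p.wp W Q s) : Runs W p s k Q := by
  have le : ∀ a, a ≤ a * k := fun a => Nat.le_mul_of_pos_right _ hk
  induction p generalizing s Q with
  | skip => exact ⟨_, _, .skip s, le _, h⟩
  | setNatReg x e => exact ⟨_, _, .setNatReg s x e h.1, le _, h.2⟩
  | setRealReg x e => exact ⟨_, _, .setRealReg s x e, le _, h⟩
  | setNatArr a i e => exact ⟨_, _, .setNatArr s a i e h.1.1 h.1.2, le _, h.2⟩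
  | setRealArr a i e => exact ⟨_, _, .setRealArr s a i e h.1, le _, h.2⟩
  | seq p q ihp ihq => exact (ihp h).seq fun _ h' => ihq h'
  | ite b p q ihp ihq => exact Runs.ite hk (fun hb => ihp (h.1 hb)) fun hb => ihq (h.2 hb)
  | loop b p => exact h.elim

/-- Total correctness of loops with loop-free bodies. -/
theorem Runs.loop_of_wp {W : ℕ} {b : Test} {p : Prog} (I : ℕ → State → Prop)
    (hI : ∀ m s, I m s → b.Holds s → p.wp W (fun s' => ∃ m' < m, I m' s') s) {m : ℕ} {s : State}
    (hs : I m s) : Runs W (.loop b p) s (m + 1) fun s' => ∃ m', I m' s' ∧ ¬ b.Holds s' :=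
  (Runs.loop le_rfl I (fun m s h hb => Runs.of_wp le_rfl (hI m s h hb)) hs).mono
    (by rw [Nat.one_mul]) fun _ => id

@[simp] theorem State.natReg_setNatReg (s : State) (x k : ℕ) :
    (s.setNatReg x k).natReg = Function.update s.natReg x k := rfl
@[simp] theorem State.realReg_setNatReg (s : State) (x k : ℕ) :
    (s.setNatReg x k).realReg = s.realReg := rfl
@[simp] theorem State.natArr_setNatReg (s : State) (x k : ℕ) :
    (s.setNatReg x k).natArr = s.natArr := rfl
@[simp] theorem State.realArr_setNatReg (s : State) (x k : ℕ) :
    (s.setNatReg x k).realArr = s.realArr := rfl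
@[simp] theorem State.natReg_setRealReg (s : State) (x : ℕ) (r : ℝ) :
    (s.setRealReg x r).natReg = s.natReg := rfl
@[simp] theorem State.realReg_setRealReg (s : State) (x : ℕ) (r : ℝ) :
    (s.setRealReg x r).realReg = Function.update s.realReg x r := rfl
@[simp] theorem State.natArr_setRealReg (s : State) (x : ℕ) (r : ℝ) :
    (s.setRealReg x r).natArr = s.natArr := rfl
@[simp] theorem State.realArr_setRealReg (s : State) (x : ℕ) (r : ℝ) :
    (s.setRealReg x r).realArr = s.realArr := rfl
@[simp] theorem State.natReg_setNatArr (s : State) (a i k : ℕ) :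
    (s.setNatArr a i k).natReg = s.natReg := rfl
@[simp] theorem State.realReg_setNatArr (s : State) (a i k : ℕ) :
    (s.setNatArr a i k).realReg = s.realReg := rfl
@[simp] theorem State.natArr_setNatArr (s : State) (a i k : ℕ) :
    (s.setNatArr a i k).natArr =
      Function.update s.natArr a (Function.update (s.natArr a) i k) := rfl
@[simp] theorem State.realArr_setNatArr (s : State) (a i k : ℕ) :
    (s.setNatArr a i k).realArr = s.realArr := rfl
@[simp] theorem State.natReg_setRealArr (s : State) (a i : ℕ) (r : ℝ) :
    (s.setRealArr a i r).natReg = s.natReg := rfl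
@[simp] theorem State.realReg_setRealArr (s : State) (a i : ℕ) (r : ℝ) :
    (s.setRealArr a i r).realReg = s.realReg := rfl
@[simp] theorem State.natArr_setRealArr (s : State) (a i : ℕ) (r : ℝ) :
    (s.setRealArr a i r).natArr = s.natArr := rfl
@[simp] theorem State.realArr_setRealArr (s : State) (a i : ℕ) (r : ℝ) :
    (s.setRealArr a i r).realArr =
      Function.update s.realArr a (Function.update (s.realArr a) i r) := rfl

end RealRAM

/-! ### Plane vectors, cones and the cyclic order of unit vectors. -/

namespace CircleQuery

/-- The cross product of plane vectors. -/
def cross (p q : ℝ × ℝ) : ℝ := p.1 * q.2 - p.2 * q.1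

/-- The dot product of plane vectors. -/
def dot (p q : ℝ × ℝ) : ℝ := p.1 * q.1 + p.2 * q.2

/-- Twice the signed area of a triangle. -/
def orient (p q r : ℝ × ℝ) : ℝ := cross p q + cross q r + cross r p

/-- `w` is a nonnegative combination of `p` and `q`. -/
def InCone (p q w : ℝ × ℝ) : Prop :=
  ∃ x y : ℝ, 0 ≤ x ∧ 0 ≤ y ∧ w = (x * p.1 + y * q.1, x * p.2 + y * q.2)

/-- The solution `o` of `dot p o = a`, `dot q o = b`. -/
noncomputable def corner (p q : ℝ × ℝ) (a b : ℝ) : ℝ × ℝ :=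
  ((a * q.2 - b * p.2) / cross p q, (b * p.1 - a * q.1) / cross p q)

/-- The determinant of the rows `p, q, r` augmented by the column `a, b, c`. -/
def tripleDet (p q r : ℝ × ℝ) (a b c : ℝ) : ℝ := a * cross q r + b * cross r p + c * cross p q

theorem cross_self (p : ℝ × ℝ) : cross p p = 0 := by unfold cross; ring

theorem cross_swap (p q : ℝ × ℝ) : cross p q = -cross q p := by unfold cross; ring

theorem orient_rotate (p q r : ℝ × ℝ) : orient q r p = orient p q r := by
  unfold orient; ring

theorem orient_swap (p q r : ℝ × ℝ) : orient p r q = -orient p q r := by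
  unfold orient cross; ring

theorem tripleDet_sub (p q r : ℝ × ℝ) (a b c ρ : ℝ) :
    tripleDet p q r (a - ρ) (b - ρ) (c - ρ) = tripleDet p q r a b c - ρ * orient p q r := by
  unfold tripleDet orient; ring

theorem dot_corner_left {p q : ℝ × ℝ} (h : cross p q ≠ 0) (a b : ℝ) :
    dot p (corner p q a b) = a := by
  unfold dot corner
  field_simp
  unfold cross; ring

theorem dot_corner_right {p q : ℝ × ℝ} (h : cross p q ≠ 0) (a b : ℝ) :
    dot q (corner p q a b) = b := by
  unfold dot corner
  field_simp
  unfold cross; ring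

theorem InCone.left (p q : ℝ × ℝ) : InCone p q p := ⟨1, 0, by simp⟩

theorem InCone.right (p q : ℝ × ℝ) : InCone p q q := ⟨0, 1, by simp⟩

theorem InCone.trans {p q p' q' w : ℝ × ℝ} (hw : InCone p' q' w) (hp : InCone p q p')
    (hq : InCone p q q') : InCone p q w := by
  obtain ⟨x, y, hx, hy, rfl⟩ := hw
  obtain ⟨a, b, ha, hb, rfl⟩ := hp
  obtain ⟨c, d, hc, hd, rfl⟩ := hq
  refine ⟨x * a + y * c, x * b + y * d, by positivity, by positivity, ?_⟩
  ext <;> simp <;> ring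

/-- Cramer's rule gives the coefficients. -/
theorem inCone_of_cross {p q w : ℝ × ℝ} (h : 0 < cross p q) (h1 : 0 ≤ cross p w)
    (h2 : 0 ≤ cross w q) : InCone p q w := by
  refine ⟨cross w q / cross p q, cross p w / cross p q, by positivity, by positivity, ?_⟩
  ext <;> simp only [] <;> field_simp <;> unfold cross <;> ring

theorem one_sub_dot {p q : ℝ × ℝ} (hp : dot p p = 1) (hq : dot q q = 1) :
    1 - dot p q = ((p.1 - q.1) ^ 2 + (p.2 - q.2) ^ 2) / 2 := by
  unfold dot at *; linarith

theorem one_sub_dot_nonneg {p q : ℝ × ℝ} (hp : dot p p = 1) (hq : dot q q = 1) :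
    0 ≤ 1 - dot p q := by
  rw [one_sub_dot hp hq]; positivity

theorem one_sub_dot_pos {p q : ℝ × ℝ} (hp : dot p p = 1) (hq : dot q q = 1) (h : p ≠ q) :
    0 < 1 - dot p q := by
  refine (one_sub_dot_nonneg hp hq).lt_of_ne fun h0 => h ?_
  rw [one_sub_dot hp hq] at h0
  have h1 : (p.1 - q.1) ^ 2 = 0 := by nlinarith [sq_nonneg (p.1 - q.1), sq_nonneg (p.2 - q.2)]
  have h2 : (p.2 - q.2) ^ 2 = 0 := by nlinarith [sq_nonneg (p.1 - q.1), sq_nonneg (p.2 - q.2)]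
  ext
  · exact sub_eq_zero.1 (pow_eq_zero_iff two_ne_zero |>.1 h1)
  · exact sub_eq_zero.1 (pow_eq_zero_iff two_ne_zero |>.1 h2)

/-- Expand in the orthonormal frame whose first axis is `p`, where `dot p` and `cross p` are the
coordinates. -/
theorem orient_eq {p : ℝ × ℝ} (hp : dot p p = 1) (q r : ℝ × ℝ) :
    orient p q r = cross p q * (1 - dot p r) - cross p r * (1 - dot p q) := by
  unfold orient cross dot at *
  linear_combination (-(q.1 * r.2 - q.2 * r.1)) * hp

theorem ne_of_orient_ne_zero {p q r : ℝ × ℝ} (h : orient p q r ≠ 0) :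
    p ≠ q ∧ q ≠ r ∧ p ≠ r := by
  refine ⟨?_, ?_, ?_⟩ <;> rintro rfl <;> apply h <;> unfold orient cross <;> ring

/-- A unit vector on the arc between `p` and `q` is in the cone they span. -/
theorem inCone_of_orient {p q w : ℝ × ℝ} (hp : dot p p = 1) (hq : dot q q = 1)
    (hw : dot w w = 1) (h : 0 < cross p q) (ho : 0 ≤ orient p w q) : InCone p q w := by
  have hpq : p ≠ q := by rintro rfl; simp [cross_self] at h
  have a1 := one_sub_dot_pos hp hq hpq
  have a2 := one_sub_dot_nonneg hp hw
  have a3 := one_sub_dot_nonneg hq hw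
  have a4 : dot q p = dot p q := by unfold dot; ring
  refine inCone_of_cross h ?_ ?_
  · rw [orient_eq hp] at ho
    have : 0 ≤ cross p w * (1 - dot p q) := by nlinarith
    exact nonneg_of_mul_nonneg_left this a1
  · have e : orient p w q = orient q p w := by unfold orient; ring
    rw [e, orient_eq hq, cross_swap q p, cross_swap q w, a4] at ho
    have : 0 ≤ cross w q * (1 - dot p q) := by nlinarith
    exact nonneg_of_mul_nonneg_left this a1

/-- The stereographic coordinate of `q` seen from `p`. -/
noncomputable def stereo (p q : ℝ × ℝ) : ℝ := cross p q / (1 - dot p q)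

/-- `stereo p q` is the cotangent of half the angle from `p` to `q`, so it decreases as `q` turns
counterclockwise away from `p`. Cutting the circle at `p` turns the cyclic order into a linear one.
-/
theorem orient_eq_stereo {p q r : ℝ × ℝ} (hp : dot p p = 1) (hq : dot q q = 1)
    (hr : dot r r = 1) (hpq : p ≠ q) (hpr : p ≠ r) :
    orient p q r = (1 - dot p q) * (1 - dot p r) * (stereo p q - stereo p r) := by
  have h1 := one_sub_dot_pos hp hq hpq
  have h2 := one_sub_dot_pos hp hr hpr
  rw [orient_eq hp, stereo, stereo]
  field_simp

theorem orient_pos_iff {p q r : ℝ × ℝ} (hp : dot p p = 1) (hq : dot q q = 1)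
    (hr : dot r r = 1) (hpq : p ≠ q) (hpr : p ≠ r) :
    0 < orient p q r ↔ stereo p r < stereo p q := by
  have h1 := one_sub_dot_pos hp hq hpq
  have h2 := one_sub_dot_pos hp hr hpr
  rw [orient_eq_stereo hp hq hr hpq hpr, mul_pos_iff_of_pos_left (mul_pos h1 h2), sub_pos]

theorem orient_trans {k l i r : ℝ × ℝ} (hk : dot k k = 1) (hl : dot l l = 1)
    (hi : dot i i = 1) (hr : dot r r = 1) (h1 : 0 < orient k l i) (h2 : 0 < orient k i r) :
    0 < orient k l r := by
  have e1 := ne_of_orient_ne_zero h1.ne'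
  have e2 := ne_of_orient_ne_zero h2.ne'
  rw [orient_pos_iff hk hl hr e1.1 e2.2.2]
  rw [orient_pos_iff hk hl hi e1.1 e1.2.2] at h1
  rw [orient_pos_iff hk hi hr e2.1 e2.2.2] at h2
  exact h2.trans h1

/-- With `θ` the angle from `p` to `q`, this is `1 - cos θ = 2 sin² (θ/2)` together with `1 + cot²
(θ/2) = 1 / sin² (θ/2)`. It recovers `dot p q` from `stereo p q`. -/
theorem one_sub_dot_mul {p q : ℝ × ℝ} (hp : dot p p = 1) (hq : dot q q = 1) (h : p ≠ q) :
    (1 - dot p q) * (1 + stereo p q ^ 2) = 2 := by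
  have h1 := one_sub_dot_pos hp hq h
  have h2 : cross p q ^ 2 + dot p q ^ 2 = 1 := by
    have : cross p q ^ 2 + dot p q ^ 2 = dot p p * dot q q := by unfold cross dot; ring
    rw [this, hp, hq, one_mul]
  rw [stereo, div_pow, one_add_div (by positivity), ← mul_div_assoc,
    div_eq_iff (by positivity)]
  linear_combination (1 - dot p q) * h2

/-- In the rational parametrization of the circle the orientation determinant is a Vandermonde
determinant up to a positive factor. -/
theorem orient_eq_stereo_prod {p q w r : ℝ × ℝ} (hp : dot p p = 1) (hq : dot q q = 1)
    (hw : dot w w = 1) (hr : dot r r = 1) (h1 : p ≠ q) (h2 : p ≠ w) (h3 : p ≠ r) :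
    orient q w r = (1 - dot p q) * (1 - dot p w) * (1 - dot p r) / 2 *
      ((stereo p q - stereo p w) * (stereo p w - stereo p r) * (stereo p q - stereo p r)) := by
  have key : ∀ u v : ℝ × ℝ, cross u v = dot p u * cross p v - cross p u * dot p v := by
    intro u v
    unfold cross dot at *
    linear_combination (-(u.1 * v.2 - u.2 * v.1)) * hp
  have c : ∀ u : ℝ × ℝ, dot u u = 1 → p ≠ u →
      cross p u = stereo p u * (1 - dot p u) := by
    intro u hu h
    rw [stereo, div_mul_cancel₀ _ (one_sub_dot_pos hp hu h).ne']
  have e1 := one_sub_dot_mul hp hq h1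
  have e2 := one_sub_dot_mul hp hw h2
  have e3 := one_sub_dot_mul hp hr h3
  rw [orient, key q w, key w r, key r q, c q hq h1, c w hw h2, c r hr h3]
  generalize stereo p q = x at *
  generalize stereo p w = y at *
  generalize stereo p r = z at *
  have p1 : 1 + x ^ 2 ≠ 0 := by positivity
  have p2 : 1 + y ^ 2 ≠ 0 := by positivity
  have p3 : 1 + z ^ 2 ≠ 0 := by positivity
  rw [show dot p q = 1 - 2 / (1 + x ^ 2) by rw [← e1]; field_simp; ring,
    show dot p w = 1 - 2 / (1 + y ^ 2) by rw [← e2]; field_simp; ring,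
    show dot p r = 1 - 2 / (1 + z ^ 2) by rw [← e3]; field_simp; ring]
  field_simp
  ring

/-- If `p, q, w, r` are in cyclic order on the unit circle, then so are `q, w, r`. -/
theorem orient_nonneg_of_between {p q w r : ℝ × ℝ} (hp : dot p p = 1) (hq : dot q q = 1)
    (hw : dot w w = 1) (hr : dot r r = 1) (h1 : 0 ≤ orient p q w) (h2 : 0 < orient p w r)
    (h3 : 0 < orient p q r) : 0 ≤ orient q w r := by
  have e2 := ne_of_orient_ne_zero h2.ne'
  have e3 := ne_of_orient_ne_zero h3.ne'
  have a1 := one_sub_dot_pos hp hq e3.1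
  have a2 := one_sub_dot_pos hp hw e2.1
  have a3 := one_sub_dot_pos hp hr e3.2.2
  rw [orient_pos_iff hp hw hr e2.1 e2.2.2] at h2
  rw [orient_eq_stereo hp hq hw e3.1 e2.1] at h1
  have h4 : 0 ≤ stereo p q - stereo p w := nonneg_of_mul_nonneg_right h1 (mul_pos a1 a2)
  rw [orient_eq_stereo_prod hp hq hw hr e3.1 e2.1 e3.2.2]
  have h5 : 0 ≤ stereo p w - stereo p r := by linarith
  have h6 : 0 ≤ stereo p q - stereo p r := by linarith
  positivity

/-- Counterclockwise from `k`, `e` comes strictly before `f`, and `f` comes no later than a half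
turn. -/
theorem cross_pos_of_orient {k e f : ℝ × ℝ} (hk : dot k k = 1) (he : dot e e = 1)
    (hf : dot f f = 1) (ho : 0 < orient k e f) (hc : 0 ≤ cross k f) : 0 < cross k e := by
  have hne := ne_of_orient_ne_zero ho.ne'
  have b1 := one_sub_dot_pos hk he hne.1
  have b2 := one_sub_dot_pos hk hf hne.2.2
  rw [orient_eq hk] at ho
  exact pos_of_mul_pos_left (by nlinarith : 0 < cross k e * (1 - dot k f)) b2.le

end CircleQuery

/-! ### Cyclic lists of sides and the convex polygons they bound. -/

namespace CircleQuery

/-- `nx` and `pv` link the indices in `A` in the counterclockwise order of the unit normals `N`. -/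
structure CyclicList (N : ℕ → ℝ × ℝ) (A : Finset ℕ) (nx pv : ℕ → ℕ) : Prop where
  unit : ∀ i ∈ A, dot (N i) (N i) = 1
  nx_mem : ∀ i ∈ A, nx i ∈ A
  pv_mem : ∀ i ∈ A, pv i ∈ A
  pv_nx : ∀ i ∈ A, pv (nx i) = i
  nx_pv : ∀ i ∈ A, nx (pv i) = i
  cross_pos : ∀ i ∈ A, 0 < cross (N i) (N (nx i))
  orient_pos : ∀ i ∈ A, ∀ k ∈ A, k ≠ i → k ≠ nx i → 0 < orient (N i) (N (nx i)) (N k)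

/-- The basic identity of the shrinking process: if `c` and `c'` are the ends of side `i`, on the
lines of its neighbours `l` and `r`, then the determinant of the three lines is the signed length
`τ` of the side times the sines of the two turns. For positive turns its sign tells whether the side
still exists. -/
theorem edge_step {l i r c c' : ℝ × ℝ} (hi : dot i i = 1) (h : dot i c = dot i c') :
    ∃ τ : ℝ, c' = (c.1 - τ * i.2, c.2 + τ * i.1) ∧
      tripleDet l i r (dot l c) (dot i c) (dot r c') = cross l i * cross i r * τ := by
  refine ⟨i.1 * (c'.2 - c.2) - i.2 * (c'.1 - c.1), ?_, ?_⟩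
  · unfold dot at hi h
    ext
    · simp only
      linear_combination (-c'.1 + c.1) * hi - i.1 * h
    · simp only
      linear_combination (-c'.2 + c.2) * hi - i.2 * h
  · unfold dot at hi h
    unfold tripleDet cross dot
    linear_combination (r.2 * (c'.2 - c.2) + r.1 * (c'.1 - c.1)) * (l.1 * i.2 - l.2 * i.1) * (-hi) +
      (r.1 * i.1 + r.2 * i.2) * (l.1 * i.2 - l.2 * i.1) * (-h)

namespace CyclicList

variable {N : ℕ → ℝ × ℝ} {A : Finset ℕ} {nx pv : ℕ → ℕ}

theorem nx_ne (h : CyclicList N A nx pv) {i : ℕ} (hi : i ∈ A) : nx i ≠ i := by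
  intro e
  have := h.cross_pos i hi
  rw [e, cross_self] at this
  exact this.false

theorem pv_ne (h : CyclicList N A nx pv) {i : ℕ} (hi : i ∈ A) : pv i ≠ i := by
  intro e
  have := h.nx_pv i hi
  rw [e] at this
  exact h.nx_ne hi this

theorem nx_ne_pv (h : CyclicList N A nx pv) {i : ℕ} (hi : i ∈ A) : nx i ≠ pv i := by
  intro e
  have h1 := h.cross_pos i hi
  have h2 := h.cross_pos _ (h.pv_mem i hi)
  rw [h.nx_pv i hi, cross_swap, ← e] at h2
  linarith

theorem cross_pv_pos (h : CyclicList N A nx pv) {i : ℕ} (hi : i ∈ A) :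
    0 < cross (N (pv i)) (N i) := by
  have := h.cross_pos _ (h.pv_mem i hi)
  rwa [h.nx_pv i hi] at this

theorem orient_pv_pos (h : CyclicList N A nx pv) {i : ℕ} (hi : i ∈ A) :
    0 < orient (N (pv i)) (N i) (N (nx i)) := by
  have := h.orient_pos _ (h.pv_mem i hi) (nx i) (h.nx_mem i hi) (h.nx_ne_pv hi)
  rw [h.nx_pv i hi] at this
  exact this (h.nx_ne hi)

variable {a : ℕ → ℝ}

/-- The corner of the polygon with offsets `a` between the sides `i` and `nx i`. -/
noncomputable def corner (N : ℕ → ℝ × ℝ) (nx : ℕ → ℕ) (a : ℕ → ℝ) (i : ℕ) : ℝ × ℝ :=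
  CircleQuery.corner (N i) (N (nx i)) (a i) (a (nx i))

theorem dot_corner (h : CyclicList N A nx pv) {i : ℕ} (hi : i ∈ A) :
    dot (N i) (corner N nx a i) = a i := dot_corner_left (h.cross_pos i hi).ne' _ _

theorem dot_corner_nx (h : CyclicList N A nx pv) {i : ℕ} (hi : i ∈ A) :
    dot (N (nx i)) (corner N nx a i) = a (nx i) := dot_corner_right (h.cross_pos i hi).ne' _ _

theorem dot_corner_pv (h : CyclicList N A nx pv) {i : ℕ} (hi : i ∈ A) :
    dot (N i) (corner N nx a (pv i)) = a i := by
  have := h.dot_corner_nx (a := a) (h.pv_mem i hi)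
  rwa [h.nx_pv i hi] at this

theorem exists_edge (h : CyclicList N A nx pv) {i : ℕ} (hi : i ∈ A)
    (ha : 0 ≤ tripleDet (N (pv i)) (N i) (N (nx i)) (a (pv i)) (a i) (a (nx i))) :
    ∃ τ : ℝ, 0 ≤ τ ∧ corner N nx a i = ((corner N nx a (pv i)).1 - τ * (N i).2,
      (corner N nx a (pv i)).2 + τ * (N i).1) := by
  obtain ⟨τ, h1, h2⟩ := edge_step (l := N (pv i)) (r := N (nx i)) (h.unit i hi)
    ((h.dot_corner_pv (a := a) hi).trans (h.dot_corner hi).symm)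
  refine ⟨τ, ?_, h1⟩
  rw [h.dot_corner (h.pv_mem i hi), h.dot_corner_pv hi, h.dot_corner_nx hi] at h2
  rw [h2] at ha
  exact nonneg_of_mul_nonneg_right ha (mul_pos (h.cross_pv_pos hi) (h.cross_pos i hi))

/-- A cyclic list of sides of nonnegative lengths bounds a convex polygon. -/
theorem dot_corner_le (h : CyclicList N A nx pv)
    (ha : ∀ i ∈ A, 0 ≤ tripleDet (N (pv i)) (N i) (N (nx i)) (a (pv i)) (a i) (a (nx i)))
    {j k : ℕ} (hj : j ∈ A) (hk : k ∈ A) : dot (N k) (corner N nx a j) ≤ a k := by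
  have uk := h.unit k hk
  -- Cut open at `k`, the cyclic list is linearly ordered by `stereo (N k)`, decreasing along `nx`.
  have inj : ∀ e ∈ A, ∀ f ∈ A, f = nx e → e ≠ k → f ≠ k →
      0 < orient (N k) (N e) (N f) := by
    rintro e he f - rfl hek hfk
    rw [← orient_rotate]
    exact h.orient_pos e he k hk hek.symm hfk.symm
  have fwd : ∀ e ∈ A, 0 ≤ cross (N k) (N e) → dot (N k) (corner N nx a e) ≤ a k := by
    by_contra! hc
    have hB : (A.filter fun e => 0 ≤ cross (N k) (N e) ∧ a k < dot (N k) (corner N nx a e)).Nonempty := by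
      obtain ⟨e, he⟩ := hc
      exact ⟨e, by simpa using he⟩
    -- The largest `stereo` is the smallest angle from `N k`: `e` is the first offender, so the
    -- corner before it is still on the right side of line `k`.
    obtain ⟨e, he, hmax⟩ := Finset.exists_max_image _ (fun e => stereo (N k) (N e)) hB
    simp only [Finset.mem_filter] at he hmax
    obtain ⟨heA, hce, hbad⟩ := he
    have hek : e ≠ k := by
      rintro rfl
      rw [h.dot_corner heA] at hbad
      exact hbad.false
    obtain ⟨τ, hτ, hstep⟩ := h.exists_edge heA (ha e heA)
    have hprev : dot (N k) (corner N nx a (pv e)) ≤ a k := by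
      by_cases hpk : pv e = k
      · rw [hpk, h.dot_corner hk]
      · by_contra! hb
        have ho := inj (pv e) (h.pv_mem e heA) e heA (h.nx_pv e heA).symm hpk hek
        have u1 := h.unit _ (h.pv_mem e heA)
        have u2 := h.unit _ heA
        have hne := ne_of_orient_ne_zero ho.ne'
        have := hmax (pv e) ⟨h.pv_mem e heA, (cross_pos_of_orient uk u1 u2 ho hce).le, hb⟩
        rw [orient_pos_iff uk u1 u2 hne.1 hne.2.2] at ho
        linarith
    -- Within a half turn of `N k`, walking along a side of length `τ ≥ 0` leads away from line `k`,
    -- so no first offender can exist.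
    have : dot (N k) (corner N nx a e) =
        dot (N k) (corner N nx a (pv e)) - τ * cross (N k) (N e) := by
      rw [hstep]; unfold dot cross; ring
    nlinarith
  have bwd : ∀ e ∈ A, cross (N k) (N e) ≤ 0 → dot (N k) (corner N nx a (pv e)) ≤ a k := by
    by_contra! hc
    have hB : (A.filter fun e => cross (N k) (N e) ≤ 0 ∧ a k < dot (N k) (corner N nx a (pv e))).Nonempty := by
      obtain ⟨e, he⟩ := hc
      exact ⟨e, by simpa using he⟩
    -- The mirror image: the last offender in the other half turn, refuted by walking backwards.
    obtain ⟨e, he, hmin⟩ := Finset.exists_min_image _ (fun e => stereo (N k) (N e)) hB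
    simp only [Finset.mem_filter] at he hmin
    obtain ⟨heA, hce, hbad⟩ := he
    have hek : e ≠ k := by
      rintro rfl
      rw [h.dot_corner_pv heA] at hbad
      exact hbad.false
    obtain ⟨τ, hτ, hstep⟩ := h.exists_edge heA (ha e heA)
    have hnext : dot (N k) (corner N nx a e) ≤ a k := by
      by_cases hpk : nx e = k
      · rw [← hpk, h.dot_corner_nx heA]
      · by_contra! hb
        have ho := inj e heA (nx e) (h.nx_mem e heA) rfl hek hpk
        have u1 := h.unit _ (h.nx_mem e heA)
        have u2 := h.unit _ heA
        have hne := ne_of_orient_ne_zero ho.ne'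
        have hneg : cross (N k) (N (nx e)) ≤ 0 := by
          by_contra! hp
          linarith [cross_pos_of_orient uk u2 u1 ho hp.le]
        have := hmin (nx e) ⟨h.nx_mem e heA, hneg, by rwa [h.pv_nx e heA]⟩
        rw [orient_pos_iff uk u2 u1 hne.1 hne.2.2] at ho
        linarith
    have : dot (N k) (corner N nx a e) =
        dot (N k) (corner N nx a (pv e)) - τ * cross (N k) (N e) := by
      rw [hstep]; unfold dot cross; ring
    nlinarith
  rcases le_or_gt 0 (cross (N k) (N j)) with hc | hc
  · exact fwd j hj hc
  · by_cases hpk : nx j = k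
    · rw [← hpk, h.dot_corner_nx hj]
    · have hjk : j ≠ k := by rintro rfl; simp [cross_self] at hc
      have hneg : cross (N k) (N (nx j)) ≤ 0 := by
        by_contra! hp
        linarith [cross_pos_of_orient uk (h.unit _ hj) (h.unit _ (h.nx_mem j hj))
          (inj j hj _ (h.nx_mem j hj) rfl hjk hpk) hp.le]
      have := bwd (nx j) (h.nx_mem j hj) hneg
      rwa [h.pv_nx j hj] at this

/-- Only the conditions at the new pair `pv i`, `nx i` are new. A third normal avoids the arcs from
`pv i` to `i` and from `i` to `nx i`, hence their union, by `orient_trans`. -/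
theorem remove (h : CyclicList N A nx pv) {i : ℕ} (hi : i ∈ A)
    (hc : 0 < cross (N (pv i)) (N (nx i))) :
    CyclicList N (A.erase i) (Function.update nx (pv i) (nx i))
      (Function.update pv (nx i) (pv i)) := by
  have hl := h.pv_mem i hi
  have hr := h.nx_mem i hi
  have nxl := h.nx_pv i hi
  have pvr := h.pv_nx i hi
  have inj1 : ∀ j ∈ A, nx j = i → j = pv i := fun j hj e => by rw [← e, h.pv_nx j hj]
  have inj2 : ∀ j ∈ A, pv j = i → j = nx i := fun j hj e => by rw [← e, h.nx_pv j hj]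
  constructor
  · exact fun j hj => h.unit j (Finset.mem_of_mem_erase hj)
  · intro j hj
    rw [Finset.mem_erase] at hj ⊢
    by_cases e : j = pv i
    · subst e; simpa using ⟨h.nx_ne hi, hr⟩
    · rw [Function.update_of_ne e]
      exact ⟨fun e' => e (inj1 j hj.2 e'), h.nx_mem j hj.2⟩
  · intro j hj
    rw [Finset.mem_erase] at hj ⊢
    by_cases e : j = nx i
    · subst e; simpa using ⟨h.pv_ne hi, hl⟩
    · rw [Function.update_of_ne e]
      exact ⟨fun e' => e (inj2 j hj.2 e'), h.pv_mem j hj.2⟩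
  · intro j hj
    rw [Finset.mem_erase] at hj
    by_cases e : j = pv i
    · subst e; simp
    · rw [Function.update_of_ne e, Function.update_of_ne, h.pv_nx j hj.2]
      intro e'
      apply hj.1
      rw [← h.pv_nx j hj.2, e', pvr]
  · intro j hj
    rw [Finset.mem_erase] at hj
    by_cases e : j = nx i
    · subst e; simp
    · rw [Function.update_of_ne e, Function.update_of_ne, h.nx_pv j hj.2]
      intro e'
      apply hj.1
      rw [← h.nx_pv j hj.2, e', nxl]
  · intro j hj
    rw [Finset.mem_erase] at hj
    by_cases e : j = pv i
    · subst e; simpa using hc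
    · rw [Function.update_of_ne e]
      exact h.cross_pos j hj.2
  · intro j hj k hk
    rw [Finset.mem_erase] at hj hk
    by_cases e : j = pv i
    · subst e
      intro h1 h2
      rw [Function.update_self] at h2 ⊢
      have o1 := h.orient_pos _ hl k hk.2 h1 (by rw [nxl]; exact hk.1)
      rw [nxl] at o1
      have o2 := h.orient_pos _ hi k hk.2 hk.1 h2
      rw [orient_rotate] at o1 o2 ⊢
      exact orient_trans (h.unit k hk.2) (h.unit _ hl) (h.unit _ hi) (h.unit _ hr) o1 o2
    · rw [Function.update_of_ne e]
      exact h.orient_pos j hj.2 k hk.2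

end CyclicList

/-! ### The shrinking polygon and its events. -/

/-- The circle with centre `o` and radius `r` is inside the first `n` halfplanes. -/
def Feasible (n : ℕ) (N : ℕ → ℝ × ℝ) (d : ℕ → ℝ) (o : ℝ × ℝ) (r : ℝ) : Prop :=
  ∀ i < n, dot (N i) o + r ≤ d i

/-- The three-plane determinant of the side `i` of the shrinking polygon and its neighbours. -/
def sideDet (N : ℕ → ℝ × ℝ) (d : ℕ → ℝ) (nx pv : ℕ → ℕ) (i : ℕ) : ℝ :=
  tripleDet (N (pv i)) (N i) (N (nx i)) (d (pv i)) (d i) (d (nx i))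

/-- The orientation determinant of the side `i` of the shrinking polygon and its neighbours. -/
def sideOrient (N : ℕ → ℝ × ℝ) (nx pv : ℕ → ℕ) (i : ℕ) : ℝ :=
  orient (N (pv i)) (N i) (N (nx i))

/-- The polygon shrunk by `ρ`, with the sides in `A` surviving. -/
structure Shrunk (n : ℕ) (N : ℕ → ℝ × ℝ) (d : ℕ → ℝ) (A : Finset ℕ) (nx pv : ℕ → ℕ)
    (ρ : ℝ) : Prop extends CyclicList N A nx pv where
  lt : ∀ i ∈ A, i < n
  le : ∀ i ∈ A, ρ * sideOrient N nx pv i ≤ sideDet N d nx pv i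
  feasible : ∀ o r, ρ ≤ r → (∀ i ∈ A, dot (N i) o + r ≤ d i) → Feasible n N d o r

namespace Shrunk

variable {n : ℕ} {N : ℕ → ℝ × ℝ} {d : ℕ → ℝ} {A : Finset ℕ} {nx pv : ℕ → ℕ} {ρ : ℝ}

theorem advance (h : Shrunk n N d A nx pv ρ) {ρ' : ℝ} (hρ : ρ ≤ ρ')
    (h' : ∀ i ∈ A, ρ' * sideOrient N nx pv i ≤ sideDet N d nx pv i) :
    Shrunk n N d A nx pv ρ' :=
  { h with
    le := h'
    feasible := fun o r hr => h.feasible o r (hρ.trans hr) }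

/-- Subtracting `ρ` from all offsets turns `le` into nonnegativity of all side lengths, so
`dot_corner_le` applies. -/
theorem feasible_corner (h : Shrunk n N d A nx pv ρ) {j : ℕ} (hj : j ∈ A) :
    Feasible n N d (CyclicList.corner N nx (fun i => d i - ρ) j) ρ := by
  refine h.feasible _ _ le_rfl fun k hk => ?_
  have := h.toCyclicList.dot_corner_le (a := fun i => d i - ρ) (fun i hi => ?_) hj hk
  · linarith
  · rw [tripleDet_sub]
    have := h.le i hi
    unfold sideOrient sideDet at this
    linarith

/-- At the vanishing radius the side has length zero, so a single circle touches it and both its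
neighbours. -/
theorem corner_pv_eq (h : Shrunk n N d A nx pv ρ) {i : ℕ} (hi : i ∈ A)
    (he : ρ * sideOrient N nx pv i = sideDet N d nx pv i) :
    CyclicList.corner N nx (fun i => d i - ρ) i =
      CyclicList.corner N nx (fun i => d i - ρ) (pv i) := by
  have ht : dot (N i) (CyclicList.corner N nx (fun i => d i - ρ) (pv i)) =
      dot (N i) (CyclicList.corner N nx (fun i => d i - ρ) i) := by
    rw [h.dot_corner_pv hi, h.dot_corner hi]
  obtain ⟨τ, h1, h2⟩ := edge_step (l := N (pv i)) (r := N (nx i)) (h.unit i hi) ht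
  rw [h.dot_corner (h.pv_mem i hi), h.dot_corner_pv hi, h.dot_corner_nx hi, tripleDet_sub] at h2
  have h3 : cross (N (pv i)) (N i) * cross (N i) (N (nx i)) * τ = 0 := by
    rw [← h2, sub_eq_zero]; exact he.symm
  have h4 := mul_pos (h.cross_pv_pos hi) (h.cross_pos i hi)
  rcases mul_eq_zero.1 h3 with h5 | h5
  · exact absurd h5 h4.ne'
  · rw [h1, h5]; simp

/-- Zero is a combination of the three normals with nonnegative coefficients, namely their pairwise
cross products, whose sum is `orient`. The same combination of the three constraints bounds the
radius. -/
theorem le_of_cross_nonpos (h : Shrunk n N d A nx pv ρ) {i : ℕ} (hi : i ∈ A)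
    (he : ρ * sideOrient N nx pv i = sideDet N d nx pv i)
    (hc : cross (N (pv i)) (N (nx i)) ≤ 0) {o : ℝ × ℝ} {r : ℝ} (hf : Feasible n N d o r) :
    r ≤ ρ := by
  have h1 := hf _ (h.lt _ (h.pv_mem i hi))
  have h2 := hf _ (h.lt _ hi)
  have h3 := hf _ (h.lt _ (h.nx_mem i hi))
  have c1 := h.cross_pos i hi
  have c2 := h.cross_pv_pos hi
  rw [cross_swap] at hc
  have hc' : 0 ≤ cross (N (nx i)) (N (pv i)) := by linarith
  have ho := h.orient_pv_pos hi
  unfold sideOrient sideDet tripleDet at he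
  have hz : cross (N i) (N (nx i)) * dot (N (pv i)) o + cross (N (nx i)) (N (pv i)) * dot (N i) o
      + cross (N (pv i)) (N i) * dot (N (nx i)) o = 0 := by
    unfold cross dot; ring
  have k1 := mul_le_mul_of_nonneg_left h1 c1.le
  have k2 := mul_le_mul_of_nonneg_left h2 hc'
  have k3 := mul_le_mul_of_nonneg_left h3 c2.le
  have : r * orient (N (pv i)) (N i) (N (nx i)) ≤ ρ * orient (N (pv i)) (N i) (N (nx i)) := by
    rw [he]
    have : orient (N (pv i)) (N i) (N (nx i)) = cross (N (pv i)) (N i) + cross (N i) (N (nx i))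
      + cross (N (nx i)) (N (pv i)) := rfl
    rw [this]
    linarith
  exact le_of_mul_le_mul_right this ho

/-- The vanished side has shrunk to the point `p`, so its neighbours keep their ends and lengths.
Its constraint is redundant from then on: `N i` is a nonnegative combination of the neighbouring
normals with coefficients of sum greater than `1`, so for `r ≥ ρ` the neighbours' constraints imply
it. -/
theorem remove (h : Shrunk n N d A nx pv ρ) {i : ℕ} (hi : i ∈ A)
    (he : ρ * sideOrient N nx pv i = sideDet N d nx pv i)
    (hc : 0 < cross (N (pv i)) (N (nx i))) :
    Shrunk n N d (A.erase i) (Function.update nx (pv i) (nx i))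
      (Function.update pv (nx i) (pv i)) ρ := by
  have hl := h.pv_mem i hi
  have hr := h.nx_mem i hi
  have nxl := h.nx_pv i hi
  have pvr := h.pv_nx i hi
  have R := h.toCyclicList.remove hi hc
  have hcorner := h.corner_pv_eq hi he
  set p := CyclicList.corner N nx (fun i => d i - ρ) i with hp
  have tl : dot (N (pv i)) p = d (pv i) - ρ := by rw [hcorner, h.dot_corner hl]
  have ti : dot (N i) p = d i - ρ := h.dot_corner hi
  have tr : dot (N (nx i)) p = d (nx i) - ρ := h.dot_corner_nx hi
  refine { R with lt := ?_, le := ?_, feasible := ?_ }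
  · exact fun j hj => h.lt j (Finset.mem_of_mem_erase hj)
  · intro j hj
    have hj' := Finset.mem_erase.1 hj
    -- The length of side `j` between `c` and `c'` does not depend on which lines cut it there:
    -- nonnegativity is read off from the old neighbours `a'`, `b'` and transferred to the
    -- determinant of the new neighbours `a`, `b`.
    have key : ∀ a b : ℕ, a ∈ A → b ∈ A → 0 < cross (N a) (N j) → 0 < cross (N j) (N b) →
        ∀ c c' : ℝ × ℝ, dot (N a) c = d a - ρ → dot (N j) c = d j - ρ →
        dot (N j) c' = d j - ρ → dot (N b) c' = d b - ρ →
        ∀ a' b', 0 < cross a' (N j) → 0 < cross (N j) b' →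
        0 ≤ tripleDet a' (N j) b' (dot a' c) (dot (N j) c) (dot b' c') →
        ρ * orient (N a) (N j) (N b) ≤ tripleDet (N a) (N j) (N b) (d a) (d j) (d b) := by
      intro a b ha hb hca hcb c c' t1 t2 t3 t4 a' b' ca' cb' hT
      obtain ⟨τ, e1, e2⟩ := edge_step (l := a') (r := b') (h.unit j hj'.2) (t2.trans t3.symm)
      obtain ⟨τ', e1', e2'⟩ := edge_step (l := N a) (r := N b) (h.unit j hj'.2) (t2.trans t3.symm)
      rw [e2] at hT
      have hτ := nonneg_of_mul_nonneg_right hT (mul_pos ca' cb')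
      have hττ : τ = τ' := by
        rw [e1'] at e1
        have u := h.unit j hj'.2
        simp only [Prod.mk.injEq] at e1
        unfold dot at u
        linear_combination (τ' - τ) * u + (N j).2 * e1.1 - (N j).1 * e1.2
      rw [t1, t2, t4, tripleDet_sub] at e2'
      rw [← hττ] at e2'
      have := mul_nonneg (mul_pos hca hcb).le hτ
      linarith
    by_cases e1 : j = pv i
    · subst e1
      by_cases e2 : pv i = nx i
      · exact absurd e2.symm (h.nx_ne_pv hi)
      · unfold sideOrient sideDet
        rw [Function.update_self, Function.update_of_ne e2]
        have hpl := h.pv_mem _ hl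
        refine key _ _ hpl hr (h.cross_pv_pos hl) hc
          (CyclicList.corner N nx (fun i => d i - ρ) (pv (pv i))) p (h.dot_corner hpl)
          (h.dot_corner_pv hl) tl tr (N (pv (pv i))) (N i) (h.cross_pv_pos hl) (h.cross_pv_pos hi) ?_
        rw [h.dot_corner hpl, h.dot_corner_pv hl, ti, tripleDet_sub]
        have := h.le _ hl
        unfold sideOrient sideDet at this
        rw [nxl] at this
        linarith
    · by_cases e2 : j = nx i
      · subst e2
        unfold sideOrient sideDet
        rw [Function.update_self, Function.update_of_ne e1]
        have hpr := h.nx_mem _ hr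
        refine key _ _ hl hpr hc (h.cross_pos _ hr) p
          (CyclicList.corner N nx (fun i => d i - ρ) (nx i)) tl tr (h.dot_corner hr)
          (h.dot_corner_nx hr) (N i) (N (nx (nx i))) (h.cross_pos _ hi) (h.cross_pos _ hr) ?_
        rw [tr, ti, h.dot_corner_nx hr, tripleDet_sub]
        have := h.le _ hr
        unfold sideOrient sideDet at this
        rw [pvr] at this
        linarith
      · have := h.le j hj'.2
        unfold sideOrient sideDet at this ⊢
        rwa [Function.update_of_ne e1, Function.update_of_ne e2]
  · intro o r hρ ho
    refine h.feasible o r hρ fun k hk => ?_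
    by_cases hki : k = i
    · subst hki
      have h1 := ho _ (Finset.mem_erase.2 ⟨h.pv_ne hk, hl⟩)
      have h2 := ho _ (Finset.mem_erase.2 ⟨h.nx_ne hk, hr⟩)
      have k1 := mul_le_mul_of_nonneg_left h1 (h.cross_pos k hk).le
      have k2 := mul_le_mul_of_nonneg_left h2 (h.cross_pv_pos hk).le
      have hO := h.orient_pv_pos hk
      have k3 := mul_le_mul_of_nonneg_right hρ hO.le
      unfold sideOrient sideDet tripleDet at he
      -- The linear relation among three plane vectors; it eliminates the centre.
      have hz : cross (N k) (N (nx k)) * dot (N (pv k)) o + cross (N (nx k)) (N (pv k)) * dot (N k) o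
          + cross (N (pv k)) (N k) * dot (N (nx k)) o = 0 := by
        unfold cross dot; ring
      have e0 : orient (N (pv k)) (N k) (N (nx k)) = cross (N (pv k)) (N k) +
        cross (N k) (N (nx k)) + cross (N (nx k)) (N (pv k)) := rfl
      rw [cross_swap (N (nx k))] at hz e0 he
      refine le_of_mul_le_mul_left ?_ hc
      rw [e0] at k3 he
      nlinarith
    · exact ho k (Finset.mem_erase.2 ⟨hki, hk⟩)

end Shrunk

end CircleQuery

/-! ### The forest of touching circles. -/

namespace CircleQuery

/-- The cyclic successor of `i` below `n`. -/
def succIdx (n i : ℕ) : ℕ := if i + 1 < n then i + 1 else 0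

/-- The circle of the node `p` touches both sides of the chord of the node `c`, and the cone of
the chord of `p` contains the one of `c`. -/
structure IsParent (N : ℕ → ℝ × ℝ) (d : ℕ → ℝ) (P : ℕ → ℝ × ℝ) (R : ℕ → ℝ) (ch : ℕ → ℕ × ℕ)
    (rk : ℕ → ℕ) (c p : ℕ) : Prop where
  radius_pos : 0 < R p
  tight_left : dot (N (ch c).1) (P p) + R p = d (ch c).1
  tight_right : dot (N (ch c).2) (P p) + R p = d (ch c).2
  cone_left : InCone (N (ch p).1) (N (ch p).2) (N (ch c).1)
  cone_right : InCone (N (ch p).1) (N (ch p).2) (N (ch c).2)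
  rk_lt : rk c < rk p

/-- The forest of circles touching two or three sides built so far by the shrinking process;
`V` is the set of nodes, `ch` gives their chords and `rk` bounds their heights. -/
structure Forest (n : ℕ) (N : ℕ → ℝ × ℝ) (d : ℕ → ℝ) (A : Finset ℕ) (nx chord par : ℕ → ℕ)
    (P : ℕ → ℝ × ℝ) (R : ℕ → ℝ) (V : ℕ → Prop) (ch : ℕ → ℕ × ℕ) (rk : ℕ → ℕ) : Prop where
  fresh : ∀ i ∈ A, ¬ V (n + i)
  lt : ∀ c, V c → c < 2 * n
  feasible : ∀ c, V c → Feasible n N d (P c) (R c)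
  radius_nonneg : ∀ c, V c → 0 ≤ R c
  tight_left : ∀ c, V c → dot (N (ch c).1) (P c) + R c = d (ch c).1
  tight_right : ∀ c, V c → dot (N (ch c).2) (P c) + R c = d (ch c).2
  chord_lt : ∀ c, V c → (ch c).1 < n ∧ (ch c).2 < n
  chord_mem : ∀ j ∈ A, V (chord j)
  ch_chord : ∀ j ∈ A, ch (chord j) = (j, nx j)
  step : ∀ c, V c → (∃ j ∈ A, chord j = c) ∨ V (par c) ∧ IsParent N d P R ch rk c (par c)
  rk_le : ∀ c, V c → rk c + A.card ≤ n
  leaf : ∀ c < n, V c ∧ ch c = (c, succIdx n c) ∧ R c = 0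

/-- The complete forest, whose roots are largest circles of the polygon. -/
structure Climb (n : ℕ) (N : ℕ → ℝ × ℝ) (d : ℕ → ℝ) (par : ℕ → ℕ) (P : ℕ → ℝ × ℝ) (R : ℕ → ℝ)
    (V : ℕ → Prop) (ch : ℕ → ℕ × ℕ) (rk : ℕ → ℕ) : Prop where
  feasible : ∀ c, V c → Feasible n N d (P c) (R c)
  radius_nonneg : ∀ c, V c → 0 ≤ R c
  tight_left : ∀ c, V c → dot (N (ch c).1) (P c) + R c = d (ch c).1
  tight_right : ∀ c, V c → dot (N (ch c).2) (P c) + R c = d (ch c).2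
  chord_lt : ∀ c, V c → (ch c).1 < n ∧ (ch c).2 < n
  step : ∀ c, V c → (par c = c ∧ 0 < R c ∧ ∀ o r, Feasible n N d o r → r ≤ R c) ∨
    V (par c) ∧ IsParent N d P R ch rk c (par c)
  rk_le : ∀ c, V c → rk c ≤ n + 1
  leaf : ∀ c < n, V c ∧ ch c = (c, succIdx n c) ∧ R c = 0

namespace Forest

variable {n : ℕ} {N : ℕ → ℝ × ℝ} {d : ℕ → ℝ} {A : Finset ℕ} {nx pv chord par : ℕ → ℕ}
  {P : ℕ → ℝ × ℝ} {R : ℕ → ℝ} {V : ℕ → Prop} {ch : ℕ → ℕ × ℕ} {rk : ℕ → ℕ}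

theorem chord_inj (h : Forest n N d A nx chord par P R V ch rk) {i j : ℕ} (hi : i ∈ A)
    (hj : j ∈ A) (e : chord i = chord j) : i = j := by
  have h1 := h.ch_chord i hi
  rw [e, h.ch_chord j hj] at h1
  exact (Prod.mk.inj h1).1.symm

/-- The node `n + i` becomes the parent of the nodes at both ends of the vanished side `i`, and then
stands for the new pair of neighbours `pv i`, `nx i`. -/
theorem remove (h : Forest n N d A nx chord par P R V ch rk) (hA : CyclicList N A nx pv)
    (hlt : ∀ i ∈ A, i < n) {i : ℕ} (hi : i ∈ A) {p : ℝ × ℝ} {ρ : ℝ} (hρ : 0 < ρ)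
    (hp : Feasible n N d p ρ) (tl : dot (N (pv i)) p + ρ = d (pv i))
    (ti : dot (N i) p + ρ = d i) (tr : dot (N (nx i)) p + ρ = d (nx i))
    (hcone : InCone (N (pv i)) (N (nx i)) (N i)) {P' : ℕ → ℝ × ℝ} {R' : ℕ → ℝ}
    (hP : P' (n + i) = p) (hP' : ∀ c, c ≠ n + i → P' c = P c)
    (hR : R' (n + i) = ρ) (hR' : ∀ c, c ≠ n + i → R' c = R c) :
    ∃ V' ch' rk', Forest n N d (A.erase i) (Function.update nx (pv i) (nx i))
      (Function.update chord (pv i) (n + i))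
      (Function.update (Function.update par (chord (pv i)) (n + i)) (chord i) (n + i))
      P' R' V' ch' rk' := by
  classical
  have hl := hA.pv_mem i hi
  have hne : ∀ c, V c → c ≠ n + i := fun c hc e => h.fresh i hi (e ▸ hc)
  have hli : pv i ≠ i := hA.pv_ne hi
  have hin := hlt i hi
  have hcard : (A.erase i).card + 1 = A.card := Finset.card_erase_add_one hi
  have hAn : A.card ≤ n := by
    have : A ⊆ Finset.range n := fun j hj => Finset.mem_range.2 (hlt j hj)
    simpa using Finset.card_le_card this
  set ch' := Function.update ch (n + i) (pv i, nx i) with hch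
  -- Old ranks are at most `n - A.card` and the set of surviving sides has just lost an element, so
  -- this rank exceeds all of them.
  set rk' := Function.update rk (n + i) (n - (A.erase i).card) with hrk
  have ch_old : ∀ c, V c → ch' c = ch c := fun c hc => Function.update_of_ne (hne c hc) _ _
  have rk_old : ∀ c, V c → rk' c = rk c := fun c hc => Function.update_of_ne (hne c hc) _ _
  have ch_new : ch' (n + i) = (pv i, nx i) := Function.update_self ..
  have rk_new : rk' (n + i) = n - (A.erase i).card := Function.update_self ..
  have old : ∀ c, V c → P' c = P c ∧ R' c = R c := fun c hc =>
    ⟨hP' c (hne c hc), hR' c (hne c hc)⟩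
  refine ⟨fun c => V c ∨ c = n + i, ch', rk', ?_, ?_, ?_, ?_, ?_, ?_, ?_, ?_, ?_, ?_, ?_, ?_⟩
  · rintro j hj (h1 | h1)
    · exact h.fresh j (Finset.mem_of_mem_erase hj) h1
    · exact (Finset.mem_erase.1 hj).1 (by omega)
  · rintro c (hc | rfl)
    · exact h.lt c hc
    · omega
  · rintro c (hc | rfl)
    · rw [(old c hc).1, (old c hc).2]; exact h.feasible c hc
    · rwa [hP, hR]
  · rintro c (hc | rfl)
    · rw [(old c hc).2]; exact h.radius_nonneg c hc
    · rw [hR]; exact hρ.le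
  · rintro c (hc | rfl)
    · rw [(old c hc).1, (old c hc).2, ch_old c hc]; exact h.tight_left c hc
    · rw [hP, hR, ch_new]; exact tl
  · rintro c (hc | rfl)
    · rw [(old c hc).1, (old c hc).2, ch_old c hc]; exact h.tight_right c hc
    · rw [hP, hR, ch_new]; exact tr
  · rintro c (hc | rfl)
    · rw [ch_old c hc]; exact h.chord_lt c hc
    · rw [ch_new]; exact ⟨hlt _ hl, hlt _ (hA.nx_mem i hi)⟩
  · intro j hj
    by_cases e : j = pv i
    · subst e; right; simp
    · left; rw [Function.update_of_ne e]; exact h.chord_mem j (Finset.mem_of_mem_erase hj)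
  · intro j hj
    by_cases e : j = pv i
    · subst e; simp [ch_new]
    · have hjA := Finset.mem_of_mem_erase hj
      rw [Function.update_of_ne e, Function.update_of_ne e, ch_old _ (h.chord_mem j hjA)]
      exact h.ch_chord j hjA
  · rintro c (hc | rfl)
    · have hrkc := h.rk_le c hc
      have rk_lt : rk' c < rk' (n + i) := by
        rw [rk_old c hc, rk_new]; omega
      by_cases e1 : c = chord i
      · subst e1
        right
        rw [Function.update_self]
        refine ⟨Or.inr rfl, ?_, ?_, ?_, ?_, ?_, rk_lt⟩
        all_goals simp only [ch_old _ hc, ch_new, h.ch_chord i hi, hP, hR]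
        exacts [hρ, ti, tr, hcone, InCone.right _ _]
      · by_cases e2 : c = chord (pv i)
        · subst e2
          right
          rw [Function.update_of_ne e1, Function.update_self]
          refine ⟨Or.inr rfl, ?_, ?_, ?_, ?_, ?_, rk_lt⟩
          all_goals simp only [ch_old _ hc, ch_new, h.ch_chord _ hl, hA.nx_pv i hi, hP, hR]
          exacts [hρ, tl, ti, InCone.left _ _, hcone]
        · rw [Function.update_of_ne e1, Function.update_of_ne e2]
          rcases h.step c hc with ⟨j, hj, rfl⟩ | ⟨hV, hs⟩
          · left
            have hji : j ≠ i := fun e => e1 (by rw [e])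
            have hjl : j ≠ pv i := fun e => e2 (by rw [e])
            exact ⟨j, Finset.mem_erase.2 ⟨hji, hj⟩, Function.update_of_ne hjl _ _⟩
          · right
            refine ⟨Or.inl hV, ?_, ?_, ?_, ?_, ?_, ?_⟩
            all_goals simp only [ch_old _ hc, ch_old _ hV, rk_old _ hc, rk_old _ hV,
              (old _ hV).1, (old _ hV).2]
            exacts [hs.1, hs.2, hs.3, hs.4, hs.5, hs.6]
    · left
      exact ⟨pv i, Finset.mem_erase.2 ⟨hli, hl⟩, Function.update_self ..⟩
  · rintro c (hc | rfl)
    · have := h.rk_le c hc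
      rw [rk_old c hc]; omega
    · rw [rk_new]; omega
  · intro c hc
    obtain ⟨h1, h2, h3⟩ := h.leaf c hc
    exact ⟨Or.inl h1, by rw [ch_old c h1, h2], by rw [(old c h1).2, h3]⟩

/-- Each surviving side `j` gets a root `2 * n + j` of its own, even where the circles coincide,
because the cone of a root has to contain the cone of the pair `j`, `nx j`. -/
theorem finish (h : Forest n N d A nx chord par P R V ch rk) (hA : CyclicList N A nx pv)
    (hlt : ∀ i ∈ A, i < n) {ρ : ℝ} (hρ : 0 < ρ)
    (hmax : ∀ o r, Feasible n N d o r → r ≤ ρ) {q : ℕ → ℝ × ℝ}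
    (hq : ∀ j ∈ A, Feasible n N d (q j) ρ ∧ dot (N j) (q j) + ρ = d j ∧
      dot (N (nx j)) (q j) + ρ = d (nx j))
    {par' : ℕ → ℕ} {P' : ℕ → ℝ × ℝ} {R' : ℕ → ℝ}
    (hpar : ∀ j ∈ A, par' (chord j) = 2 * n + j ∧ par' (2 * n + j) = 2 * n + j)
    (hpar' : ∀ c < 2 * n, (∀ j ∈ A, chord j ≠ c) → par' c = par c)
    (hP : ∀ j ∈ A, P' (2 * n + j) = q j ∧ R' (2 * n + j) = ρ)
    (hP' : ∀ c < 2 * n, P' c = P c ∧ R' c = R c) :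
    ∃ V' ch' rk', Climb n N d par' P' R' V' ch' rk' := by
  classical
  set ch' : ℕ → ℕ × ℕ := fun c => if c < 2 * n then ch c else (c - 2 * n, nx (c - 2 * n)) with hc'
  set rk' : ℕ → ℕ := fun c => if c < 2 * n then rk c else n + 1 with hr'
  have ch_old : ∀ c, V c → ch' c = ch c := fun c hc => if_pos (h.lt c hc)
  have rk_old : ∀ c, V c → rk' c = rk c := fun c hc => if_pos (h.lt c hc)
  have ch_new : ∀ j, ch' (2 * n + j) = (j, nx j) := fun j => by simp [hc']
  have rk_new : ∀ j, rk' (2 * n + j) = n + 1 := fun j => by simp [hr']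
  have old : ∀ c, V c → P' c = P c ∧ R' c = R c := fun c hc => hP' c (h.lt c hc)
  refine ⟨fun c => V c ∨ ∃ j ∈ A, c = 2 * n + j, ch', rk', ?_, ?_, ?_, ?_, ?_, ?_, ?_, ?_⟩
  · rintro c (hc | ⟨j, hj, rfl⟩)
    · rw [(old c hc).1, (old c hc).2]; exact h.feasible c hc
    · rw [(hP j hj).1, (hP j hj).2]; exact (hq j hj).1
  · rintro c (hc | ⟨j, hj, rfl⟩)
    · rw [(old c hc).2]; exact h.radius_nonneg c hc
    · rw [(hP j hj).2]; exact hρ.le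
  · rintro c (hc | ⟨j, hj, rfl⟩)
    · rw [(old c hc).1, (old c hc).2, ch_old c hc]; exact h.tight_left c hc
    · rw [(hP j hj).1, (hP j hj).2, ch_new]; exact (hq j hj).2.1
  · rintro c (hc | ⟨j, hj, rfl⟩)
    · rw [(old c hc).1, (old c hc).2, ch_old c hc]; exact h.tight_right c hc
    · rw [(hP j hj).1, (hP j hj).2, ch_new]; exact (hq j hj).2.2
  · rintro c (hc | ⟨j, hj, rfl⟩)
    · rw [ch_old c hc]; exact h.chord_lt c hc
    · rw [ch_new]; exact ⟨hlt j hj, hlt _ (hA.nx_mem j hj)⟩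
  · rintro c (hc | ⟨j, hj, rfl⟩)
    · right
      by_cases e : ∃ j ∈ A, chord j = c
      · obtain ⟨j, hj, rfl⟩ := e
        rw [(hpar j hj).1]
        refine ⟨Or.inr ⟨j, hj, rfl⟩, ?_, ?_, ?_, ?_, ?_, ?_⟩
        all_goals simp only [ch_old _ hc, ch_new, rk_old _ hc, rk_new, h.ch_chord j hj,
          (hP j hj).1, (hP j hj).2]
        exacts [hρ, (hq j hj).2.1, (hq j hj).2.2, InCone.left _ _, InCone.right _ _,
          by have := h.rk_le _ hc; omega]
      · rw [hpar' c (h.lt c hc) fun j hj e' => e ⟨j, hj, e'⟩]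
        obtain ⟨hV, hs⟩ := (h.step c hc).resolve_left e
        refine ⟨Or.inl hV, ?_, ?_, ?_, ?_, ?_, ?_⟩
        all_goals simp only [ch_old _ hc, ch_old _ hV, rk_old _ hc, rk_old _ hV,
          (old _ hV).1, (old _ hV).2]
        exacts [hs.1, hs.2, hs.3, hs.4, hs.5, hs.6]
    · left
      rw [(hpar j hj).2, (hP j hj).2]
      exact ⟨rfl, hρ, hmax⟩
  · rintro c (hc | ⟨j, hj, rfl⟩)
    · have := h.rk_le c hc
      rw [rk_old c hc]; omega
    · rw [rk_new]
  · intro c hc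
    obtain ⟨h1, h2, h3⟩ := h.leaf c hc
    exact ⟨Or.inl h1, by rw [ch_old c h1, h2], by rw [(old c h1).2, h3]⟩

end Forest

/-! ### Optimality of the circles met while climbing. -/

/-- The circle with centre `o` and radius `r` is a largest one inside the first `n` halfplanes and
the query halfplane `0 ≤ dot w o + e`. -/
structure IsBest (n : ℕ) (N : ℕ → ℝ × ℝ) (d : ℕ → ℝ) (w : ℝ × ℝ) (e : ℝ) (o : ℝ × ℝ)
    (r : ℝ) : Prop where
  radius_pos : 0 < r
  feasible : Feasible n N d o r
  query : r ≤ dot w o + e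
  max : ∀ o' r', Feasible n N d o' r' → r' ≤ dot w o' + e → r' ≤ r

/-- Linear programming duality: with `w = x p + y q`, adding `x` times the first and `y` times the
second constraint to the query constraint cancels the centre and leaves `(1 + x + y) r' ≤ (1 + x +
y) r`. -/
theorem le_of_inCone {p q w o o' : ℝ × ℝ} {a b e r r' : ℝ} (hw : InCone p q w)
    (h1 : dot p o + r = a) (h2 : dot q o + r = b) (h3 : dot w o + e ≤ r)
    (h1' : dot p o' + r' ≤ a) (h2' : dot q o' + r' ≤ b) (h3' : r' ≤ dot w o' + e) : r' ≤ r := by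
  obtain ⟨x, y, hx, hy, rfl⟩ := hw
  have k1 := mul_le_mul_of_nonneg_left h1' hx
  have k2 := mul_le_mul_of_nonneg_left h2' hy
  rw [← h1] at k1
  rw [← h2] at k2
  have k : (1 + x + y) * r' ≤ (1 + x + y) * r := by
    unfold dot at *
    simp only at *
    linarith
  exact le_of_mul_le_mul_left k (by positivity)

namespace Climb

variable {n : ℕ} {N : ℕ → ℝ × ℝ} {d : ℕ → ℝ} {par : ℕ → ℕ}
  {P : ℕ → ℝ × ℝ} {R : ℕ → ℝ} {V : ℕ → Prop} {ch : ℕ → ℕ × ℕ} {rk : ℕ → ℕ} {w : ℝ × ℝ} {e : ℝ}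

theorem par_spec (h : Climb n N d par P R V ch rk) {c : ℕ} (hc : V c)
    (hw : InCone (N (ch c).1) (N (ch c).2) w) :
    V (par c) ∧ InCone (N (ch (par c)).1) (N (ch (par c)).2) w := by
  rcases h.step c hc with ⟨h1, -⟩ | ⟨h1, h2⟩
  · rw [h1]; exact ⟨hc, hw⟩
  · exact ⟨h1, hw.trans h2.cone_left h2.cone_right⟩

theorem iterate_spec (h : Climb n N d par P R V ch rk) {c : ℕ} (hc : V c)
    (hw : InCone (N (ch c).1) (N (ch c).2) w) (m : ℕ) :
    V (par^[m] c) ∧ InCone (N (ch (par^[m] c)).1) (N (ch (par^[m] c)).2) w := by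
  induction m with
  | zero => exact ⟨hc, hw⟩
  | succ m ih => rw [Function.iterate_succ_apply']; exact h.par_spec ih.1 ih.2

/-- Ranks increase strictly from a node to its parent and never exceed `n + 1`, so `n + 2` steps
reach a root. -/
theorem par_iterate (h : Climb n N d par P R V ch rk) {c : ℕ} (hc : V c) {m : ℕ}
    (hm : n + 2 ≤ m) : par (par^[m] c) = par^[m] c := by
  have key : ∀ m, V (par^[m] c) ∧ (par (par^[m] c) = par^[m] c ∨ m ≤ rk (par^[m] c)) := by
    intro m
    induction m with
    | zero => exact ⟨hc, Or.inr (Nat.zero_le _)⟩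
    | succ m ih =>
      rw [Function.iterate_succ_apply']
      obtain ⟨hV, ih⟩ := ih
      rcases h.step _ hV with ⟨h1, -⟩ | ⟨h1, h2⟩
      · rw [h1, h1]; exact ⟨hV, Or.inl rfl⟩
      · refine ⟨h1, ?_⟩
        rcases ih with ih | ih
        · rw [ih, ih]; exact Or.inl rfl
        · exact Or.inr (lt_of_le_of_lt ih h2.rk_lt)
  obtain ⟨hV, h1⟩ := key m
  refine h1.resolve_right fun h2 => ?_
  have := h.rk_le _ hV
  omega

theorem isBest_root (h : Climb n N d par P R V ch rk) {c : ℕ} (hc : V c) (hp : par c = c)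
    (hg : 0 < dot w (P c) + e - R c) : IsBest n N d w e (P c) (R c) := by
  rcases h.step c hc with ⟨-, h1, h2⟩ | ⟨-, h2⟩
  · exact ⟨h1, h.feasible c hc, by linarith, fun o r ho _ => h2 o r ho⟩
  · have := h2.rk_lt
    rw [hp] at this
    exact absurd this (lt_irrefl _)

/-- Along the segment from `c` to its parent the circle touches both sides of the chord of `c`, and
the gap is affine; `θ` is where it is zero. There the query line is touched too, and duality
applies. -/
theorem isBest_between (h : Climb n N d par P R V ch rk) {c : ℕ} (hc : V c)
    (hw : InCone (N (ch c).1) (N (ch c).2) w) {g g' θ : ℝ}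
    (hg : g = dot w (P c) + e - R c) (hg' : g' = dot w (P (par c)) + e - R (par c))
    (hpos : 0 < g) (hneg : g' ≤ 0) (hθ : θ = g / (g - g')) :
    IsBest n N d w e ((P c).1 + θ * ((P (par c)).1 - (P c).1),
      (P c).2 + θ * ((P (par c)).2 - (P c).2)) (R c + θ * (R (par c) - R c)) := by
  have hd : 0 < g - g' := by linarith
  have h0 : 0 < θ := by rw [hθ]; positivity
  have h1 : θ ≤ 1 := by rw [hθ, div_le_one hd]; linarith
  have h2 : θ * (g - g') = g := by rw [hθ]; field_simp
  -- `c` is not a root, since the gap has different signs at `c` and at `par c`.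
  obtain ⟨hV, hs⟩ : V (par c) ∧ IsParent N d P R ch rk c (par c) := by
    refine (h.step c hc).resolve_left ?_
    rintro ⟨h3, -⟩
    rw [h3] at hg'
    linarith
  have hR := h.radius_nonneg c hc
  have lin : ∀ v : ℝ × ℝ, dot v ((P c).1 + θ * ((P (par c)).1 - (P c).1),
      (P c).2 + θ * ((P (par c)).2 - (P c).2)) = (1 - θ) * dot v (P c) + θ * dot v (P (par c)) := by
    intro v; unfold dot; ring
  have hr : R c + θ * (R (par c) - R c) = (1 - θ) * R c + θ * R (par c) := by ring
  have hq : (1 - θ) * R c + θ * R (par c) =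
      (1 - θ) * dot w (P c) + θ * dot w (P (par c)) + e := by
    rw [hg, hg'] at h2
    linarith
  refine ⟨?_, ?_, ?_, ?_⟩
  · rw [hr]
    have := mul_pos h0 hs.radius_pos
    have := mul_nonneg (sub_nonneg.2 h1) hR
    linarith
  · intro i hi
    rw [lin, hr]
    have k1 := mul_le_mul_of_nonneg_left (h.feasible c hc i hi) (sub_nonneg.2 h1)
    have k2 := mul_le_mul_of_nonneg_left (h.feasible _ hV i hi) h0.le
    linarith
  · rw [lin, hr, hq]
  · intro o' r' ho' hq'
    obtain ⟨l1, l2⟩ := h.chord_lt c hc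
    refine le_of_inCone (o := ((P c).1 + θ * ((P (par c)).1 - (P c).1),
      (P c).2 + θ * ((P (par c)).2 - (P c).2))) hw ?_ ?_ ?_ (ho' _ l1) (ho' _ l2) hq'
    · rw [lin, hr]
      linear_combination (1 - θ) * h.tight_left c hc + θ * hs.tight_left
    · rw [lin, hr]
      linear_combination (1 - θ) * h.tight_right c hc + θ * hs.tight_right
    · rw [lin, hr, hq]

/-- Duality compares with the circle of radius zero at the leaf. -/
theorem nonpos_of_leaf (h : Climb n N d par P R V ch rk) {c : ℕ} (hc : V c)
    (hw : InCone (N (ch c).1) (N (ch c).2) w) (hR : R c = 0)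
    (hg : dot w (P c) + e - R c ≤ 0) {o : ℝ × ℝ} {r : ℝ} (ho : Feasible n N d o r)
    (hq : r ≤ dot w o + e) : r ≤ 0 := by
  obtain ⟨l1, l2⟩ := h.chord_lt c hc
  have := le_of_inCone hw (h.tight_left c hc) (h.tight_right c hc) (by linarith) (ho _ l1)
    (ho _ l2) hq
  linarith

end Climb

end CircleQuery

/-! ### Sides, normals and halfplanes of a convex polygon. -/

namespace CircleQuery

theorem orient_eq_sub (p q r : ℝ × ℝ) :
    orient p q r = (q.1 - p.1) * (r.2 - p.2) - (q.2 - p.2) * (r.1 - p.1) := by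
  unfold orient cross; ring

theorem succIdx_lt {n i : ℕ} (hi : i < n) : succIdx n i < n := by
  unfold succIdx; split <;> omega

/-- The points `U 0, …, U (n - 1)` are in strictly convex position, in counterclockwise order. -/
def IsCcw (n : ℕ) (U : ℕ → ℝ × ℝ) : Prop :=
  3 ≤ n ∧ ∀ i j k, i < j → j < k → k < n → 0 < orient (U i) (U j) (U k)

/-- The distance of two points. -/
noncomputable def len (p q : ℝ × ℝ) : ℝ :=
  Real.sqrt ((q.1 - p.1) * (q.1 - p.1) + (q.2 - p.2) * (q.2 - p.2))

/-- The unit normal to the right of the direction from `p` to `q`. -/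
noncomputable def normal (p q : ℝ × ℝ) : ℝ × ℝ := ((q.2 - p.2) / len p q, (p.1 - q.1) / len p q)

theorem len_pos {p q : ℝ × ℝ} (h : p ≠ q) : 0 < len p q := by
  refine Real.sqrt_pos.2 ?_
  by_contra! hn
  have h1 : (q.1 - p.1) = 0 := by nlinarith [mul_self_nonneg (q.1 - p.1), mul_self_nonneg (q.2 - p.2)]
  have h2 : (q.2 - p.2) = 0 := by nlinarith [mul_self_nonneg (q.1 - p.1), mul_self_nonneg (q.2 - p.2)]
  exact h (Prod.ext (by linarith) (by linarith))

theorem len_mul_self (p q : ℝ × ℝ) :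
    len p q * len p q = (q.1 - p.1) * (q.1 - p.1) + (q.2 - p.2) * (q.2 - p.2) :=
  Real.mul_self_sqrt (by nlinarith [mul_self_nonneg (q.1 - p.1), mul_self_nonneg (q.2 - p.2)])

theorem dot_normal_self {p q : ℝ × ℝ} (h : p ≠ q) : dot (normal p q) (normal p q) = 1 := by
  have h1 := len_pos h
  have h2 := len_mul_self p q
  unfold dot normal
  field_simp
  linarith

theorem orient_eq_len_mul {p q : ℝ × ℝ} (h : p ≠ q) (x : ℝ × ℝ) :
    orient p q x = len p q * (dot (normal p q) p - dot (normal p q) x) := by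
  have h1 := len_pos h
  unfold dot normal
  field_simp
  rw [orient_eq_sub]; ring

theorem cross_normal {p q r s : ℝ × ℝ} (h : p ≠ q) (h' : r ≠ s) :
    len p q * len r s * cross (normal p q) (normal r s) =
      (q.1 - p.1) * (s.2 - r.2) - (q.2 - p.2) * (s.1 - r.1) := by
  have h1 := len_pos h
  have h2 := len_pos h'
  unfold cross normal
  field_simp
  ring

namespace IsCcw

variable {n : ℕ} {U : ℕ → ℝ × ℝ}

theorem edge (h : IsCcw n U) {i j : ℕ} (hi : i < n) (hj : j < n) (h1 : j ≠ i)
    (h2 : j ≠ succIdx n i) : 0 < orient (U i) (U (succIdx n i)) (U j) := by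
  unfold succIdx at *
  split at h2
  · rename_i hs
    rw [if_pos hs]
    rcases lt_or_gt_of_ne h1 with h3 | h3
    · rw [orient_rotate]; exact h.2 _ _ _ h3 (by omega) hs
    · exact h.2 _ _ _ (by omega) (by omega) hj
  · rename_i hs
    rw [if_neg hs, ← orient_rotate]
    exact h.2 _ _ _ (by omega) (by omega) hi

theorem ne (h : IsCcw n U) {i j : ℕ} (hi : i < n) (hj : j < n) (hij : i ≠ j) : U i ≠ U j := by
  have key : ∀ i j, i < j → j < n → U i ≠ U j := by
    intro i j hij hj
    have hn := h.1
    rcases Nat.eq_zero_or_pos i with h0 | h0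
    · rcases Nat.lt_or_ge (j + 1) n with h1 | h1
      · exact (ne_of_orient_ne_zero (h.2 i j (j + 1) hij (by omega) h1).ne').1
      · exact (ne_of_orient_ne_zero (h.2 i 1 j (by omega) (by omega) hj).ne').2.2
    · exact (ne_of_orient_ne_zero (h.2 0 i j h0 hij hj).ne').2.1
  rcases lt_or_gt_of_ne hij with h1 | h1
  · exact key i j h1 hj
  · exact (key j i h1 hi).symm

theorem ne_succ (h : IsCcw n U) {i : ℕ} (hi : i < n) : U i ≠ U (succIdx n i) := by
  refine h.ne hi (succIdx_lt hi) ?_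
  have := h.1
  unfold succIdx; split <;> omega

end IsCcw

/-- `N` and `d` describe the sides of the polygon `U`. -/
def IsSides (n : ℕ) (U N : ℕ → ℝ × ℝ) (d : ℕ → ℝ) : Prop :=
  ∀ i < n, N i = normal (U i) (U (succIdx n i)) ∧ d i = dot (N i) (U i)

namespace IsSides

variable {n : ℕ} {U N : ℕ → ℝ × ℝ} {d : ℕ → ℝ}

theorem unit (hs : IsSides n U N d) (h : IsCcw n U) {i : ℕ} (hi : i < n) :
    dot (N i) (N i) = 1 := by
  rw [(hs i hi).1]; exact dot_normal_self (h.ne_succ hi)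

theorem orient_eq (hs : IsSides n U N d) (h : IsCcw n U) {i : ℕ} (hi : i < n) (x : ℝ × ℝ) :
    orient (U i) (U (succIdx n i)) x = len (U i) (U (succIdx n i)) * (d i - dot (N i) x) := by
  rw [orient_eq_len_mul (h.ne_succ hi), (hs i hi).2, (hs i hi).1]

theorem le_iff (hs : IsSides n U N d) (h : IsCcw n U) {i : ℕ} (hi : i < n) (x : ℝ × ℝ) :
    dot (N i) x ≤ d i ↔ 0 ≤ orient (U i) (U (succIdx n i)) x := by
  rw [hs.orient_eq h hi, mul_nonneg_iff_of_pos_left (len_pos (h.ne_succ hi)), sub_nonneg]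

theorem lt_iff (hs : IsSides n U N d) (h : IsCcw n U) {i : ℕ} (hi : i < n) (x : ℝ × ℝ) :
    dot (N i) x < d i ↔ 0 < orient (U i) (U (succIdx n i)) x := by
  rw [hs.orient_eq h hi, mul_pos_iff_of_pos_left (len_pos (h.ne_succ hi)), sub_pos]

theorem dot_left (hs : IsSides n U N d) {i : ℕ} (hi : i < n) :
    dot (N i) (U i) = d i := (hs i hi).2.symm

theorem dot_right (hs : IsSides n U N d) (h : IsCcw n U) {i : ℕ} (hi : i < n) :
    dot (N i) (U (succIdx n i)) = d i := by
  have h1 := hs.orient_eq h hi (U (succIdx n i))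
  have h2 : orient (U i) (U (succIdx n i)) (U (succIdx n i)) = 0 := by unfold orient cross; ring
  rw [h2] at h1
  have := (mul_eq_zero.1 h1.symm).resolve_left (len_pos (h.ne_succ hi)).ne'
  linarith

theorem dot_lt (hs : IsSides n U N d) (h : IsCcw n U) {i j : ℕ} (hi : i < n) (hj : j < n)
    (h1 : j ≠ i) (h2 : j ≠ succIdx n i) : dot (N i) (U j) < d i :=
  (hs.lt_iff h hi _).2 (h.edge hi hj h1 h2)

theorem dot_le (hs : IsSides n U N d) (h : IsCcw n U) {i j : ℕ} (hi : i < n) (hj : j < n) :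
    dot (N i) (U j) ≤ d i := by
  by_cases h1 : j = i
  · subst h1; exact (hs.dot_left hi).le
  by_cases h2 : j = succIdx n i
  · subst h2; exact (hs.dot_right h hi).le
  exact (hs.dot_lt h hi hj h1 h2).le

theorem cross_pos (hs : IsSides n U N d) (h : IsCcw n U) {i : ℕ} (hi : i < n) :
    0 < cross (N i) (N (succIdx n i)) := by
  have hi' := succIdx_lt hi
  have n1 := h.ne_succ hi
  have n2 := h.ne_succ hi'
  have hn := h.1
  have h1 := h.edge hi (succIdx_lt hi') (by unfold succIdx; split_ifs <;> omega)
    (by unfold succIdx; split_ifs <;> omega)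
  rw [(hs i hi).1, (hs _ hi').1]
  have h2 := cross_normal n1 n2
  refine pos_of_mul_pos_right (a := len (U i) (U (succIdx n i)) *
    len (U (succIdx n i)) (U (succIdx n (succIdx n i)))) ?_ (mul_pos (len_pos n1) (len_pos n2)).le
  rw [h2]
  rw [orient_eq_sub] at h1
  linarith

/-- The normals occur in the cyclic order of the sides. Otherwise `N k` lies in the cone of two
successive normals; their common vertex maximizes both, hence also `dot (N k)`, so it lies on side
`k`. As `U k` is not on side `i`, `N k` must be a multiple of the normal of side `succIdx n i`, and
that side would contain too many vertices. -/
theorem orient_pos (hs : IsSides n U N d) (h : IsCcw n U) {i k : ℕ} (hi : i < n) (hk : k < n)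
    (h1 : k ≠ i) (h2 : k ≠ succIdx n i) : 0 < orient (N i) (N (succIdx n i)) (N k) := by
  by_contra! hn
  have hi' := succIdx_lt hi
  have hk' := succIdx_lt hk
  have h3 := h.1
  obtain ⟨x, y, hx, hy, e⟩ := inCone_of_orient (hs.unit h hi) (hs.unit h hi') (hs.unit h hk)
    (hs.cross_pos h hi) (by rw [orient_swap]; linarith)
  have hlin : ∀ v, dot (N k) v = x * dot (N i) v + y * dot (N (succIdx n i)) v := by
    intro v; rw [e]; unfold dot; ring
  have a1 := hs.dot_le h hk hi'
  have a2 := hs.dot_lt h hi hk h1 h2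
  have a3 := hs.dot_le h hi' hk
  rw [← hs.dot_left hk, hlin, hlin (U k), hs.dot_right h hi, hs.dot_left hi'] at a1
  have b2 := mul_le_mul_of_nonneg_left a3 hy
  have hx0 : x = 0 := by
    by_contra hx0
    have : 0 < x := lt_of_le_of_ne hx (Ne.symm hx0)
    have := mul_lt_mul_of_pos_left a2 this
    linarith
  have hy0 : 0 < y := by
    refine lt_of_le_of_ne hy fun hy0 => ?_
    have := hs.unit h hk
    rw [e, hx0, ← hy0] at this
    simp [dot] at this
  have c1 : dot (N (succIdx n i)) (U k) = d (succIdx n i) := by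
    subst hx0
    refine le_antisymm a3 ?_
    refine le_of_mul_le_mul_left ?_ hy0
    linarith
  have c2 : dot (N (succIdx n i)) (U (succIdx n k)) = d (succIdx n i) := by
    have h5 := hs.dot_right h hk
    rw [← hs.dot_left hk, hlin, hlin (U k), hx0, c1] at h5
    simpa [hy0.ne'] using h5
  have e1 : k = succIdx n (succIdx n i) := by
    by_contra hne
    exact (hs.dot_lt h hi' hk h2 hne).ne c1
  have e2 : succIdx n k ≠ succIdx n i := by
    revert h1 h2; unfold succIdx; split_ifs <;> omega
  have e3 : succIdx n k ≠ succIdx n (succIdx n i) := by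
    rw [← e1]; unfold succIdx; split_ifs <;> omega
  exact (hs.dot_lt h hi' hk' e2 e3).ne c2

/-- A discrete intermediate value theorem that locates a point in the fan of triangles with apex `U
0`. -/
theorem exists_sign_change {f : ℕ → ℝ} {m : ℕ} (h1 : 0 ≤ f 1) (hm : f m ≤ 0) (h : 2 ≤ m) :
    ∃ i, 1 ≤ i ∧ i < m ∧ 0 ≤ f i ∧ f (i + 1) ≤ 0 := by
  induction m, h using Nat.le_induction with
  | base => exact ⟨1, le_rfl, by omega, h1, hm⟩
  | succ m hle ih =>
    rcases le_total 0 (f m) with hp | hp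
    · exact ⟨m, by omega, by omega, hp, hm⟩
    · obtain ⟨i, a, b, c⟩ := ih hp
      exact ⟨i, a, by omega, c⟩

theorem mem_convexHull (hs : IsSides n U N d) (h : IsCcw n U) {S : Set Plane}
    (hS : ∀ i < n, !₂[(U i).1, (U i).2] ∈ S) {p : Plane}
    (hp : ∀ i < n, dot (N i) (p 0, p 1) ≤ d i) : p ∈ convexHull ℝ S := by
  have hn := h.1
  set x : ℝ × ℝ := (p 0, p 1) with hx
  have hc := convex_convexHull ℝ S
  have hin : ∀ i < n, !₂[(U i).1, (U i).2] ∈ convexHull ℝ S := fun i hi =>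
    subset_convexHull ℝ S (hS i hi)
  have key : ∀ i j k, i < n → j < n → k < n → 0 < orient (U i) (U j) (U k) →
      0 ≤ orient (U i) (U j) x → 0 ≤ orient (U j) (U k) x → 0 ≤ orient (U k) (U i) x →
      p ∈ convexHull ℝ S := by
    intro i j k hi hj hk hT h1 h2 h3
    -- The three orientations are the barycentric coordinates of `x`, up to normalization.
    have hsum : orient (U j) (U k) x + orient (U k) (U i) x + orient (U i) (U j) x =
        orient (U i) (U j) (U k) := by unfold orient cross; ring
    have hw := hc.sum_mem (t := Finset.univ) (w := ![orient (U j) (U k) x / orient (U i) (U j) (U k),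
      orient (U k) (U i) x / orient (U i) (U j) (U k),
      orient (U i) (U j) x / orient (U i) (U j) (U k)])
      (z := ![!₂[(U i).1, (U i).2], !₂[(U j).1, (U j).2], !₂[(U k).1, (U k).2]]) ?_ ?_ ?_
    · convert hw using 1
      ext l
      fin_cases l <;> simp [Fin.sum_univ_three] <;> field_simp <;>
        simp only [orient_eq_sub, hx] <;> ring
    · intro l _
      fin_cases l <;> simp <;> positivity
    · simp [Fin.sum_univ_three]
      rw [← add_div, ← add_div, hsum, div_self hT.ne']
    · intro l _
      fin_cases l
      exacts [hin i hi, hin j hj, hin k hk]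
  have hfirst : 0 ≤ orient (U 0) (U 1) x := by
    have := (hs.le_iff h (by omega : 0 < n) x).1 (hp 0 (by omega))
    rwa [show succIdx n 0 = 1 from if_pos (by omega)] at this
  have hlast : 0 ≤ orient (U (n - 1)) (U 0) x := by
    have := (hs.le_iff h (by omega : n - 1 < n) x).1 (hp (n - 1) (by omega))
    rwa [show succIdx n (n - 1) = 0 from if_neg (by omega)] at this
  have swap : ∀ i, orient (U i) (U 0) x = -orient (U 0) (U i) x := by
    intro i; unfold orient cross; ring
  have edge : ∀ i, i + 1 < n → 0 ≤ orient (U i) (U (i + 1)) x := by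
    intro i hi
    have := (hs.le_iff h (by omega : i < n) x).1 (hp i (by omega))
    rwa [show succIdx n i = i + 1 from if_pos hi] at this
  rw [swap] at hlast
  obtain ⟨i, a, b, c, e⟩ := exists_sign_change (f := fun i => orient (U 0) (U i) x)
    (m := n - 1) hfirst (by linarith) (by omega)
  refine key 0 i (i + 1) (by omega) (by omega) (by omega)
    (h.2 _ _ _ (by omega) (by omega) (by omega)) c (edge i (by omega)) ?_
  rw [swap]; linarith

/-- A convex polygon is the intersection of the halfplanes of its sides. -/
theorem mem_convexHull_iff (hs : IsSides n U N d) (h : IsCcw n U) {S : Set Plane}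
    (hS : ∀ p : Plane, p ∈ S ↔ ∃ i < n, (p 0, p 1) = U i) (p : Plane) :
    p ∈ convexHull ℝ S ↔ ∀ i < n, dot (N i) (p 0, p 1) ≤ d i := by
  constructor
  · intro hp i hi
    have hcv : Convex ℝ {q : Plane | dot (N i) (q 0, q 1) ≤ d i} := by
      intro q hq q' hq' a b ha hb hab
      simp only [Set.mem_ofPred_eq] at *
      have e : dot (N i) ((a • q + b • q') 0, (a • q + b • q') 1) =
          a * dot (N i) (q 0, q 1) + b * dot (N i) (q' 0, q' 1) := by
        simp [dot]; ring
      rw [e]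
      have k1 := mul_le_mul_of_nonneg_left hq ha
      have k2 := mul_le_mul_of_nonneg_left hq' hb
      have : a * d i + b * d i = d i := by rw [← add_mul, hab, one_mul]
      linarith
    refine convexHull_min ?_ hcv hp
    intro q hq
    obtain ⟨j, hj, e⟩ := (hS q).1 hq
    simp only [Set.mem_ofPred_eq]
    rw [e]
    exact hs.dot_le h hi hj
  · exact hs.mem_convexHull h fun i hi => (hS _).2 ⟨i, hi, by simp⟩

/-- The shrinking starts at radius `0` with all sides. Their determinants are positive because the
`τ` of `edge_step` is the actual side length. -/
theorem shrunk (hs : IsSides n U N d) (h : IsCcw n U) {nx pv : ℕ → ℕ}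
    (hnx : ∀ i < n, nx i = succIdx n i) (hpv : ∀ i < n, pv (succIdx n i) = i) :
    Shrunk n N d (Finset.range n) nx pv 0 ∧
      ∀ i < n, 0 < sideDet N d nx pv i ∧ 0 < sideOrient N nx pv i := by
  have hn := h.1
  have surj : ∀ i < n, ∃ j < n, succIdx n j = i := by
    intro i hi
    rcases Nat.eq_zero_or_pos i with h0 | h0
    · exact ⟨n - 1, by omega, by unfold succIdx; rw [if_neg (by omega)]; omega⟩
    · exact ⟨i - 1, by omega, by unfold succIdx; rw [if_pos (by omega)]; omega⟩
  have hC : CyclicList N (Finset.range n) nx pv := by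
    constructor
    · exact fun i hi => hs.unit h (Finset.mem_range.1 hi)
    · intro i hi
      rw [Finset.mem_range] at *
      rw [hnx i hi]; exact succIdx_lt hi
    · intro i hi
      rw [Finset.mem_range] at *
      obtain ⟨j, hj, rfl⟩ := surj i hi
      rwa [hpv j hj]
    · intro i hi
      rw [Finset.mem_range] at *
      rw [hnx i hi, hpv i hi]
    · intro i hi
      rw [Finset.mem_range] at *
      obtain ⟨j, hj, rfl⟩ := surj i hi
      rw [hpv j hj, hnx j hj]
    · intro i hi
      rw [Finset.mem_range] at *
      rw [hnx i hi]; exact hs.cross_pos h hi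
    · intro i hi k hk
      rw [Finset.mem_range] at *
      rw [hnx i hi]; exact hs.orient_pos h hi hk
  have hdet : ∀ i < n, 0 < sideDet N d nx pv i := by
    intro i hi
    have hi' := Finset.mem_range.2 hi
    have hne := h.ne_succ hi
    have hl := len_pos hne
    obtain ⟨j, hj, e⟩ := surj i hi
    have c1 := hC.cross_pv_pos hi'
    have c2 := hC.cross_pos i hi'
    have e1 : pv i = j := by rw [← e, hpv j hj]
    obtain ⟨τ, k1, k2⟩ := edge_step (l := N (pv i)) (r := N (nx i)) (c := U i)
      (c' := U (succIdx n i)) (hs.unit h hi) ((hs.dot_left hi).trans (hs.dot_right h hi).symm)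
    have k3 : dot (N (pv i)) (U i) = d (pv i) := by
      rw [e1, ← e]; exact hs.dot_right h hj
    rw [hs.dot_left hi, k3, hnx i hi, hs.dot_left (succIdx_lt hi), ← hnx i hi] at k2
    unfold sideDet
    rw [k2]
    refine mul_pos (mul_pos c1 c2) ?_
    have k4 : τ = len (U i) (U (succIdx n i)) := by
      have k5 := len_mul_self (U i) (U (succIdx n i))
      have u := hs.unit h hi
      have e2 : (U (succIdx n i)).1 = (U i).1 - τ * (N i).2 := by rw [k1]
      have e3 : (U (succIdx n i)).2 = (U i).2 + τ * (N i).1 := by rw [k1]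
      have e4 : (N i).1 * len (U i) (U (succIdx n i)) = (U (succIdx n i)).2 - (U i).2 := by
        rw [(hs i hi).1, normal, div_mul_cancel₀ _ hl.ne']
      have e5 : (N i).2 * len (U i) (U (succIdx n i)) = (U i).1 - (U (succIdx n i)).1 := by
        rw [(hs i hi).1, normal, div_mul_cancel₀ _ hl.ne']
      unfold dot at u
      linear_combination (len (U i) (U (succIdx n i)) - τ) * u - (N i).1 * e4 - (N i).2 * e5 -
        (N i).1 * e3 + (N i).2 * e2
    rw [k4]; exact hl
  refine ⟨{ hC with lt := fun i hi => Finset.mem_range.1 hi, le := ?_, feasible := ?_ }, ?_⟩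
  · intro i hi
    rw [zero_mul]; exact (hdet i (Finset.mem_range.1 hi)).le
  · exact fun o r _ ho i hi => ho i (Finset.mem_range.2 hi)
  · exact fun i hi => ⟨hdet i hi, hC.orient_pv_pos (Finset.mem_range.2 hi)⟩

/-- Leaf `i` is the vertex `U (succIdx n i)`, a circle of radius `0` touching the sides `i` and
`succIdx n i`. -/
theorem forest (hs : IsSides n U N d) (h : IsCcw n U) {nx chord par : ℕ → ℕ}
    {P : ℕ → ℝ × ℝ} {R : ℕ → ℝ} (hnx : ∀ i < n, nx i = succIdx n i)
    (hchord : ∀ i < n, chord i = i) (hP : ∀ i < n, P i = U (succIdx n i))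
    (hR : ∀ i < n, R i = 0) :
    Forest n N d (Finset.range n) nx chord par P R (fun c => c < n)
      (fun c => (c, succIdx n c)) (fun _ => 0) := by
  constructor
  · intro i _; omega
  · intro c hc; omega
  · intro c hc i hi
    rw [hP c hc, hR c hc, add_zero]; exact hs.dot_le h hi (succIdx_lt hc)
  · intro c hc; exact (hR c hc).ge
  · intro c hc
    rw [hP c hc, hR c hc, add_zero]; exact hs.dot_right h hc
  · intro c hc
    rw [hP c hc, hR c hc, add_zero]; exact hs.dot_left (succIdx_lt hc)
  · exact fun c hc => ⟨hc, succIdx_lt hc⟩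
  · intro j hj
    rw [Finset.mem_range] at hj
    rwa [hchord j hj]
  · intro j hj
    rw [Finset.mem_range] at hj
    rw [hchord j hj, hnx j hj]
  · exact fun c hc => Or.inl ⟨c, Finset.mem_range.2 hc, hchord c hc⟩
  · intro c _; simp
  · exact fun c hc => ⟨hc, rfl, hR c hc⟩

/-- The stopping condition of the search for the arc of normals that contains `w`. -/
theorem inCone_of_search (hs : IsSides n U N d) (h : IsCcw n U) {w : ℝ × ℝ} (hw : dot w w = 1)
    {i : ℕ} (hi : i < n) (h1 : 0 ≤ orient (N 0) (N i) w)
    (h2 : i + 1 < n → orient (N 0) (N (i + 1)) w < 0) :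
    InCone (N i) (N (succIdx n i)) w := by
  have hn := h.1
  have u0 := hs.unit h (by omega : 0 < n)
  refine inCone_of_orient (hs.unit h hi) (hs.unit h (succIdx_lt hi)) hw (hs.cross_pos h hi) ?_
  unfold succIdx
  split_ifs with hi'
  · have h3 := h2 hi'
    rcases Nat.eq_zero_or_pos i with h0 | h0
    · subst h0
      -- On the arc starting at `N 0` the upper search bound alone decides.
      rw [orient_swap]; simp only [zero_add] at h3 ⊢; linarith
    · refine orient_nonneg_of_between u0 (hs.unit h hi) hw (hs.unit h hi') h1
        (by rw [orient_swap]; linarith) ?_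
      have := hs.orient_pos h hi (by omega : 0 < n) (by omega)
        (by unfold succIdx; rw [if_pos hi']; omega)
      rw [succIdx, if_pos hi'] at this
      rwa [orient_rotate] at this
  -- The last arc ends at `N 0`, so the lower search bound alone decides.
  · rwa [orient_rotate]

end IsSides

/-- The Cauchy-Schwarz inequality, by Lagrange's identity. -/
theorem dot_sub_le {m : ℝ × ℝ} (hm : dot m m = 1) {o p : Plane} {r : ℝ}
    (hp : p ∈ Metric.sphere o r) : dot m (p 0, p 1) ≤ dot m (o 0, o 1) + r := by
  rw [mem_sphere_iff_norm, EuclideanSpace.norm_eq, Fin.sum_univ_two] at hp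
  have hr : 0 ≤ r := by rw [← hp]; positivity
  have h2 : (p 0 - o 0) ^ 2 + (p 1 - o 1) ^ 2 = r ^ 2 := by
    rw [← hp, Real.sq_sqrt (by positivity)]
    simp
  have h3 : dot m (p 0, p 1) - dot m (o 0, o 1) ≤ r := by
    refine abs_le_of_sq_le_sq' ?_ hr |>.2
    unfold dot at *
    simp only at *
    nlinarith [sq_nonneg (m.1 * (p 1 - o 1) - m.2 * (p 0 - o 0))]
  linarith

theorem sphere_subset_iff {m : ℝ × ℝ} (hm : dot m m = 1) {o : Plane} {r : ℝ} (hr : 0 < r)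
    (b : ℝ) : (∀ p ∈ Metric.sphere o r, dot m (p 0, p 1) ≤ b) ↔ dot m (o 0, o 1) + r ≤ b := by
  constructor
  · intro hp
    -- The extreme point of the circle in direction `m`.
    have := hp (o + r • !₂[m.1, m.2]) ?_
    · unfold dot at *
      simp at this
      linear_combination this - r * hm
    · rw [mem_sphere_iff_norm, add_sub_cancel_left, norm_smul, EuclideanSpace.norm_eq,
        Fin.sum_univ_two]
      unfold dot at hm
      have : ‖(!₂[m.1, m.2] : Plane) 0‖ ^ 2 + ‖(!₂[m.1, m.2] : Plane) 1‖ ^ 2 = 1 := by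
        simp; linarith
      rw [this]; simp [abs_of_pos hr]
  · exact fun h p hp => (dot_sub_le hm hp).trans h

/-- The circles in the intersection of the polygon with a halfplane. -/
theorem isCircleIn_iff {n : ℕ} {U N : ℕ → ℝ × ℝ} {d : ℕ → ℝ} (hs : IsSides n U N d)
    (h : IsCcw n U) {S : Set Plane} (hS : ∀ p : Plane, p ∈ S ↔ ∃ i < n, (p 0, p 1) = U i)
    {a b c l : ℝ} (hl : 0 < l) (hw : dot (a / l, b / l) (a / l, b / l) = 1) (o : Plane) (r : ℝ) :
    IsCircleIn (convexHull ℝ S ∩ halfplane a b c) o r ↔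
      0 < r ∧ Feasible n N d (o 0, o 1) r ∧ r ≤ dot (a / l, b / l) (o 0, o 1) + c / l := by
  unfold IsCircleIn
  refine and_congr_right fun hr => ?_
  rw [Set.subset_inter_iff]
  refine and_congr ?_ ?_
  · have : Metric.sphere o r ⊆ convexHull ℝ S ↔
        ∀ i < n, ∀ p ∈ Metric.sphere o r, dot (N i) (p 0, p 1) ≤ d i := by
      constructor
      · exact fun hh i hi p hp => (hs.mem_convexHull_iff h hS p).1 (hh hp) i hi
      · exact fun hh p hp => (hs.mem_convexHull_iff h hS p).2 fun i hi => hh i hi p hp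
    rw [this]
    exact forall₂_congr fun i hi => sphere_subset_iff (hs.unit h hi) hr _
  -- The outer normal of the query halfplane is the negative of `w`.
  · have hm : dot (-(a / l), -(b / l)) (-(a / l), -(b / l)) = 1 := by
      unfold dot at *; simp only at *; linarith
    have e : ∀ p : Plane, p ∈ halfplane a b c ↔
        dot (-(a / l), -(b / l)) (p 0, p 1) ≤ c / l := by
      intro p
      have e2 : a * p 0 + b * p 1 + c =
          l * (c / l - dot (-(a / l), -(b / l)) (p 0, p 1)) := by
        unfold dot; field_simp; ring
      rw [halfplane, Set.mem_ofPred_eq, e2, mul_nonneg_iff_of_pos_left hl, sub_nonneg]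
    have := sphere_subset_iff hm (o := o) hr (c / l)
    simp only [← e] at this
    refine this.trans ?_
    unfold dot
    simp only
    constructor <;> intro h' <;> linarith


end CircleQuery

/-! ### A max-tree in an array. -/

namespace CircleQuery

open RealRAM

/-- The entries `1, …, n - 1` of `M` are the maxima of their two children in the heap order. -/
def IsMaxTree (n : ℕ) (M : ℕ → ℝ) : Prop :=
  ∀ j, 1 ≤ j → j < n → M j = max (M (2 * j)) (M (2 * j + 1))

theorem IsMaxTree.le_root {n : ℕ} {M : ℕ → ℝ} (h : IsMaxTree n M) {j : ℕ} (h1 : 1 ≤ j)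
    (h2 : j < 2 * n) : M j ≤ M 1 := by
  induction j using Nat.strong_induction_on with
  | _ j ih =>
    rcases h1.eq_or_lt with h3 | h3
    · rw [← h3]
    · refine le_trans ?_ (ih (j / 2) (by omega) (by omega) (by omega))
      rw [h (j / 2) (by omega) (by omega)]
      rcases Nat.even_or_odd' j with ⟨k, hk | hk⟩
      · rw [show 2 * (j / 2) = j by omega]; exact le_max_left _ _
      · rw [show 2 * (j / 2) + 1 = j by omega]; exact le_max_right _ _

/-- Recompute the maxima on the path from the node in integer register `10` to the root. -/
def walkUp : Prog :=
  .loop (.natLe (.const 1) (.reg 10))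
    (.seq
      (.ite (.realLe (.arr 8 (.add (.mul (.const 2) (.reg 10)) (.const 1)))
          (.arr 8 (.mul (.const 2) (.reg 10))))
        (.setRealArr 8 (.reg 10) (.arr 8 (.mul (.const 2) (.reg 10))))
        (.setRealArr 8 (.reg 10) (.arr 8 (.add (.mul (.const 2) (.reg 10)) (.const 1)))))
      (.setNatReg 10 (.div (.reg 10) (.const 2))))

/-- Replace the leaf with the number in integer register `11` by the value of `e`. -/
def setLeaf (e : RealExp) : Prog :=
  .seq (.seq (.setRealArr 8 (.add (.reg 0) (.reg 11)) e)
    (.setNatReg 10 (.div (.add (.reg 0) (.reg 11)) (.const 2)))) walkUp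

/-- Descend from the root to a largest leaf; its number goes to integer register `11`. -/
def findMax : Prog :=
  .seq (.setNatReg 12 (.const 1))
    (.seq
      (.loop (.neg (.natLe (.reg 0) (.reg 12)))
        (.ite (.realLe (.arr 8 (.add (.mul (.const 2) (.reg 12)) (.const 1)))
            (.arr 8 (.mul (.const 2) (.reg 12))))
          (.setNatReg 12 (.mul (.const 2) (.reg 12)))
          (.setNatReg 12 (.add (.mul (.const 2) (.reg 12)) (.const 1)))))
      (.setNatReg 11 (.sub (.reg 12) (.reg 0))))

theorem lt_two_pow_log (n : ℕ) : n < 2 ^ (Nat.log 2 n + 1) := Nat.lt_pow_succ_log_self one_lt_two n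

/-- The invariant is that only the node `p` may violate the max property. Repairing `p` can only
spoil its parent `p / 2`, and `p = 0` is no node of the tree. The bound `p < 2 ^ m` counts the
steps. -/
theorem runs_walkUp {W n : ℕ} {s : State} (hW : n ≤ W) (hp : s.natReg 10 < n)
    (hM : ∀ j, 1 ≤ j → j < n → j ≠ s.natReg 10 →
      s.realArr 8 j = max (s.realArr 8 (2 * j)) (s.realArr 8 (2 * j + 1))) :
    Runs W walkUp s (Nat.log 2 n + 2) fun s' => ∃ M : ℕ → ℝ,
      s' = ⟨Function.update s.natReg 10 0, s.realReg, s.natArr, Function.update s.realArr 8 M⟩ ∧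
      IsMaxTree n M ∧ ∀ q, n ≤ q → M q = s.realArr 8 q := by
  let I : ℕ → State → Prop := fun m s' => ∃ (M : ℕ → ℝ) (p : ℕ), p < 2 ^ m ∧ p < n ∧
      s' = ⟨Function.update s.natReg 10 p, s.realReg, s.natArr, Function.update s.realArr 8 M⟩ ∧
      (∀ j, 1 ≤ j → j < n → j ≠ p → M j = max (M (2 * j)) (M (2 * j + 1))) ∧
      ∀ q, n ≤ q → M q = s.realArr 8 q
  have hI : I (Nat.log 2 n + 1) s :=
    ⟨s.realArr 8, s.natReg 10, hp.trans (lt_two_pow_log n), hp, by simp, hM, fun _ _ => rfl⟩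
  refine (Runs.loop_of_wp I ?_ hI).mono le_rfl ?_
  · rintro m s' ⟨M, p, h1, h2, rfl, h3, h4⟩ hb
    simp only [Test.Holds, NatExp.value, Function.update_self] at hb
    have step : ∀ x, x = max (M (2 * p)) (M (2 * p + 1)) → ∃ m' < m, I m'
        ((State.setRealArr ⟨Function.update s.natReg 10 p, s.realReg, s.natArr,
          Function.update s.realArr 8 M⟩ 8 p x).setNatReg 10 (p / 2)) := by
      intro x hx
      obtain ⟨m, rfl⟩ : ∃ k, m = k + 1 := by
        rcases m with _ | m
        · simp at h1; omega
        · exact ⟨m, rfl⟩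
      refine ⟨m, by omega, Function.update M p x, p / 2, ?_, by omega, ?_, ?_, ?_⟩
      · rw [pow_succ] at h1; omega
      · simp [State.setRealArr, State.setNatReg]
      · intro j j1 j2 j3
        by_cases e : j = p
        · subst e
          rw [Function.update_self, Function.update_of_ne (by omega),
            Function.update_of_ne (by omega)]
          exact hx
        · rw [Function.update_of_ne e, Function.update_of_ne (by omega),
            Function.update_of_ne (by omega)]
          exact h3 j j1 j2 e
      · intro q hq
        rw [Function.update_of_ne (by omega)]
        exact h4 q hq
    simp only [Prog.wp, Test.Holds, NatExp.value, RealExp.value, State.natReg_setRealArr,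
      Function.update_self]
    exact ⟨fun hle => ⟨by omega, by omega, step _ (max_eq_left hle).symm⟩,
      fun hle => ⟨by omega, by omega, step _ (max_eq_right (not_le.1 hle).le).symm⟩⟩
  · rintro s' ⟨m, ⟨M, p, h1, h2, rfl, h3, h4⟩, hb⟩
    simp only [Test.Holds, NatExp.value, Function.update_self] at hb
    obtain rfl : p = 0 := by omega
    exact ⟨M, rfl, fun j j1 j2 => h3 j j1 j2 (by omega), h4⟩

theorem runs_setLeaf {W n : ℕ} {s : State} (e : RealExp) (hW : 2 * n ≤ W)
    (hn : s.natReg 0 = n) (hi : s.natReg 11 < n) (hn2 : 2 ≤ n) (hM : IsMaxTree n (s.realArr 8)) :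
    Runs W (setLeaf e) s (Nat.log 2 n + 2) fun s' => ∃ M : ℕ → ℝ,
      s' = ⟨Function.update s.natReg 10 0, s.realReg, s.natArr, Function.update s.realArr 8 M⟩ ∧
      IsMaxTree n M ∧ ∀ q, n ≤ q →
        M q = Function.update (s.realArr 8) (n + s.natReg 11) (e.value s) q := by
  refine Runs.seq (Runs.of_wp (by omega) (Q := fun s' => s' =
    ⟨Function.update s.natReg 10 ((n + s.natReg 11) / 2), s.realReg, s.natArr,
      Function.update s.realArr 8
        (Function.update (s.realArr 8) (n + s.natReg 11) (e.value s))⟩) ?_)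
    (Q' := fun s' => ∃ M : ℕ → ℝ, s' = ⟨Function.update s.natReg 10 0, s.realReg, s.natArr,
        Function.update s.realArr 8 M⟩ ∧
      IsMaxTree n M ∧ ∀ q, n ≤ q →
        M q = Function.update (s.realArr 8) (n + s.natReg 11) (e.value s) q)
    fun s' hs' => ?_
  · simp only [Prog.wp, NatExp.value, State.natReg_setRealArr, hn]
    refine ⟨by omega, by omega, ?_⟩
    simp [State.setNatReg, State.setRealArr]
  · subst hs'
    refine (runs_walkUp (n := n) (by omega) ?_ ?_).mono le_rfl ?_
    · simp only [Function.update_self]; omega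
    · simp only [Function.update_self]
      intro j j1 j2 j3
      rw [Function.update_of_ne (by omega), Function.update_of_ne (by omega),
        Function.update_of_ne (by omega)]
      exact hM j j1 j2
    · rintro s' ⟨M, rfl, h1, h2⟩
      refine ⟨M, by simp, h1, fun q hq => ?_⟩
      rw [h2 q hq]; simp

/-- The value at the current node `q` stays equal to the value at the root; `n ≤ q * 2 ^ m` bounds
the number of levels still to descend. -/
theorem runs_findMax {W n : ℕ} {s : State} (hW : 2 * n ≤ W) (hn : s.natReg 0 = n) (hn2 : 2 ≤ n)
    (hM : IsMaxTree n (s.realArr 8)) : Runs W findMax s (Nat.log 2 n + 2) fun s' => ∃ i < n,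
      s' = ⟨Function.update (Function.update s.natReg 12 (n + i)) 11 i, s.realReg, s.natArr,
        s.realArr⟩ ∧ ∀ j < n, s.realArr 8 (n + j) ≤ s.realArr 8 (n + i) := by
  let I : ℕ → State → Prop := fun m s' => ∃ q : ℕ, 1 ≤ q ∧ n ≤ q * 2 ^ m ∧ q < 2 * n ∧
      s' = ⟨Function.update s.natReg 12 q, s.realReg, s.natArr, s.realArr⟩ ∧
      s.realArr 8 q = s.realArr 8 1
  refine Runs.seq (Runs.of_wp (by omega) (Q := I (Nat.log 2 n + 1)) ?_)
    fun s1 hs1 => Runs.seq (Runs.loop_of_wp I ?_ hs1) (Q' := fun s' => ∃ i < n,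
      s' = ⟨Function.update (Function.update s.natReg 12 (n + i)) 11 i, s.realReg, s.natArr,
        s.realArr⟩ ∧ ∀ j < n, s.realArr 8 (n + j) ≤ s.realArr 8 (n + i)) ?_
  · refine ⟨by simp [NatExp.value]; omega, 1, le_rfl, ?_, by omega, rfl, rfl⟩
    have := lt_two_pow_log n
    omega
  · rintro m s' ⟨q, h1, h2, h3, rfl, h4⟩ hb
    simp only [Test.Holds, NatExp.value, Function.update_self] at hb
    rw [Function.update_of_ne (by decide), hn, not_le] at hb
    have h5 := hM q h1 hb
    have step : ∀ q', q' = 2 * q ∨ q' = 2 * q + 1 → s.realArr 8 q' = s.realArr 8 q →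
        q' ≤ W ∧ ∃ m' < m, I m' (State.setNatReg ⟨Function.update s.natReg 12 q, s.realReg,
          s.natArr, s.realArr⟩ 12 q') := by
      intro q' hq' e
      obtain ⟨m, rfl⟩ : ∃ k, m = k + 1 := by
        rcases m with _ | m
        · simp at h2; omega
        · exact ⟨m, rfl⟩
      refine ⟨by omega, m, by omega, q', by omega, ?_, by omega, ?_, e.trans h4⟩
      · calc n ≤ q * 2 ^ (m + 1) := h2
          _ = (2 * q) * 2 ^ m := by rw [pow_succ]; ring
          _ ≤ q' * 2 ^ m := Nat.mul_le_mul_right _ (by omega)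
      · simp [State.setNatReg]
    simp only [Prog.wp, Test.Holds, NatExp.value, RealExp.value, Function.update_self]
    exact ⟨fun hle => step _ (Or.inl rfl) (by rw [h5, max_eq_left hle]),
      fun hle => step _ (Or.inr rfl) (by rw [h5, max_eq_right (not_le.1 hle).le])⟩
  · rintro s' ⟨m, ⟨q, h1, h2, h3, rfl, h4⟩, hb⟩
    simp only [Test.Holds, NatExp.value, Function.update_self, not_not] at hb
    rw [Function.update_of_ne (by decide), hn] at hb
    refine Runs.of_wp (by omega) ?_
    simp only [Prog.wp, NatExp.value, Function.update_self]
    rw [Function.update_of_ne (by decide), hn]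
    refine ⟨by omega, q - n, by omega, ?_, fun j hj => ?_⟩
    · rw [Nat.add_sub_cancel' hb]; rfl
    · rw [Nat.add_sub_cancel' hb, h4]
      exact hM.le_root (by omega) (by omega)

end CircleQuery

/-! ### One event of the shrinking process on the machine. -/

namespace CircleQuery

open RealRAM

/-- The unit normals of the sides are stored in the real arrays `2` and `3`. -/
def normals (s : State) (i : ℕ) : ℝ × ℝ := (s.realArr 2 i, s.realArr 3 i)

/-- The centres of the nodes are stored in the real arrays `5` and `6`. -/
def centres (s : State) (i : ℕ) : ℝ × ℝ := (s.realArr 5 i, s.realArr 6 i)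

/-- The cross product of two stored normals. -/
def crossE (x y : NatExp) : RealExp :=
  .sub (.mul (.arr 2 x) (.arr 3 y)) (.mul (.arr 3 x) (.arr 2 y))

/-- The orientation of three stored normals. -/
def orientE (x y z : NatExp) : RealExp :=
  .add (.add (crossE x y) (crossE y z)) (crossE z x)

/-- The determinant of three stored sides. -/
def tripleE (x y z : NatExp) : RealExp :=
  .add (.add (.mul (.arr 4 x) (crossE y z)) (.mul (.arr 4 y) (crossE z x)))
    (.mul (.arr 4 z) (crossE x y))

/-- The abscissa of the corner of two stored sides shifted by the real register `3`. -/
def cornerXE (x y : NatExp) : RealExp :=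
  .div (.sub (.mul (.sub (.arr 4 x) (.reg 3)) (.arr 3 y))
    (.mul (.sub (.arr 4 y) (.reg 3)) (.arr 3 x))) (crossE x y)

/-- The ordinate of the corner of two stored sides shifted by the real register `3`. -/
def cornerYE (x y : NatExp) : RealExp :=
  .div (.sub (.mul (.sub (.arr 4 y) (.reg 3)) (.arr 2 x))
    (.mul (.sub (.arr 4 x) (.reg 3)) (.arr 2 y))) (crossE x y)

theorem crossE_value (s : State) (x y : NatExp) :
    (crossE x y).value s = cross (normals s (x.value s)) (normals s (y.value s)) := rfl

theorem orientE_value (s : State) (x y z : NatExp) : (orientE x y z).value s =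
    orient (normals s (x.value s)) (normals s (y.value s)) (normals s (z.value s)) := rfl

theorem tripleE_value (s : State) (x y z : NatExp) : (tripleE x y z).value s =
    tripleDet (normals s (x.value s)) (normals s (y.value s)) (normals s (z.value s))
      (s.realArr 4 (x.value s)) (s.realArr 4 (y.value s)) (s.realArr 4 (z.value s)) := rfl

theorem cornerXE_value (s : State) (x y : NatExp) : (cornerXE x y).value s =
    (corner (normals s (x.value s)) (normals s (y.value s)) (s.realArr 4 (x.value s) - s.realReg 3)
      (s.realArr 4 (y.value s) - s.realReg 3)).1 := rfl

theorem cornerYE_value (s : State) (x y : NatExp) : (cornerYE x y).value s =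
    (corner (normals s (x.value s)) (normals s (y.value s)) (s.realArr 4 (x.value s) - s.realReg 3)
      (s.realArr 4 (y.value s) - s.realReg 3)).2 := rfl

/-- The reciprocal of the radius at which the side in integer register `11` vanishes. -/
def keyE : RealExp :=
  .div (orientE (.arr 1 (.reg 11)) (.reg 11) (.arr 0 (.reg 11)))
    (tripleE (.arr 1 (.reg 11)) (.reg 11) (.arr 0 (.reg 11)))

theorem keyE_value (s : State) : keyE.value s =
    sideOrient (normals s) (s.natArr 0) (s.natArr 1) (s.natReg 11) /
      sideDet (normals s) (s.realArr 4) (s.natArr 0) (s.natArr 1) (s.natReg 11) := rfl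

/-- Compute the circle at which the side in integer register `11` vanishes. -/
def eventCircle : Prog :=
  .seq (.setNatReg 13 (.arr 1 (.reg 11))) <|
  .seq (.setNatReg 14 (.arr 0 (.reg 11))) <|
  .seq (.setRealReg 3 (.div (tripleE (.reg 13) (.reg 11) (.reg 14))
    (orientE (.reg 13) (.reg 11) (.reg 14)))) <|
  .seq (.setRealReg 4 (cornerXE (.reg 13) (.reg 11))) <|
  .setRealReg 5 (cornerYE (.reg 13) (.reg 11))

/-- Store the new node and remove the side in integer register `11` from the cyclic list. -/
def unlink : Prog :=
  .seq (.setRealArr 5 (.add (.reg 0) (.reg 11)) (.reg 4)) <|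
  .seq (.setRealArr 6 (.add (.reg 0) (.reg 11)) (.reg 5)) <|
  .seq (.setRealArr 7 (.add (.reg 0) (.reg 11)) (.reg 3)) <|
  .seq (.setNatArr 3 (.arr 2 (.reg 13)) (.add (.reg 0) (.reg 11))) <|
  .seq (.setNatArr 3 (.arr 2 (.reg 11)) (.add (.reg 0) (.reg 11))) <|
  .seq (.setNatArr 2 (.reg 13) (.add (.reg 0) (.reg 11))) <|
  .seq (.setNatArr 0 (.reg 13) (.reg 14)) <|
  .setNatArr 1 (.reg 14) (.reg 13)

/-- One event of the shrinking process; integer register `15` is set when it is over. -/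
def shrinkStep : Prog :=
  .seq findMax <| .seq eventCircle <|
  .ite (.realLe (crossE (.reg 13) (.reg 14)) (.const 0)) (.setNatReg 15 (.const 1)) <|
  .seq unlink <| .seq (setLeaf (.const 0)) <|
  .seq (.setNatReg 11 (.reg 13)) <| .seq (setLeaf keyE) <|
  .seq (.setNatReg 11 (.reg 14)) (setLeaf keyE)

/-- The memory during the shrinking process with sides in `A` surviving at radius `ρ`. -/
structure Shrinking (n : ℕ) (N : ℕ → ℝ × ℝ) (d : ℕ → ℝ) (A : Finset ℕ) (ρ : ℝ)
    (s : State) : Prop where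
  size : s.natReg 0 = n
  normals_eq : normals s = N
  offsets_eq : s.realArr 4 = d
  bound : ∀ a i, s.natArr a i < 3 * n
  nonempty : A.Nonempty
  radius_nonneg : 0 ≤ ρ
  shrunk : Shrunk n N d A (s.natArr 0) (s.natArr 1) ρ
  tree : IsMaxTree n (s.realArr 8)
  det_pos : ∀ i ∈ A, 0 < sideDet N d (s.natArr 0) (s.natArr 1) i
  key : ∀ i ∈ A, s.realArr 8 (n + i) = sideOrient N (s.natArr 0) (s.natArr 1) i /
    sideDet N d (s.natArr 0) (s.natArr 1) i
  dead : ∀ i < n, i ∉ A → s.realArr 8 (n + i) = 0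
  forest : ∃ V ch rk, Forest n N d A (s.natArr 0) (s.natArr 2) (s.natArr 3) (centres s)
    (s.realArr 7) V ch rk

theorem lt_update {f : ℕ → ℕ} {b i v : ℕ} (hf : ∀ j, f j < b) (hv : v < b) (j : ℕ) :
    Function.update f i v j < b := by
  rw [Function.update_apply]
  split_ifs
  exacts [hv, hf j]

theorem lt_update_arr {f : ℕ → ℕ → ℕ} {b a : ℕ} {g : ℕ → ℕ} (hf : ∀ a j, f a j < b)
    (hg : ∀ j, g j < b) (a' j : ℕ) : Function.update f a g a' j < b := by
  rw [Function.update_apply]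
  split_ifs
  exacts [hg j, hf a' j]

theorem runs_eventCircle {W n : ℕ} {s : State} {k : ℕ} (hk : 1 ≤ k) (hW : 3 * n ≤ W)
    (hb : ∀ a i, s.natArr a i < 3 * n) : Runs W eventCircle s k fun s' =>
      s'.natArr = s.natArr ∧ s'.realArr = s.realArr ∧ s'.natReg 0 = s.natReg 0 ∧
      s'.natReg 11 = s.natReg 11 ∧ s'.natReg 13 = s.natArr 1 (s.natReg 11) ∧
      s'.natReg 14 = s.natArr 0 (s.natReg 11) ∧ s'.natReg 15 = s.natReg 15 ∧
      s'.realReg 3 = sideDet (normals s) (s.realArr 4) (s.natArr 0) (s.natArr 1) (s.natReg 11) /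
        sideOrient (normals s) (s.natArr 0) (s.natArr 1) (s.natReg 11) ∧
      (s'.realReg 4, s'.realReg 5) = corner (normals s (s.natArr 1 (s.natReg 11)))
        (normals s (s.natReg 11)) (s.realArr 4 (s.natArr 1 (s.natReg 11)) - s'.realReg 3)
        (s.realArr 4 (s.natReg 11) - s'.realReg 3) := by
  have h1 := hb 1 (s.natReg 11)
  have h2 := hb 0 (s.natReg 11)
  refine Runs.of_wp hk ?_
  simp only [eventCircle, Prog.wp, NatExp.value, RealExp.value, orientE_value,
    tripleE_value, cornerXE_value, cornerYE_value, State.natReg_setNatReg, State.natArr_setNatReg]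
  simp [normals, sideDet, sideOrient]
  omega

theorem runs_unlink {W n : ℕ} {s : State} {k : ℕ} (hk : 1 ≤ k) (hW : 3 * n ≤ W)
    (hn : s.natReg 0 = n) (hb : ∀ a i, s.natArr a i < 3 * n) (h11 : s.natReg 11 < n)
    (h13 : s.natReg 13 < n) (h14 : s.natReg 14 < n) : Runs W unlink s k fun s' =>
      s'.natReg = s.natReg ∧ (∀ a i, s'.natArr a i < 3 * n) ∧
      s'.natArr 0 = Function.update (s.natArr 0) (s.natReg 13) (s.natReg 14) ∧
      s'.natArr 1 = Function.update (s.natArr 1) (s.natReg 14) (s.natReg 13) ∧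
      s'.natArr 2 = Function.update (s.natArr 2) (s.natReg 13) (n + s.natReg 11) ∧
      s'.natArr 3 = Function.update (Function.update (s.natArr 3) (s.natArr 2 (s.natReg 13))
        (n + s.natReg 11)) (s.natArr 2 (s.natReg 11)) (n + s.natReg 11) ∧
      s'.realArr 2 = s.realArr 2 ∧ s'.realArr 3 = s.realArr 3 ∧ s'.realArr 4 = s.realArr 4 ∧
      s'.realArr 8 = s.realArr 8 ∧
      centres s' (n + s.natReg 11) = (s.realReg 4, s.realReg 5) ∧
      (∀ c, c ≠ n + s.natReg 11 → centres s' c = centres s c) ∧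
      s'.realArr 7 (n + s.natReg 11) = s.realReg 3 ∧
      ∀ c, c ≠ n + s.natReg 11 → s'.realArr 7 c = s.realArr 7 c := by
  have h1 := hb 2 (s.natReg 11)
  have h2 := hb 2 (s.natReg 13)
  refine Runs.of_wp hk ?_
  simp only [unlink, Prog.wp, NatExp.value, RealExp.value, hn]
  simp [hn, centres]
  refine ⟨by omega, by omega, by omega, by omega, by omega, by omega, ?_, ?_, ?_⟩
  · intro a i
    refine lt_update_arr (lt_update_arr (lt_update_arr (lt_update_arr hb ?_) ?_) ?_) ?_ a i
    · exact lt_update (lt_update (hb 3) (by omega)) (by omega)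
    · exact lt_update (hb 2) (by omega)
    · exact lt_update (hb 0) (by omega)
    · exact lt_update (hb 1) (by omega)
  · exact fun c hc => ⟨Function.update_of_ne hc _ _, Function.update_of_ne hc _ _⟩
  · exact fun c hc => Function.update_of_ne hc _ _

theorem Shrinking.key_pos {n : ℕ} {N : ℕ → ℝ × ℝ} {d : ℕ → ℝ} {A : Finset ℕ} {ρ : ℝ} {s : State}
    (h : Shrinking n N d A ρ s) {i : ℕ} (hi : i ∈ A) : 0 < s.realArr 8 (n + i) := by
  rw [h.key i hi]
  exact div_pos (h.shrunk.orient_pv_pos hi) (h.det_pos i hi)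

/-- The side with the largest key vanishes first. -/
theorem Shrinking.advance {n : ℕ} {N : ℕ → ℝ × ℝ} {d : ℕ → ℝ} {A : Finset ℕ} {ρ : ℝ} {s : State}
    (h : Shrinking n N d A ρ s) {i : ℕ} (hi : i < n)
    (hmax : ∀ j < n, s.realArr 8 (n + j) ≤ s.realArr 8 (n + i)) {ρ' : ℝ}
    (hρ' : ρ' = sideDet N d (s.natArr 0) (s.natArr 1) i /
      sideOrient N (s.natArr 0) (s.natArr 1) i) :
    i ∈ A ∧ 0 < ρ' ∧ ρ' * sideOrient N (s.natArr 0) (s.natArr 1) i =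
      sideDet N d (s.natArr 0) (s.natArr 1) i ∧
      Shrunk n N d A (s.natArr 0) (s.natArr 1) ρ' := by
  -- Removed sides have key `0`, surviving ones positive keys, so a maximal key belongs to a
  -- surviving side.
  have hiA : i ∈ A := by
    by_contra hiA
    obtain ⟨j, hj⟩ := h.nonempty
    have h1 := hmax j (h.shrunk.lt j hj)
    rw [h.dead i hi hiA] at h1
    exact absurd (h.key_pos hj) (not_lt.2 h1)
  have o1 : 0 < sideOrient N (s.natArr 0) (s.natArr 1) i := h.shrunk.orient_pv_pos hiA
  have d1 := h.det_pos i hiA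
  have e1 : ρ' * sideOrient N (s.natArr 0) (s.natArr 1) i =
      sideDet N d (s.natArr 0) (s.natArr 1) i := by rw [hρ']; field_simp
  refine ⟨hiA, by rw [hρ']; positivity, e1, h.shrunk.advance ?_ fun j hj => ?_⟩
  · rw [hρ', le_div_iff₀ o1]; exact h.shrunk.le i hiA
  -- Keys are reciprocals of radii, so the largest key gives the smallest vanishing radius.
  · have h2 := hmax j (h.shrunk.lt j hj)
    have d2 := h.det_pos j hj
    rw [h.key i hiA, h.key j hj, div_le_div_iff₀ d2 d1] at h2
    rw [hρ', div_mul_eq_mul_div, div_le_iff₀ o1]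
    linarith

/-- Besides the removed side, only its two neighbours change their determinants, so three leaf
updates restore the tree. -/
theorem runs_shrinkStep {W n : ℕ} {N : ℕ → ℝ × ℝ} {d : ℕ → ℝ} {A : Finset ℕ} {ρ : ℝ} {s : State}
    (hW : 3 * n ≤ W) (hn : 2 ≤ n) (h : Shrinking n N d A ρ s) (hdone : s.natReg 15 = 0) :
    Runs W shrinkStep s (Nat.log 2 n + 2) fun s' =>
      (s'.natReg 15 = 1 ∧ ∃ ρ', s'.realReg 3 = ρ' ∧ 0 < ρ' ∧ Shrinking n N d A ρ' s' ∧
        ∀ o r, Feasible n N d o r → r ≤ ρ') ∨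
      (s'.natReg 15 = 0 ∧ ∃ A' ρ', A'.card < A.card ∧ Shrinking n N d A' ρ' s') := by
  have hk : 1 ≤ Nat.log 2 n + 2 := by omega
  refine Runs.seq (runs_findMax (by omega) h.size hn h.tree) ?_
  rintro s1 ⟨i, hin, rfl, hmax⟩
  refine Runs.seq (runs_eventCircle hk hW h.bound) ?_
  intro s2 hs2
  simp only [Function.update_self] at hs2
  obtain ⟨nA, rA, r0, r11, r13, r14, r15, q3, q45⟩ := hs2
  have hnorm : normals ⟨Function.update (Function.update s.natReg 12 (n + i)) 11 i, s.realReg,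
    s.natArr, s.realArr⟩ = N := h.normals_eq
  have hnorm2 : normals s2 = N := by rw [← h.normals_eq]; unfold normals; rw [rA]
  rw [hnorm, h.offsets_eq] at q3 q45
  have r0' : s2.natReg 0 = n := by rw [r0]; simpa using h.size
  have r15' : s2.natReg 15 = 0 := by rw [r15]; simpa using hdone
  obtain ⟨hiA, hρ', hdet, hS⟩ := h.advance hin hmax q3
  set nx := s.natArr 0 with hnx
  set pv := s.natArr 1 with hpv
  have hl := hS.pv_mem i hiA
  have hr := hS.nx_mem i hiA
  have hl_lt := hS.lt _ hl
  have hr_lt := hS.lt _ hr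
  -- No array has been written yet, so the old memory also describes the polygon shrunk to the new
  -- radius.
  have hmem : Shrinking n N d A (s2.realReg 3) s2 := by
    constructor
    · exact r0'
    · exact hnorm2
    · rw [rA]; exact h.offsets_eq
    · rw [nA]; exact h.bound
    · exact h.nonempty
    · exact hρ'.le
    · rw [nA]; exact hS
    · rw [rA]; exact h.tree
    · rw [nA]; exact h.det_pos
    · rw [nA, rA]; exact h.key
    · rw [rA]; exact h.dead
    · have : centres s2 = centres s := by unfold centres; rw [rA]
      rw [nA, rA, this]; exact h.forest
  refine Runs.ite hk (fun hb => ?_) fun hb => ?_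
  · simp only [Test.Holds, crossE_value, NatExp.value, RealExp.value, r13, r14, hnorm2] at hb
    refine Runs.of_wp hk ⟨by simp [NatExp.value]; omega, Or.inl ⟨by simp [NatExp.value], _, rfl,
      hρ', ?_, ?_⟩⟩
    · exact ⟨by simpa using hmem.1, hmem.2, hmem.3, hmem.4, hmem.5, hmem.6, hmem.7, hmem.8, hmem.9,
        hmem.10, hmem.11, hmem.12⟩
    · intro o r ho
      exact hS.le_of_cross_nonpos hiA hdet (by simpa using hb) ho
  · simp only [Test.Holds, crossE_value, NatExp.value, RealExp.value, r13, r14, hnorm2] at hb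
    have hc : 0 < cross (N (pv i)) (N (nx i)) := by simpa using hb
    refine Runs.seq (runs_unlink hk hW r0' hmem.bound (by rwa [r11]) (by rwa [r13])
      (by rwa [r14])) ?_
    rintro s3 ⟨g0, gb, a0, a1, a2, a3, b2, b3, b4, b8, p1, p2, p3, p4⟩
    rw [r11] at a2 a3 p1 p2 p3 p4
    rw [r13] at a0 a1 a2 a3
    rw [r14] at a0 a1
    rw [nA] at a0 a1 a2 a3
    rw [← hnx] at a0
    rw [← hpv] at a1
    have R := hS.remove hiA hdet hc
    have hlr : nx i ≠ pv i := hS.nx_ne_pv hiA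
    have hli : pv i ≠ i := hS.pv_ne hiA
    have hri : nx i ≠ i := hS.nx_ne hiA
    refine Runs.seq (runs_setLeaf (n := n) _ (by omega) (by rw [g0]; exact r0')
      (by rw [g0, r11]; exact hin) hn (by rw [b8, rA]; exact h.tree)) ?_
    rintro s4 ⟨M4, rfl, t4, m4⟩
    have N3 : ∀ (f : ℕ → ℕ) (g : ℕ → ℝ) (M : ℕ → ℝ),
        normals ⟨f, g, s3.natArr, Function.update s3.realArr 8 M⟩ = N := by
      intro f g M
      rw [← hnorm2]; unfold normals; simp [b2, b3]
    have D3 : ∀ M : ℕ → ℝ, Function.update s3.realArr 8 M 4 = d := by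
      intro M
      rw [Function.update_of_ne (by decide), b4, rA]; exact h.offsets_eq
    refine Runs.seq (Runs.of_wp hk (Q := fun s5 => s5 = ⟨Function.update
      (Function.update s3.natReg 10 0) 11 (pv i), s3.realReg, s3.natArr,
      Function.update s3.realArr 8 M4⟩) ?_) ?_
    · simp only [Prog.wp, NatExp.value]
      rw [Function.update_of_ne (by decide), g0, r13]
      exact ⟨by omega, rfl⟩
    rintro s5 rfl
    refine Runs.seq (runs_setLeaf (n := n) _ (by omega) ?_ (by simpa using hl_lt) hn
      (by simpa using t4)) ?_
    · simp [g0, r0']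
    rintro s6 ⟨M6, rfl, t6, m6⟩
    simp only [keyE_value, N3, D3, a0, a1, Function.update_self] at m6
    refine Runs.seq (Runs.of_wp hk (Q := fun s7 => s7.natReg 0 = n ∧ s7.natReg 11 = nx i ∧
      s7.natReg 15 = 0 ∧ s7.natArr = s3.natArr ∧ s7.realArr = Function.update s3.realArr 8 M6) ?_) ?_
    · simp [Prog.wp, NatExp.value, g0, r14, r0', r15']
      omega
    rintro ⟨x7, y7, z7, w7⟩ ⟨c0, c11, c15, rfl, rfl⟩
    simp only at c0 c11 c15
    refine (runs_setLeaf (n := n) _ (by omega) c0 (by simpa only [c11] using hr_lt) hn (by simpa using t6)).mono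
      le_rfl ?_
    rintro s8 ⟨M8, rfl, t8, m8⟩
    simp only [keyE_value, N3, D3, a0, a1, c11, Function.update_self] at m8
    have leaf : ∀ j < n, M8 (n + j) = if j = nx i then
        sideOrient N (Function.update nx (pv i) (nx i)) (Function.update pv (nx i) (pv i)) (nx i) /
        sideDet N d (Function.update nx (pv i) (nx i)) (Function.update pv (nx i) (pv i)) (nx i) else
        if j = pv i then
        sideOrient N (Function.update nx (pv i) (nx i)) (Function.update pv (nx i) (pv i)) (pv i) /
        sideDet N d (Function.update nx (pv i) (nx i)) (Function.update pv (nx i) (pv i)) (pv i) else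
        if j = i then 0 else s.realArr 8 (n + j) := by
      intro j hj
      rw [m8 _ (by omega), Function.update_apply, m6 _ (by omega), Function.update_apply,
        m4 _ (by omega), Function.update_apply, b8, rA, g0, r11]
      simp [RealExp.value]
    refine Or.inr ⟨by simpa using c15, A.erase i, s2.realReg 3, Finset.card_erase_lt_of_mem hiA, ?_⟩
    -- A surviving side still has `ρ' * sideOrient ≤ sideDet`, and the left side is positive.
    have hdet' : ∀ j ∈ A.erase i, 0 < sideDet N d (Function.update nx (pv i) (nx i))
        (Function.update pv (nx i) (pv i)) j := by
      intro j hj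
      exact (mul_pos hρ' (R.orient_pv_pos hj)).trans_le (R.le j hj)
    constructor
    · simpa using c0
    · simp only [Function.update_idem]; exact N3 _ _ _
    · simp only [Function.update_idem]; exact D3 _
    · exact gb
    · exact ⟨pv i, Finset.mem_erase.2 ⟨hli, hl⟩⟩
    · exact hρ'.le
    · simp only [a0, a1]; exact R
    · simpa using t8
    · simp only [a0, a1]; exact hdet'
    · intro j hj
      simp only [a0, a1, Function.update_self]
      have hj' := Finset.mem_erase.1 hj
      rw [leaf j (h.shrunk.lt j hj'.2)]
      split_ifs with e1 e2 e3
      · rw [e1]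
      · rw [e2]
      · exact absurd e3 hj'.1
      · rw [h.key j hj'.2]
        unfold sideOrient sideDet
        rw [Function.update_of_ne e1, Function.update_of_ne e2]
    · intro j hj hjA
      simp only [Function.update_self]
      rw [leaf j hj]
      split_ifs with e1 e2 e3
      · exact absurd (Finset.mem_erase.2 ⟨by rw [e1]; exact hri, by rw [e1]; exact hr⟩) hjA
      · exact absurd (Finset.mem_erase.2 ⟨by rw [e2]; exact hli, by rw [e2]; exact hl⟩) hjA
      · rfl
      · exact h.dead j hj fun hA => hjA (Finset.mem_erase.2 ⟨e3, hA⟩)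
    · obtain ⟨V, ch, rk, F⟩ := h.forest
      -- The program computes the corner before side `i`; by `corner_pv_eq` it is also the corner
      -- after it.
      have hnode : CyclicList.corner N nx (fun i => d i - s2.realReg 3) (pv i) =
          (s2.realReg 4, s2.realReg 5) := by
        rw [q45]; unfold CyclicList.corner; rw [hS.nx_pv i hiA]
      have hfeas := hS.feasible_corner hl
      have tl := hS.dot_corner (a := fun i => d i - s2.realReg 3) hl
      have ti := hS.dot_corner_pv (a := fun i => d i - s2.realReg 3) hiA
      have tr := hS.dot_corner_nx (a := fun i => d i - s2.realReg 3) hiA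
      rw [hS.corner_pv_eq hiA hdet] at tr
      rw [hnode] at hfeas tl ti tr
      have hcen : centres s2 = centres s := by unfold centres; rw [rA]
      obtain ⟨V', ch', rk', F'⟩ := F.remove hS.toCyclicList hS.lt hiA hρ' hfeas
        (by rw [tl]; ring) (by rw [ti]; ring) (by rw [tr]; ring)
        (inCone_of_cross hc (hS.cross_pv_pos hiA).le (hS.cross_pos i hiA).le)
        (P' := centres s3) (R' := s3.realArr 7) p1 (by rw [← hcen]; exact p2) p3
        (by rw [← rA]; exact p4)
      refine ⟨V', ch', rk', ?_⟩
      have hcen3 : centres (⟨Function.update x7 10 0, y7, s3.natArr,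
          Function.update (Function.update s3.realArr 8 M6) 8 M8⟩ : State) = centres s3 := by
        unfold centres; simp
      rw [hcen3]
      simp only [a0, a2, a3]
      simpa using F'

end CircleQuery

/-! ### Storing the sides in counterclockwise order. -/

namespace CircleQuery

open RealRAM

/-- The coordinates of the polygon, in counterclockwise order if `τ` is its orientation. -/
noncomputable def vertexIdx (n : ℕ) (τ : ℝ) (i : ℕ) : ℕ := open Classical in
  if 0 ≤ τ then i else n - 1 - i

/-- Put the position of the side in integer register `11` into the registers `10`, `12`, `13`. -/
def sideIndices : Prog :=
  .seq (.ite (.natLe (.add (.reg 11) (.const 2)) (.reg 0))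
    (.setNatReg 10 (.add (.reg 11) (.const 1))) (.setNatReg 10 (.const 0))) <|
  .ite (.realLe (.const 0) (.reg 3))
    (.seq (.setNatReg 12 (.reg 11)) (.setNatReg 13 (.reg 10)))
    (.seq (.setNatReg 12 (.sub (.sub (.reg 0) (.const 1)) (.reg 11)))
      (.setNatReg 13 (.sub (.sub (.reg 0) (.const 1)) (.reg 10))))

/-- Store the side in integer register `11`, whose ends are the vertices in `12` and `13`. -/
def storeSide : Prog :=
  .seq (.setRealReg 4 (.sub (.arr 0 (.reg 13)) (.arr 0 (.reg 12)))) <|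
  .seq (.setRealReg 5 (.sub (.arr 1 (.reg 13)) (.arr 1 (.reg 12)))) <|
  .seq (.setRealReg 6 (.sqrt (.add (.mul (.reg 4) (.reg 4)) (.mul (.reg 5) (.reg 5))))) <|
  .seq (.setRealArr 2 (.reg 11) (.div (.reg 5) (.reg 6))) <|
  .seq (.setRealArr 3 (.reg 11)
    (.div (.sub (.arr 0 (.reg 12)) (.arr 0 (.reg 13))) (.reg 6))) <|
  .seq (.setRealArr 4 (.reg 11) (.add (.mul (.arr 2 (.reg 11)) (.arr 0 (.reg 12)))
    (.mul (.arr 3 (.reg 11)) (.arr 1 (.reg 12))))) <|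
  .seq (.setRealArr 5 (.reg 11) (.arr 0 (.reg 13))) <|
  .seq (.setRealArr 6 (.reg 11) (.arr 1 (.reg 13))) <|
  .seq (.setNatArr 0 (.reg 11) (.reg 10)) <|
  .seq (.setNatArr 1 (.reg 10) (.reg 11)) <|
  .seq (.setNatArr 2 (.reg 11) (.reg 11)) <|
  .setNatReg 11 (.add (.reg 11) (.const 1))

/-- Store all sides, in counterclockwise order. -/
def storeSides : Prog :=
  .seq (.seq (.setRealReg 3 (.sub
    (.mul (.sub (.arr 0 (.const 1)) (.arr 0 (.const 0)))
      (.sub (.arr 1 (.const 2)) (.arr 1 (.const 0))))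
    (.mul (.sub (.arr 1 (.const 1)) (.arr 1 (.const 0)))
      (.sub (.arr 0 (.const 2)) (.arr 0 (.const 0))))))
    (.setNatReg 11 (.const 0)))
  (.loop (.neg (.natLe (.reg 0) (.reg 11))) (.seq sideIndices storeSide))

/-- The memory after the first `i` sides of the polygon `U` have been stored. -/
structure StoredSides (n : ℕ) (U : ℕ → ℝ × ℝ) (i : ℕ) (s : State) : Prop where
  size : s.natReg 0 = n
  bound : ∀ a j, s.natArr a j < 3 * n
  radius : s.realArr 7 = fun _ => 0
  tree : s.realArr 8 = fun _ => 0
  normals_eq : ∀ j < i, normals s j = normal (U j) (U (succIdx n j))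
  offset_eq : ∀ j < i, s.realArr 4 j = dot (normals s j) (U j)
  centre_eq : ∀ j < i, centres s j = U (succIdx n j)
  next_eq : ∀ j < i, s.natArr 0 j = succIdx n j
  prev_eq : ∀ j < i, s.natArr 1 (succIdx n j) = j
  chord_eq : ∀ j < i, s.natArr 2 j = j

theorem runs_sideIndices {W n : ℕ} {s : State} {k : ℕ} (hk : 1 ≤ k) (hW : n ≤ W)
    (hn : s.natReg 0 = n) (hi : s.natReg 11 < n) : Runs W sideIndices s k fun s' =>
      s'.natReg 0 = n ∧ s'.natReg 11 = s.natReg 11 ∧ s'.natReg 10 = succIdx n (s.natReg 11) ∧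
      s'.natReg 12 = vertexIdx n (s.realReg 3) (s.natReg 11) ∧
      s'.natReg 13 = vertexIdx n (s.realReg 3) (succIdx n (s.natReg 11)) ∧
      s'.realReg = s.realReg ∧ s'.natArr = s.natArr ∧ s'.realArr = s.realArr := by
  refine Runs.of_wp hk ?_
  simp only [sideIndices, Prog.wp, Test.Holds, NatExp.value, RealExp.value, succIdx, vertexIdx]
  constructor <;> intro h1 <;> simp only [hn] at h1
  · rw [if_pos (by omega)]
    refine ⟨by omega, fun h2 => ?_, fun h2 => ?_⟩ <;> simp at h2 <;> simp [h2, hn]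
    · omega
    · omega
  · rw [if_neg (by omega)]
    refine ⟨by omega, fun h2 => ?_, fun h2 => ?_⟩ <;> simp at h2 <;> simp [h2, hn]
    · omega
    · omega

theorem runs_storeSide {W n : ℕ} {s : State} {k : ℕ} {U : ℕ → ℝ × ℝ} (hk : 1 ≤ k) (hW : 3 * n ≤ W)
    (hi : s.natReg 11 < n) (hS : StoredSides n U (s.natReg 11) s)
    (h10 : s.natReg 10 = succIdx n (s.natReg 11))
    (h12 : (s.realArr 0 (s.natReg 12), s.realArr 1 (s.natReg 12)) = U (s.natReg 11))
    (h13 : (s.realArr 0 (s.natReg 13), s.realArr 1 (s.natReg 13)) = U (succIdx n (s.natReg 11))) :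
    Runs W storeSide s k fun s' =>
      s'.natReg 11 = s.natReg 11 + 1 ∧ s'.realReg 3 = s.realReg 3 ∧
      s'.realArr 0 = s.realArr 0 ∧ s'.realArr 1 = s.realArr 1 ∧
      StoredSides n U (s.natReg 11 + 1) s' := by
  obtain ⟨hn, hb, h7, h8, e1, e2, e3, e4, e5, e6⟩ := hS
  have hsucc := succIdx_lt hi
  refine Runs.of_wp hk ?_
  simp only [storeSide, Prog.wp, NatExp.value, RealExp.value]
  simp
  refine ⟨by omega, by omega, by omega, by omega, by omega, ?_⟩
  generalize s.natReg 11 = i at *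
  have old : ∀ j < i + 1, j ≠ i → j < i := fun j h1 h2 => by omega
  constructor
  · simpa using hn
  · simp only [State.natArr_setNatReg, State.natArr_setNatArr, State.natArr_setRealArr,
      State.natArr_setRealReg]
    refine lt_update_arr (lt_update_arr (lt_update_arr hb ?_) ?_) ?_
    · exact lt_update (hb 0) (by omega)
    · exact lt_update (by simpa using hb 1) (by omega)
    · exact lt_update (by simpa using hb 2) (by omega)
  · simpa using h7
  · simpa using h8
  · intro j hj
    by_cases e : j = i
    · subst e
      simp [normals, normal, len, ← h12, ← h13]
    · rw [← e1 j (old j hj e)]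
      simp [normals, e]
  · intro j hj
    by_cases e : j = i
    · subst e
      simp [normals, dot, ← h12]
    · have := e2 j (old j hj e)
      simp [normals, dot, e] at this ⊢
      exact this
  · intro j hj
    by_cases e : j = i
    · subst e
      simp [centres, ← h13]
    · rw [← e3 j (old j hj e)]
      simp [centres, e]
  · intro j hj
    by_cases e : j = i
    · subst e; simp [h10]
    · rw [← e4 j (old j hj e)]; simp [e]
  · intro j hj
    by_cases e : j = i
    · subst e; simp [h10]
    -- `succIdx` is injective below `n`, so earlier backward links are not overwritten.
    · have hne : succIdx n j ≠ succIdx n i := by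
        have := old j hj e
        unfold succIdx; split_ifs <;> omega
      have := e5 j (old j hj e)
      simp [h10, hne, this]
  · intro j hj
    by_cases e : j = i
    · subst e; simp
    · rw [← e6 j (old j hj e)]; simp [e, e6 j (old j hj e)]

/-- The corners of the polygon in the initial memory, in counterclockwise order. -/
noncomputable def inputVertex (n : ℕ) (τ : ℝ) (X Y : ℕ → ℝ) (i : ℕ) : ℝ × ℝ :=
  (X (vertexIdx n τ i), Y (vertexIdx n τ i))

theorem runs_storeSides {W n : ℕ} {s : State} (hW : 3 * n ≤ W) (hn : s.natReg 0 = n)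
    (hb : ∀ a j, s.natArr a j < 3 * n) (h7 : s.realArr 7 = fun _ => 0)
    (h8 : s.realArr 8 = fun _ => 0) {τ : ℝ}
    (hτ : τ = orient (s.realArr 0 0, s.realArr 1 0) (s.realArr 0 1, s.realArr 1 1)
      (s.realArr 0 2, s.realArr 1 2)) :
    Runs W storeSides s (n + 1)
      (StoredSides n (inputVertex n τ (s.realArr 0) (s.realArr 1)) n) := by
  rw [orient_eq_sub] at hτ
  let I : ℕ → State → Prop := fun m s' => s'.natReg 11 + m = n ∧ s'.realReg 3 = τ ∧
    s'.realArr 0 = s.realArr 0 ∧ s'.realArr 1 = s.realArr 1 ∧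
    StoredSides n (inputVertex n τ (s.realArr 0) (s.realArr 1)) (s'.natReg 11) s'
  refine Runs.seq (Q := I n) (Runs.of_wp (by omega) ?_) fun s1 hs1 =>
    (Runs.loop le_rfl I ?_ hs1).mono (by omega) ?_
  · simp only [Prog.wp, NatExp.value, RealExp.value]
    refine ⟨by omega, by simp, by simpa using hτ.symm, by simp, by simp, ?_⟩
    constructor <;> simp [hn, hb, h7, h8]
  · rintro m s2 ⟨i1, i2, i3, i4, i5⟩ hbt
    simp only [Test.Holds, NatExp.value, i5.size, not_le] at hbt
    refine Runs.seq (runs_sideIndices le_rfl (by omega) i5.size hbt) ?_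
    rintro s3 ⟨j0, j11, j10, j12, j13, jr, jn, ja⟩
    have hS : StoredSides n (inputVertex n τ (s.realArr 0) (s.realArr 1)) (s3.natReg 11) s3 := by
      rw [j11]
      constructor
      · exact j0
      · rw [jn]; exact i5.bound
      · rw [ja]; exact i5.radius
      · rw [ja]; exact i5.tree
      · simpa only [normals, ja] using i5.normals_eq
      · simpa only [normals, ja] using i5.offset_eq
      · simpa only [centres, ja] using i5.centre_eq
      · rw [jn]; exact i5.next_eq
      · rw [jn]; exact i5.prev_eq
      · rw [jn]; exact i5.chord_eq
    refine (runs_storeSide le_rfl hW (by omega) hS (by rw [j10, j11]) ?_ ?_).mono le_rfl ?_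
    · rw [j12, j11, ja, i2, i3, i4]; rfl
    · rw [j13, j11, ja, i2, i3, i4]; rfl
    · rintro s4 ⟨k11, k3, k0, k1, kS⟩
      refine ⟨m - 1, by omega, by omega, by rw [k3, jr, i2], by rw [k0, ja, i3],
        by rw [k1, ja, i4], by rw [k11]; exact kS⟩
  · rintro s2 ⟨m, ⟨i1, i2, i3, i4, i5⟩, hbt⟩
    simp only [Test.Holds, NatExp.value, i5.size, not_not] at hbt
    have : s2.natReg 11 = n := by omega
    rwa [this] at i5

end CircleQuery

/-! ### The remaining preprocessing programs and the main loop. -/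

namespace CircleQuery

open RealRAM

/-- Build the max-tree of the reciprocal radii at which the sides vanish. -/
def storeKeys : Prog :=
  .seq (.setNatReg 11 (.const 0)) <|
  .loop (.neg (.natLe (.reg 0) (.reg 11)))
    (.seq (setLeaf keyE) (.setNatReg 11 (.add (.reg 11) (.const 1))))

/-- Run the shrinking process. -/
def shrinkLoop : Prog :=
  .seq (.setNatReg 15 (.const 0)) (.loop (.natLe (.reg 15) (.const 0)) shrinkStep)

/-- Store the root node of the surviving side in integer register `11`. -/
def storeRoot : Prog :=
  .seq (.setNatReg 14 (.arr 0 (.reg 11))) <|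
  .seq (.setRealArr 5 (.add (.mul (.const 2) (.reg 0)) (.reg 11)) (cornerXE (.reg 11) (.reg 14))) <|
  .seq (.setRealArr 6 (.add (.mul (.const 2) (.reg 0)) (.reg 11)) (cornerYE (.reg 11) (.reg 14))) <|
  .seq (.setRealArr 7 (.add (.mul (.const 2) (.reg 0)) (.reg 11)) (.reg 3)) <|
  .seq (.setNatArr 3 (.arr 2 (.reg 11)) (.add (.mul (.const 2) (.reg 0)) (.reg 11))) <|
  .setNatArr 3 (.add (.mul (.const 2) (.reg 0)) (.reg 11))
    (.add (.mul (.const 2) (.reg 0)) (.reg 11))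

/-- Store the root nodes of all surviving sides. -/
def storeRoots : Prog :=
  .seq (.setNatReg 11 (.const 0)) <|
  .loop (.neg (.natLe (.reg 0) (.reg 11))) <|
  .seq (.ite (.realLe (.arr 8 (.add (.reg 0) (.reg 11))) (.const 0)) .skip storeRoot)
    (.setNatReg 11 (.add (.reg 11) (.const 1)))

/-- Compute the number of levels of the table of ancestors. -/
def countLevels : Prog :=
  .seq (.seq (.setNatReg 9 (.const 0)) (.setNatReg 10 (.const 1))) <|
  .loop (.neg (.natLe (.mul (.const 3) (.reg 0)) (.reg 10))) <|
  .seq (.setNatReg 10 (.mul (.const 2) (.reg 10))) (.setNatReg 9 (.add (.reg 9) (.const 1)))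

/-- Fill the table of ancestors at distances `2 ^ k`. -/
def fillTable : Prog :=
  .seq (.setNatReg 11 (.mul (.const 3) (.reg 0))) <|
  .loop (.neg (.natLe (.mul (.add (.reg 9) (.const 1)) (.mul (.const 3) (.reg 0))) (.reg 11))) <|
  .seq (.setNatArr 3 (.reg 11) (.arr 3 (.add
      (.mul (.sub (.div (.reg 11) (.mul (.const 3) (.reg 0))) (.const 1))
        (.mul (.const 3) (.reg 0)))
      (.arr 3 (.sub (.reg 11) (.mul (.const 3) (.reg 0)))))))
    (.setNatReg 11 (.add (.reg 11) (.const 1)))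

/-- The preprocessing. -/
def preprocess : Prog :=
  .seq storeSides <| .seq storeKeys <| .seq shrinkLoop <| .seq storeRoots <|
  .seq countLevels fillTable

theorem StoredSides.isSides {n : ℕ} {U : ℕ → ℝ × ℝ} {s : State} (h : StoredSides n U n s) :
    IsSides n U (normals s) (s.realArr 4) :=
  fun i hi => ⟨h.normals_eq i hi, h.offset_eq i hi⟩

theorem runs_storeKeys {W n : ℕ} {U : ℕ → ℝ × ℝ} {s : State} (hW : 3 * n ≤ W) (hU : IsCcw n U)
    (h : StoredSides n U n s) : Runs W storeKeys s ((Nat.log 2 n + 2) * (n + 1))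
      (Shrinking n (normals s) (s.realArr 4) (Finset.range n) 0) := by
  have hn := hU.1
  have hk : 1 ≤ Nat.log 2 n + 2 := by omega
  let I : ℕ → State → Prop := fun m s' => s'.natReg 0 = n ∧ s'.natReg 11 + m = n ∧
    s'.natArr = s.natArr ∧ (∀ a, a ≠ 8 → s'.realArr a = s.realArr a) ∧ IsMaxTree n (s'.realArr 8) ∧
    ∀ j < s'.natReg 11, s'.realArr 8 (n + j) =
      sideOrient (normals s) (s.natArr 0) (s.natArr 1) j /
        sideDet (normals s) (s.realArr 4) (s.natArr 0) (s.natArr 1) j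
  refine Runs.seq (Q := I n) (Runs.of_wp (Nat.mul_pos hk (by omega)) ?_) fun s1 hs1 =>
    (Runs.loop hk I ?_ hs1).mono le_rfl ?_
  · refine ⟨Nat.zero_le _, by simpa using h.size, by simp [NatExp.value], rfl, fun _ _ => rfl, ?_,
      by simp [NatExp.value]⟩
    -- The all-zero array is a max-tree.
    intro j _ _
    simp [h.tree]
  · rintro m s2 ⟨i0, i11, iN, iR, iT, iK⟩ hb
    simp only [Test.Holds, NatExp.value, i0, not_le] at hb
    refine Runs.seq (runs_setLeaf (n := n) _ (by omega) i0 hb (by omega) iT) ?_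
    rintro s3 ⟨M, rfl, tM, hM⟩
    have hnorm : normals s2 = normals s := by
      unfold normals; rw [iR 2 (by decide), iR 3 (by decide)]
    rw [keyE_value, hnorm, iR 4 (by decide), iN] at hM
    refine Runs.of_wp hk ⟨?_, m - 1, by omega, ?_, ?_, iN, ?_, ?_, ?_⟩
    · simp [NatExp.value]; omega
    · simpa using i0
    · simp [NatExp.value]; omega
    · intro a ha
      simp [ha, iR a ha]
    · simpa using tM
    · intro j hj
      simp [NatExp.value] at hj ⊢
      rw [hM _ (by omega), Function.update_apply]
      split_ifs with e
      · rw [show s2.natReg 11 = j by omega]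
      · exact iK j (by omega)
  · rintro s2 ⟨m, ⟨i0, i11, iN, iR, iT, iK⟩, hb⟩
    simp only [Test.Holds, NatExp.value, i0, not_not] at hb
    obtain ⟨S, hpos⟩ := h.isSides.shrunk hU h.next_eq h.prev_eq
    constructor
    · exact i0
    · unfold normals; rw [iR 2 (by decide), iR 3 (by decide)]
    · exact iR 4 (by decide)
    · rw [iN]; exact h.bound
    · exact ⟨0, Finset.mem_range.2 (by omega)⟩
    · exact le_rfl
    · rw [iN]; exact S
    · exact iT
    · rw [iN]; exact fun i hi => (hpos i (Finset.mem_range.1 hi)).1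
    · rw [iN]
      intro i hi
      rw [Finset.mem_range] at hi
      exact iK i (by omega)
    · intro i hi hi'
      exact absurd (Finset.mem_range.2 hi) hi'
    · have hc : centres s2 = centres s := by
        unfold centres; rw [iR 5 (by decide), iR 6 (by decide)]
      rw [iN, hc, iR 7 (by decide)]
      exact ⟨_, _, _, h.isSides.forest hU h.next_eq h.chord_eq h.centre_eq
        fun i _ => by rw [h.radius]⟩

theorem runs_shrinkLoop {W n : ℕ} {N : ℕ → ℝ × ℝ} {d : ℕ → ℝ} {A : Finset ℕ} {ρ : ℝ} {s : State}
    (hW : 3 * n ≤ W) (hn : 2 ≤ n) (h : Shrinking n N d A ρ s) :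
    Runs W shrinkLoop s ((Nat.log 2 n + 2) * (n + 1)) fun s' => ∃ A' ρ', s'.realReg 3 = ρ' ∧
      0 < ρ' ∧ Shrinking n N d A' ρ' s' ∧ ∀ o r, Feasible n N d o r → r ≤ ρ' := by
  have hk : 1 ≤ Nat.log 2 n + 2 := by omega
  have hcard : A.card ≤ n := by
    have : A ⊆ Finset.range n := fun j hj => Finset.mem_range.2 (h.shrunk.lt j hj)
    simpa using Finset.card_le_card this
  let I : ℕ → State → Prop := fun m s' =>
    (s'.natReg 15 = 0 ∧ ∃ A ρ, A.card = m ∧ Shrinking n N d A ρ s') ∨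
    (s'.natReg 15 = 1 ∧ ∃ A' ρ', s'.realReg 3 = ρ' ∧ 0 < ρ' ∧ Shrinking n N d A' ρ' s' ∧
      ∀ o r, Feasible n N d o r → r ≤ ρ')
  refine Runs.seq (Q := I A.card) (Runs.of_wp (Nat.mul_pos hk (by omega)) ?_) fun s1 hs1 =>
    (Runs.loop hk I ?_ hs1).mono (Nat.mul_le_mul_left _ (by omega)) ?_
  · refine ⟨Nat.zero_le _, Or.inl ⟨by simp [NatExp.value], A, ρ, rfl, ?_⟩⟩
    exact ⟨by simpa using h.1, h.2, h.3, h.4, h.5, h.6, h.7, h.8, h.9, h.10, h.11, h.12⟩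
  · rintro m s2 (⟨h15, A2, ρ2, rfl, h2⟩ | ⟨h15, -⟩) hb
    · refine (runs_shrinkStep hW hn h2 h15).mono le_rfl ?_
      rintro s3 (⟨h15, ρ', h3, h4, h5, h6⟩ | ⟨h15, A', ρ', h3, h4⟩)
      -- The measure is the number of surviving sides, which is positive; the finished state is
      -- given measure `0`.
      · exact ⟨0, h2.nonempty.card_pos, Or.inr ⟨h15, A2, ρ', h3, h4, h5, h6⟩⟩
      · exact ⟨_, h3, Or.inl ⟨h15, A', ρ', rfl, h4⟩⟩
    · simp [Test.Holds, NatExp.value, h15] at hb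
  · rintro s2 ⟨m, ⟨h15, -⟩ | ⟨-, h2⟩, hb⟩
    · simp [Test.Holds, NatExp.value, h15] at hb
    · exact h2

end CircleQuery

/-! ### Roots of the forest and the table of ancestors. -/

namespace CircleQuery

open RealRAM

theorem runs_storeRoot {W n : ℕ} {s : State} {k : ℕ} (hk : 1 ≤ k) (hW : 3 * n ≤ W)
    (hn : s.natReg 0 = n) (hb : ∀ a i, s.natArr a i < 3 * n) (h11 : s.natReg 11 < n) :
    Runs W storeRoot s k fun s' =>
      s'.natReg 0 = n ∧ s'.natReg 11 = s.natReg 11 ∧ s'.realReg = s.realReg ∧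
      (∀ a i, s'.natArr a i < 3 * n) ∧ (∀ a, a ≠ 3 → s'.natArr a = s.natArr a) ∧
      s'.natArr 3 = Function.update (Function.update (s.natArr 3) (s.natArr 2 (s.natReg 11))
        (2 * n + s.natReg 11)) (2 * n + s.natReg 11) (2 * n + s.natReg 11) ∧
      (∀ a, a ≠ 5 → a ≠ 6 → a ≠ 7 → s'.realArr a = s.realArr a) ∧
      centres s' = Function.update (centres s) (2 * n + s.natReg 11)
        (corner (normals s (s.natReg 11)) (normals s (s.natArr 0 (s.natReg 11)))
          (s.realArr 4 (s.natReg 11) - s.realReg 3)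
          (s.realArr 4 (s.natArr 0 (s.natReg 11)) - s.realReg 3)) ∧
      s'.realArr 7 = Function.update (s.realArr 7) (2 * n + s.natReg 11) (s.realReg 3) := by
  have h1 := hb 2 (s.natReg 11)
  have h2 := hb 0 (s.natReg 11)
  refine Runs.of_wp hk ?_
  simp only [storeRoot, Prog.wp, NatExp.value, RealExp.value, cornerXE_value, cornerYE_value]
  simp [hn, normals]
  refine ⟨by omega, by omega, by omega, by omega, ?_, ?_, ?_, ?_⟩
  · exact lt_update_arr hb (lt_update (lt_update (hb 3) (by omega)) (by omega))
  · intro a ha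
    simp [ha]
  · intro a h5 h6 h7
    simp [h5, h6, h7]
  · funext c
    by_cases e : c = 2 * n + s.natReg 11
    · subst e; simp [centres]
    · simp [centres, e]

/-- A positive key recognizes a surviving side, since the final event removes nothing from the tree.
-/
theorem runs_storeRoots {W n : ℕ} {N : ℕ → ℝ × ℝ} {d : ℕ → ℝ} {A : Finset ℕ} {ρ : ℝ} {s : State}
    (hW : 3 * n ≤ W) (h : Shrinking n N d A ρ s) (h3 : s.realReg 3 = ρ) (hρ : 0 < ρ)
    (hmax : ∀ o r, Feasible n N d o r → r ≤ ρ) : Runs W storeRoots s (n + 1) fun s' =>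
      s'.natReg 0 = n ∧ (∀ a i, s'.natArr a i < 3 * n) ∧ normals s' = N ∧ s'.realArr 4 = d ∧
      ∃ V ch rk, Climb n N d (s'.natArr 3) (centres s') (s'.realArr 7) V ch rk := by
  obtain ⟨V, ch, rk, F⟩ := h.forest
  let I : ℕ → State → Prop := fun m s' => s'.natReg 0 = n ∧ s'.natReg 11 + m = n ∧
    s'.realReg 3 = ρ ∧ (∀ a i, s'.natArr a i < 3 * n) ∧ (∀ a, a ≠ 3 → s'.natArr a = s.natArr a) ∧
    (∀ a, a ≠ 5 → a ≠ 6 → a ≠ 7 → s'.realArr a = s.realArr a) ∧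
    (∀ c < 2 * n, centres s' c = centres s c ∧ s'.realArr 7 c = s.realArr 7 c) ∧
    (∀ j ∈ A, j < s'.natReg 11 → (s'.natArr 3 (s.natArr 2 j) = 2 * n + j ∧
      s'.natArr 3 (2 * n + j) = 2 * n + j) ∧
      centres s' (2 * n + j) = CyclicList.corner N (s.natArr 0) (fun i => d i - ρ) j ∧
      s'.realArr 7 (2 * n + j) = ρ) ∧
    ∀ c < 2 * n, (∀ j ∈ A, s.natArr 2 j ≠ c) → s'.natArr 3 c = s.natArr 3 c
  refine Runs.seq (Q := I n) (Runs.of_wp (by omega) ?_) fun s1 hs1 =>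
    (Runs.loop le_rfl I ?_ hs1).mono (by omega) ?_
  · exact ⟨Nat.zero_le _, by simpa using h.size, by simp [NatExp.value], by simpa using h3,
      h.bound, fun _ _ => rfl, fun _ _ _ _ => rfl, fun _ _ => ⟨rfl, rfl⟩,
      by simp [NatExp.value], fun _ _ _ => rfl⟩
  · rintro m s2 ⟨i0, i11, i3, iB, iN, iR, iO, iA, iU⟩ hb
    simp only [Test.Holds, NatExp.value, i0, not_le] at hb
    -- Between the branch and the increment, the invariant covers the earlier sides and the current
    -- side is recorded separately.
    refine Runs.seq (Q := fun s3 => I m { s3 with natReg := Function.update s3.natReg 11 (s2.natReg 11) } ∧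
      s3.natReg 0 = n ∧ s3.natReg 11 = s2.natReg 11 ∧ (s2.natReg 11 ∈ A →
      (s3.natArr 3 (s.natArr 2 (s2.natReg 11)) = 2 * n + (s2.natReg 11) ∧
      s3.natArr 3 (2 * n + (s2.natReg 11)) = 2 * n + (s2.natReg 11)) ∧
      centres s3 (2 * n + (s2.natReg 11)) =
        CyclicList.corner N (s.natArr 0) (fun i => d i - ρ) (s2.natReg 11) ∧
      s3.realArr 7 (2 * n + (s2.natReg 11)) = ρ)) (Runs.ite le_rfl (fun ht => ?_) fun ht => ?_) ?_
    · simp only [Test.Holds, NatExp.value, RealExp.value, i0,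
        iR 8 (by decide) (by decide) (by decide)] at ht
      refine Runs.of_wp le_rfl ⟨?_, i0, rfl, fun hA => ?_⟩
      · rw [Function.update_eq_self]
        exact ⟨i0, i11, i3, iB, iN, iR, iO, iA, iU⟩
      · have := h.key_pos hA
        simp at ht
        linarith
    · simp only [Test.Holds, NatExp.value, RealExp.value, i0,
        iR 8 (by decide) (by decide) (by decide)] at ht
      have hA : s2.natReg 11 ∈ A := by
        by_contra hA
        exact ht (by rw [h.dead _ hb hA]; simp)
      refine (runs_storeRoot le_rfl hW i0 iB hb).mono le_rfl ?_
      rintro s3 ⟨j0, j11, jr, jB, jN, j3, jR, jC, j7⟩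
      have hnorm : normals s2 = N := by
        rw [← h.normals_eq]; unfold normals
        rw [iR 2 (by decide) (by decide) (by decide), iR 3 (by decide) (by decide) (by decide)]
      rw [iN 2 (by decide)] at j3
      rw [iN 0 (by decide), hnorm, i3, iR 4 (by decide) (by decide) (by decide),
        h.offsets_eq] at jC
      rw [i3] at j7
      generalize s2.natReg 11 = i at *
      have hlt : ∀ j ∈ A, s.natArr 2 j < 2 * n := fun j hj => F.lt _ (F.chord_mem j hj)
      have hi := hlt i hA
      refine ⟨⟨?_, ?_, ?_, jB, ?_, ?_, ?_, ?_, ?_⟩, j0, j11, fun _ => ⟨⟨?_, ?_⟩, ?_, ?_⟩⟩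
      · simpa using j0
      · simpa using i11
      · rw [jr]; exact i3
      · intro a ha
        rw [← iN a ha]; exact jN a ha
      · intro a h5 h6 h7
        rw [← iR a h5 h6 h7]; exact jR a h5 h6 h7
      · intro c hc
        change centres s3 c = _ ∧ s3.realArr 7 c = _
        rw [jC, j7, Function.update_of_ne (by omega), Function.update_of_ne (by omega)]
        exact iO c hc
      · intro j hj hji
        simp only [Function.update_self] at hji
        -- Distinct surviving sides stand at distinct nodes, so the parent links of earlier sides
        -- are not overwritten.
        have e1 : s.natArr 2 j ≠ s.natArr 2 i := fun e => by
          have := F.chord_inj hj hA e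
          omega
        have := hlt j hj
        change (s3.natArr 3 _ = _ ∧ s3.natArr 3 _ = _) ∧ centres s3 _ = _ ∧ s3.realArr 7 _ = _
        rw [j3, jC, j7, Function.update_of_ne (by omega), Function.update_of_ne e1,
          Function.update_of_ne (by omega), Function.update_of_ne (by omega),
          Function.update_of_ne (by omega), Function.update_of_ne (by omega)]
        exact iA j hj hji
      · intro c hc hne
        change s3.natArr 3 c = _
        rw [j3, Function.update_of_ne (by omega), Function.update_of_ne (hne i hA).symm]
        exact iU c hc hne
      · rw [j3, Function.update_of_ne (by omega), Function.update_self]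
      · rw [j3, Function.update_self]
      · rw [jC, Function.update_self]; rfl
      · rw [j7, Function.update_self]
    · rintro s3 ⟨⟨k0, k11, k3, kB, kN, kR, kO, kA, kU⟩, l0, l11, lA⟩
      simp only [Function.update_self] at k11 kA
      refine Runs.of_wp le_rfl ⟨?_, m - 1, by omega, ?_, ?_, k3, kB, kN, kR, kO, ?_, kU⟩
      · simp [NatExp.value, l11]; omega
      · simpa using l0
      · simp [NatExp.value, l11]; omega
      · intro j hj hji
        simp [NatExp.value, l11] at hji
        by_cases e : j = s2.natReg 11
        · subst e; exact lA hj
        · exact kA j hj (by omega)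
  · rintro s2 ⟨m, ⟨i0, i11, i3, iB, iN, iR, iO, iA, iU⟩, hb⟩
    simp only [Test.Holds, NatExp.value, i0, not_not] at hb
    have hS := h.shrunk
    refine ⟨i0, iB, ?_, ?_, ?_⟩
    · rw [← h.normals_eq]; unfold normals
      rw [iR 2 (by decide) (by decide) (by decide), iR 3 (by decide) (by decide) (by decide)]
    · rw [← h.offsets_eq]; exact iR 4 (by decide) (by decide) (by decide)
    · have hA : ∀ j ∈ A, j < s2.natReg 11 := fun j hj => (hS.lt j hj).trans_le hb
      refine F.finish hS.toCyclicList hS.lt hρ hmax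
        (q := CyclicList.corner N (s.natArr 0) fun i => d i - ρ) (fun j hj => ⟨?_, ?_, ?_⟩)
        (fun j hj => (iA j hj (hA j hj)).1) iU (fun j hj => (iA j hj (hA j hj)).2) iO
      · exact hS.feasible_corner hj
      · rw [hS.dot_corner hj]; ring
      · rw [hS.dot_corner_nx hj]; ring

theorem runs_countLevels {W n : ℕ} {s : State} (hW : 6 * n ≤ W) (hW' : Nat.log 2 n + 3 ≤ W)
    (hn : s.natReg 0 = n) (hn0 : 1 ≤ n) : Runs W countLevels s (Nat.log 2 n + 4) fun s' =>
      s'.natReg 0 = n ∧ s'.natArr = s.natArr ∧ s'.realArr = s.realArr ∧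
      s'.natReg 9 ≤ Nat.log 2 n + 3 ∧ 3 * n ≤ 2 ^ s'.natReg 9 := by
  let I : ℕ → State → Prop := fun m s' => s'.natReg 0 = n ∧ s'.natArr = s.natArr ∧
    s'.realArr = s.realArr ∧ s'.natReg 9 + m = Nat.log 2 n + 3 ∧ s'.natReg 10 = 2 ^ s'.natReg 9
  refine Runs.seq (Q := I (Nat.log 2 n + 3)) (Runs.of_wp (by omega) ?_) fun s1 hs1 =>
    (Runs.loop_of_wp I ?_ hs1).mono (by omega) ?_
  · simp [Prog.wp, NatExp.value, I, hn]
    omega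
  · rintro m s2 ⟨i0, iN, iR, i9, i10⟩ hb
    simp only [Test.Holds, NatExp.value, i0, not_le] at hb
    -- `2 ^ (Nat.log 2 n + 3)` is four times a power exceeding `n`, so the loop must stop by then.
    have hm : m ≠ 0 := by
      rintro rfl
      rw [i10, show s2.natReg 9 = Nat.log 2 n + 3 by omega] at hb
      have h1 := lt_two_pow_log n
      rw [show Nat.log 2 n + 3 = Nat.log 2 n + 1 + 2 by ring, pow_add] at hb
      omega
    simp only [Prog.wp, NatExp.value]
    refine ⟨by omega, ?_, m - 1, by omega, ?_, iN, iR, ?_, ?_⟩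
    · simp; omega
    · simpa using i0
    · simp; omega
    · simp [i10, pow_succ]; ring
  · rintro s2 ⟨m, ⟨i0, iN, iR, i9, i10⟩, hb⟩
    simp only [Test.Holds, NatExp.value, i0, not_not] at hb
    exact ⟨i0, iN, iR, by omega, by omega⟩

/-- Row `k` occupies the entries from `k * (3 * n)` on. Walking through the linear index row by row,
every entry needed from row `k - 1` has already been written. -/
theorem runs_fillTable {W n : ℕ} {s : State} (hn : s.natReg 0 = n) (hn0 : 1 ≤ n)
    (hW : (s.natReg 9 + 1) * (3 * n) ≤ W) (hb : ∀ a i, s.natArr a i < 3 * n) :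
    Runs W fillTable s (s.natReg 9 * (3 * n) + 1) fun s' =>
      s'.natReg 0 = n ∧ s'.natReg 9 = s.natReg 9 ∧ s'.realArr = s.realArr ∧
      (∀ a i, s'.natArr a i < 3 * n) ∧
      ∀ k ≤ s.natReg 9, ∀ c < 3 * n, s'.natArr 3 (k * (3 * n) + c) = (s.natArr 3)^[2 ^ k] c := by
  set L := s.natReg 9 with hL
  let I : ℕ → State → Prop := fun m s' => s'.natReg 0 = n ∧ s'.natReg 9 = L ∧
    s'.realArr = s.realArr ∧ (∀ a i, s'.natArr a i < 3 * n) ∧ 3 * n ≤ s'.natReg 11 ∧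
    s'.natReg 11 + m = (L + 1) * (3 * n) ∧
    ∀ k, ∀ c < 3 * n, k * (3 * n) + c < s'.natReg 11 →
      s'.natArr 3 (k * (3 * n) + c) = (s.natArr 3)^[2 ^ k] c
  have h3 : 0 < 3 * n := by omega
  have hLn : (L + 1) * (3 * n) = L * (3 * n) + 3 * n := by ring
  have lt_iter : ∀ m, ∀ c < 3 * n, (s.natArr 3)^[m] c < 3 * n := by
    intro m c hc
    cases m with
    | zero => exact hc
    | succ m => rw [Function.iterate_succ_apply']; exact hb _ _
  refine Runs.seq (Q := I (L * (3 * n))) (Runs.of_wp (by omega) ?_) fun s1 hs1 =>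
    (Runs.loop_of_wp I ?_ hs1).mono le_rfl ?_
  · refine ⟨?_, ?_, ?_, rfl, hb, ?_, ?_, ?_⟩
    · simp only [NatExp.value, hn]; omega
    · simpa using hn
    · simpa using hL.symm
    · simp [NatExp.value, hn]
    · simp only [State.natReg_setNatReg, Function.update_self, NatExp.value, hn]; omega
    · intro k c hc hlt
      simp only [State.natReg_setNatReg, Function.update_self, NatExp.value, hn] at hlt
      obtain rfl : k = 0 := by
        by_contra hk
        have : 1 * (3 * n) ≤ k * (3 * n) := Nat.mul_le_mul_right _ (by omega)
        omega
      simp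
  · rintro m s2 ⟨i0, i9, iR, iB, i11, im, iT⟩ hbt
    simp only [Test.Holds, NatExp.value, i0, i9, not_le] at hbt
    simp only [Prog.wp, NatExp.value, i0]
    set t := s2.natReg 11 with ht
    have hv : s2.natArr 3 ((t / (3 * n) - 1) * (3 * n) + s2.natArr 3 (t - 3 * n)) < 3 * n := iB _ _
    refine ⟨⟨by omega, by omega⟩, ?_, m - 1, by omega, ?_, ?_, iR, ?_, ?_, ?_, ?_⟩
    · simp; omega
    · simpa using i0
    · simpa using i9
    · exact lt_update_arr iB (lt_update (iB 3) hv)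
    · simp; omega
    · simp; omega
    · intro k c hc hlt
      simp at hlt
      by_cases e : k * (3 * n) + c = t
      · simp only [State.natArr_setNatReg, State.natArr_setNatArr, Function.update_self, e]
        have hk : t / (3 * n) = k := by
          rw [← e, Nat.add_comm, Nat.add_mul_div_right _ _ h3, Nat.div_eq_of_lt hc, Nat.zero_add]
        obtain ⟨k, rfl⟩ : ∃ k', k = k' + 1 := by
          cases k with
          | zero => omega
          | succ k => exact ⟨k, rfl⟩
        have e2 : (k + 1) * (3 * n) = k * (3 * n) + 3 * n := by ring
        rw [hk, Nat.add_sub_cancel, show t - 3 * n = k * (3 * n) + c by omega,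
          iT k c hc (by omega)]
        have hc' := lt_iter (2 ^ k) c hc
        -- `2 ^ k` steps followed by `2 ^ k` steps.
        rw [iT k _ hc' (by omega), ← Function.iterate_add_apply, pow_succ, Nat.mul_two]
      · have := iT k c hc (by omega)
        simpa [← ht, e] using this
  · rintro s2 ⟨m, ⟨i0, i9, iR, iB, i11, im, iT⟩, hbt⟩
    simp only [Test.Holds, NatExp.value, i0, i9, not_not] at hbt
    refine ⟨i0, i9, iR, iB, fun k hk c hc => iT k c hc ?_⟩
    have : k * (3 * n) ≤ L * (3 * n) := Nat.mul_le_mul_right _ hk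
    omega

end CircleQuery

/-! ### Readiness for queries and the query program. -/

namespace CircleQuery

open RealRAM

/-- The memory is ready for queries on the polygon `U`. -/
structure Prepared (n : ℕ) (U : ℕ → ℝ × ℝ) (s : State) : Prop where
  size : s.natReg 0 = n
  sides : IsSides n U (normals s) (s.realArr 4)
  levels_le : s.natReg 9 ≤ Nat.log 2 n + 3
  le_pow_levels : 3 * n ≤ 2 ^ s.natReg 9
  bound : ∀ a i, s.natArr a i < 3 * n
  climb : ∃ par V ch rk,
    Climb n (normals s) (s.realArr 4) par (centres s) (s.realArr 7) V ch rk ∧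
      (∀ c, par c < 3 * n) ∧
      ∀ k ≤ s.natReg 9, ∀ c < 3 * n, s.natArr 3 (k * (3 * n) + c) = par^[2 ^ k] c

/-- Two memories agree in everything that a query does not overwrite. -/
def SameData (s s' : State) : Prop :=
  s'.natReg 0 = s.natReg 0 ∧ s'.natReg 9 = s.natReg 9 ∧ s'.natArr = s.natArr ∧
    s'.realArr = s.realArr

theorem Prepared.congr {n : ℕ} {U : ℕ → ℝ × ℝ} {s s' : State} (h : Prepared n U s)
    (hs : SameData s s') : Prepared n U s' := by
  obtain ⟨h0, h9, hN, hR⟩ := hs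
  have e1 : normals s' = normals s := by unfold normals; rw [hR]
  have e2 : centres s' = centres s := by unfold centres; rw [hR]
  constructor
  · rw [h0]; exact h.size
  · rw [e1, hR]; exact h.sides
  · rw [h9]; exact h.levels_le
  · rw [h9]; exact h.le_pow_levels
  · rw [hN]; exact h.bound
  · rw [e1, e2, hR, hN, h9]; exact h.climb

theorem runs_preprocess {W n : ℕ} {s : State} (hW : 3 * n * (Nat.log 2 n + 4) ≤ W)
    (hn : s.natReg 0 = n) (hN : s.natArr = fun _ _ => 0) (h7 : s.realArr 7 = fun _ => 0)
    (h8 : s.realArr 8 = fun _ => 0) {τ : ℝ}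
    (hτ : τ = orient (s.realArr 0 0, s.realArr 1 0) (s.realArr 0 1, s.realArr 1 1)
      (s.realArr 0 2, s.realArr 1 2))
    (hU : IsCcw n (inputVertex n τ (s.realArr 0) (s.realArr 1))) :
    Runs W preprocess s (3 * n * (Nat.log 2 n + 4))
      (Prepared n (inputVertex n τ (s.realArr 0) (s.realArr 1))) := by
  have hn3 := hU.1
  have e1 : 3 * n * (Nat.log 2 n + 4) = 3 * (n * Nat.log 2 n) + 12 * n := by ring
  have e2 : Nat.log 2 n ≤ n * Nat.log 2 n := Nat.le_mul_of_pos_left _ (by omega)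
  have e3 : (Nat.log 2 n + 2) * (n + 1) = n * Nat.log 2 n + Nat.log 2 n + 2 * n + 2 := by ring
  refine Runs.seq ((runs_storeSides (by omega) hn (fun a j => by rw [hN]; show 0 < 3 * n; omega) h7 h8 hτ).mono
    (by omega) fun _ => id) fun s1 h1 => ?_
  refine Runs.seq ((runs_storeKeys (by omega) hU h1).mono (by omega) fun _ => id) fun s2 h2 => ?_
  refine Runs.seq ((runs_shrinkLoop (by omega) (by omega) h2).mono (by omega) fun _ => id) ?_
  rintro s3 ⟨A, ρ, h3, hρ, hS, hmax⟩
  refine Runs.seq ((runs_storeRoots (by omega) hS h3 hρ hmax).mono (by omega) fun _ => id) ?_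
  rintro s4 ⟨i0, iB, iN, i4, iC⟩
  refine Runs.seq ((runs_countLevels (by omega) (by omega) i0 (by omega)).mono (by omega)
    fun _ => id) ?_
  rintro s5 ⟨j0, jN, jR, j9, jp⟩
  have hle : (s5.natReg 9 + 1) * (3 * n) ≤ 3 * n * (Nat.log 2 n + 4) := by
    rw [Nat.mul_comm]; exact Nat.mul_le_mul_left _ (by omega)
  refine (runs_fillTable j0 (by omega) (hle.trans hW) (by rw [jN]; exact iB)).mono ?_ ?_
  · rw [Nat.add_mul] at hle; omega
  · rintro s6 ⟨k0, k9, kR, kB, kT⟩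
    have n6 : normals s6 = normals s1 := by
      rw [← iN]; unfold normals; rw [kR, jR]
    have c6 : centres s6 = centres s4 := by unfold centres; rw [kR, jR]
    have d6 : s6.realArr 4 = s1.realArr 4 := by rw [kR, jR, i4]
    obtain ⟨V, ch, rk, C⟩ := iC
    -- The parent function is array `3` before the table is filled: its first `3 * n` entries are
    -- row `0`, and later entries are reused for the higher rows.
    refine ⟨k0, ?_, by rw [k9]; exact j9, by rw [k9]; exact jp, kB, s4.natArr 3, V, ch, rk, ?_,
      iB 3, ?_⟩
    · rw [n6, d6]; exact h1.isSides
    · rw [n6, d6, c6, kR, jR]; exact C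
    · rw [k9, ← jN]; exact kT

/-- Normalize the query line. -/
def normalizeQuery : Prog :=
  .seq (.setRealReg 3 (.sqrt (.add (.mul (.reg 0) (.reg 0)) (.mul (.reg 1) (.reg 1))))) <|
  .seq (.setRealReg 4 (.div (.reg 0) (.reg 3))) <|
  .seq (.setRealReg 5 (.div (.reg 1) (.reg 3))) (.setRealReg 6 (.div (.reg 2) (.reg 3)))

/-- The unit normal of the query line, pointing into the halfplane. -/
def queryNormal (s : State) : ℝ × ℝ := (s.realReg 4, s.realReg 5)

/-- The orientation of the first normal, the normal `x` and the query normal. -/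
def orientQueryE (x : NatExp) : RealExp :=
  .add (.add (crossE (.const 0) x) (.sub (.mul (.arr 2 x) (.reg 5)) (.mul (.arr 3 x) (.reg 4))))
    (.sub (.mul (.reg 4) (.arr 3 (.const 0))) (.mul (.reg 5) (.arr 2 (.const 0))))

/-- The signed distance from the query line of the circle at the node `x`. -/
def gapE (x : NatExp) : RealExp :=
  .sub (.add (.add (.mul (.reg 4) (.arr 5 x)) (.mul (.reg 5) (.arr 6 x))) (.reg 6)) (.arr 7 x)

theorem orientQueryE_value (s : State) (x : NatExp) : (orientQueryE x).value s =
    orient (normals s 0) (normals s (x.value s)) (queryNormal s) := rfl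

theorem gapE_value (s : State) (x : NatExp) : (gapE x).value s =
    dot (queryNormal s) (centres s (x.value s)) + s.realReg 6 - s.realArr 7 (x.value s) := rfl

/-- Find the leaf whose cone contains the query normal by binary search. -/
def searchLeaf : Prog :=
  .seq (.seq (.setNatReg 2 (.const 0)) (.setNatReg 3 (.reg 0))) <|
  .loop (.natLe (.add (.reg 2) (.const 2)) (.reg 3)) <|
  .seq (.setNatReg 4 (.div (.add (.reg 2) (.reg 3)) (.const 2))) <|
  .ite (.realLe (.const 0) (orientQueryE (.reg 4))) (.setNatReg 2 (.reg 4)) (.setNatReg 3 (.reg 4))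

/-- The ancestor of the node in integer register `2` at level `k` of the table. -/
def ancestorE (k : NatExp) : NatExp :=
  .arr 3 (.add (.mul k (.mul (.const 3) (.reg 0))) (.reg 2))

/-- Climb to the last ancestor whose circle is strictly inside the halfplane. -/
def climbUp : Prog :=
  .seq (.setNatReg 6 (.reg 9)) <|
  .loop (.natLe (.const 1) (.reg 6)) <|
  .seq (.setNatReg 6 (.sub (.reg 6) (.const 1))) <|
  .seq (.setNatReg 5 (ancestorE (.reg 6))) <|
  .ite (.realLe (gapE (.reg 5)) (.const 0)) .skip (.setNatReg 2 (.reg 5))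

/-- Interpolation between an entry of node `2` and of node `5` with weight in real register `7`. -/
def mixE (a : ℕ) : RealExp :=
  .add (.arr a (.reg 2)) (.mul (.reg 7) (.sub (.arr a (.reg 5)) (.arr a (.reg 2))))

/-- Report the circle between the node in integer register `2` and its parent that touches the
query line. -/
def reportBetween : Prog :=
  .seq (.setNatReg 5 (ancestorE (.const 0))) <|
  .seq (.setRealReg 7 (.div (gapE (.reg 2)) (.sub (gapE (.reg 2)) (gapE (.reg 5))))) <|
  .seq (.setRealReg 0 (mixE 5)) <| .seq (.setRealReg 1 (mixE 6)) <|
  .seq (.setRealReg 2 (mixE 7)) (.setNatReg 1 (.const 1))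

/-- Report the circle of the node in integer register `5`. -/
def reportRoot : Prog :=
  .seq (.setRealReg 0 (.arr 5 (.reg 5))) <| .seq (.setRealReg 1 (.arr 6 (.reg 5))) <|
  .seq (.setRealReg 2 (.arr 7 (.reg 5))) (.setNatReg 1 (.const 1))

/-- The query. -/
def answerQuery : Prog :=
  .seq normalizeQuery <| .seq searchLeaf <|
  .ite (.realLe (gapE (.reg 2)) (.const 0)) (.setNatReg 1 (.const 0)) <|
  .seq (.setNatReg 5 (ancestorE (.reg 9))) <|
  .ite (.realLe (gapE (.reg 5)) (.const 0)) (.seq climbUp reportBetween) reportRoot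

theorem runs_normalizeQuery {W : ℕ} {s : State} {k : ℕ} (hk : 1 ≤ k) {a b c l : ℝ}
    (ha : s.realReg 0 = a) (hb : s.realReg 1 = b) (hc : s.realReg 2 = c)
    (hl : l = Real.sqrt (a * a + b * b)) : Runs W normalizeQuery s k fun s' =>
      SameData s s' ∧ queryNormal s' = (a / l, b / l) ∧ s'.realReg 6 = c / l := by
  refine Runs.of_wp hk ?_
  simp [normalizeQuery, Prog.wp, RealExp.value, queryNormal, SameData, ha, hb, hc, hl]

/-- The orientation of `N 0`, `N i`, `w` is nonnegative at the lower bound and negative at the upper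
one, where `n` serves as a sentinel without condition. Adjacent bounds are exactly the hypothesis of
`inCone_of_search`. -/
theorem runs_searchLeaf {W n : ℕ} {U : ℕ → ℝ × ℝ} {s : State} (hU : IsCcw n U)
    (h : Prepared n U s) (hW : n ≤ W) (hw : dot (queryNormal s) (queryNormal s) = 1) :
    Runs W searchLeaf s (Nat.log 2 n + 2) fun s' =>
      SameData s s' ∧ s'.realReg = s.realReg ∧ s'.natReg 2 < n ∧
      InCone (normals s (s'.natReg 2)) (normals s (succIdx n (s'.natReg 2))) (queryNormal s) := by
  have hn := hU.1
  let I : ℕ → State → Prop := fun m s' => SameData s s' ∧ s'.realReg = s.realReg ∧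
    s'.natReg 2 < s'.natReg 3 ∧ s'.natReg 3 ≤ n ∧ s'.natReg 3 ≤ s'.natReg 2 + 2 ^ m ∧
    0 ≤ orient (normals s 0) (normals s (s'.natReg 2)) (queryNormal s) ∧
    (s'.natReg 3 < n → orient (normals s 0) (normals s (s'.natReg 3)) (queryNormal s) < 0)
  refine Runs.seq (Q := I (Nat.log 2 n + 1)) (Runs.of_wp (by omega) ?_) fun s1 hs1 =>
    (Runs.loop_of_wp I ?_ hs1).mono (by omega) ?_
  · have h1 := lt_two_pow_log n
    have h2 : orient (normals s 0) (normals s 0) (queryNormal s) = 0 := by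
      unfold orient cross; ring
    simp [Prog.wp, NatExp.value, I, SameData, h.size, h2]
    omega
  · rintro m s2 ⟨⟨i0, i9, iN, iR⟩, ir, i1, i2, i3, i4, i5⟩ hb
    simp only [Test.Holds, NatExp.value] at hb
    obtain ⟨m, rfl⟩ : ∃ m', m = m' + 1 := by
      cases m with
      | zero => simp at i3; omega
      | succ m => exact ⟨m, rfl⟩
    rw [pow_succ] at i3
    have e1 : ∀ k v, normals (s2.setNatReg k v) = normals s := by
      intro k v; unfold normals; simp [iR]
    have e2 : ∀ k v, queryNormal (s2.setNatReg k v) = queryNormal s := by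
      intro k v; unfold queryNormal; simp [ir]
    simp only [Prog.wp, Test.Holds, NatExp.value, RealExp.value, orientQueryE_value, e1, e2,
      State.natReg_setNatReg, Function.update_self, Rat.cast_zero]
    refine ⟨by omega, fun ht => ⟨by omega, m, by omega, ?_⟩, fun ht => ⟨by omega, m, by omega, ?_⟩⟩
    · refine ⟨⟨by simpa using i0, by simpa using i9, iN, iR⟩, ir, ?_, ?_, ?_, ?_, ?_⟩ <;> simp
      · omega
      · omega
      · omega
      · exact ht
      · exact i5
    · refine ⟨⟨by simpa using i0, by simpa using i9, iN, iR⟩, ir, ?_, ?_, ?_, ?_, ?_⟩ <;> simp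
      · omega
      · omega
      · omega
      · exact i4
      · exact fun _ => not_le.1 ht
  · rintro s2 ⟨m, ⟨hD, ir, i1, i2, i3, i4, i5⟩, hb⟩
    simp only [Test.Holds, NatExp.value] at hb
    refine ⟨hD, ir, by omega, h.sides.inCone_of_search hU hw (by omega) i4 fun hlt => ?_⟩
    have e : s2.natReg 3 = s2.natReg 2 + 1 := by omega
    rw [← e] at hlt ⊢
    exact i5 hlt

/-- Binary lifting: the gap is positive at the current ancestor and nonpositive `2 ^ k` steps above
it. Testing the ancestor `2 ^ k` steps up, with `k` one smaller, halves this distance; at `k = 0`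
the sign change is between a node and its parent. -/
theorem runs_climbUp {W n : ℕ} {s : State} {par : ℕ → ℕ} {c : ℕ} {g : ℕ → ℝ}
    (hn : s.natReg 0 = n) (hL : s.natReg 9 ≤ W) (hW : 3 * n ≤ W)
    (hpar : ∀ c, par c < 3 * n)
    (hT : ∀ k ≤ s.natReg 9, ∀ c < 3 * n, s.natArr 3 (k * (3 * n) + c) = par^[2 ^ k] c)
    (hg : g = fun x => dot (queryNormal s) (centres s x) + s.realReg 6 - s.realArr 7 x)
    (h2 : s.natReg 2 = c) (hc : c < 3 * n) (hpos : 0 < g c)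
    (hneg : g (par^[2 ^ s.natReg 9] c) ≤ 0) :
    Runs W climbUp s (s.natReg 9 + 1) fun s' => SameData s s' ∧ s'.realReg = s.realReg ∧
      ∃ m, s'.natReg 2 = par^[m] c ∧ 0 < g (par^[m] c) ∧ g (par (par^[m] c)) ≤ 0 := by
  have lt_iter : ∀ m, par^[m] c < 3 * n := by
    intro m
    cases m with
    | zero => exact hc
    | succ m => rw [Function.iterate_succ_apply']; exact hpar _
  let I : ℕ → State → Prop := fun k s' => SameData s s' ∧ s'.realReg = s.realReg ∧
    s'.natReg 6 = k ∧ k ≤ s.natReg 9 ∧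
    ∃ m, s'.natReg 2 = par^[m] c ∧ 0 < g (par^[m] c) ∧ g (par^[2 ^ k] (par^[m] c)) ≤ 0
  refine Runs.seq (Q := I (s.natReg 9)) (Runs.of_wp (by omega) ?_) fun s1 hs1 =>
    (Runs.loop_of_wp I ?_ hs1).mono le_rfl ?_
  · refine ⟨hL, ⟨by simp, by simp, rfl, rfl⟩, rfl, by simp [NatExp.value], le_rfl, 0, by simpa using h2,
      hpos, hneg⟩
  · rintro k s2 ⟨⟨i0, i9, iN, iR⟩, ir, rfl, i6, m, j2, jpos, jneg⟩ hbt
    simp only [Test.Holds, NatExp.value] at hbt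
    obtain ⟨k, hk⟩ : ∃ k, s2.natReg 6 = k + 1 := ⟨s2.natReg 6 - 1, by omega⟩
    have hz : s2.natArr 3 (k * (3 * n) + par^[m] c) = par^[2 ^ k] (par^[m] c) := by
      rw [iN]; exact hT k (by omega) _ (lt_iter m)
    have hlt : par^[2 ^ k] (par^[m] c) < 3 * n := by
      rw [← Function.iterate_add_apply]; exact lt_iter _
    have hval : ∀ x k v k' v', dot (queryNormal ((s2.setNatReg k v).setNatReg k' v'))
        (centres ((s2.setNatReg k v).setNatReg k' v') x) +
        ((s2.setNatReg k v).setNatReg k' v').realReg 6 -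
        ((s2.setNatReg k v).setNatReg k' v').realArr 7 x = g x := by
      intro x k v k' v'
      rw [hg]; unfold queryNormal centres; simp [iR, ir]
    simp only [Prog.wp, Test.Holds, ancestorE, NatExp.value, gapE_value, hval, RealExp.value, hk]
    simp [i0, hn, j2, hz]
    refine ⟨by omega, by omega, fun ht => ⟨k, by omega, ?_⟩, fun ht => ⟨by omega, k, by omega, ?_⟩⟩
    · refine ⟨⟨?_, ?_, iN, iR⟩, ir, ?_, by omega, m, ?_, jpos, ht⟩
      · simp [i0, hn]
      · simp [i9]
      · simp
      · simp [j2]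
    · refine ⟨⟨?_, ?_, iN, iR⟩, ir, ?_, by omega, 2 ^ k + m, ?_, ?_, ?_⟩
      · simp [i0, hn]
      · simp [i9]
      · simp
      · simp [Function.iterate_add_apply]
      · rw [Function.iterate_add_apply]; exact ht
      · rw [hk, pow_succ, Nat.mul_two] at jneg
        rw [Function.iterate_add_apply _ _ m, ← Function.iterate_add_apply _ (2 ^ k) (2 ^ k)]
        exact jneg
  · rintro s2 ⟨k, ⟨hD, ir, i6, iL, m, j2, jpos, jneg⟩, hbt⟩
    simp only [Test.Holds, NatExp.value] at hbt
    obtain rfl : k = 0 := by omega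
    exact ⟨hD, ir, m, j2, jpos, by simpa using jneg⟩

theorem runs_answerQuery {W n : ℕ} {U : ℕ → ℝ × ℝ} {s : State} (hU : IsCcw n U)
    (h : Prepared n U s) (hW : 3 * n * (Nat.log 2 n + 4) ≤ W) {a b c l : ℝ}
    (ha : s.realReg 0 = a) (hb : s.realReg 1 = b) (hc : s.realReg 2 = c)
    (hl : l = Real.sqrt (a * a + b * b)) (hw : dot (a / l, b / l) (a / l, b / l) = 1) :
    Runs W answerQuery s (Nat.log 2 n + 4) fun s' => Prepared n U s' ∧
      ((s'.natReg 1 = 1 ∧ IsBest n (normals s) (s.realArr 4) (a / l, b / l) (c / l)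
        (s'.realReg 0, s'.realReg 1) (s'.realReg 2)) ∨
      (s'.natReg 1 = 0 ∧ ∀ o r, Feasible n (normals s) (s.realArr 4) o r →
        r ≤ dot (a / l, b / l) o + c / l → r ≤ 0)) := by
  have hn := hU.1
  have hk : 1 ≤ Nat.log 2 n + 4 := by omega
  have eW : 3 * n * (Nat.log 2 n + 4) = 3 * (n * Nat.log 2 n) + 12 * n := by ring
  have eW' : Nat.log 2 n ≤ n * Nat.log 2 n := Nat.le_mul_of_pos_left _ (by omega)
  refine Runs.seq (runs_normalizeQuery hk ha hb hc hl) ?_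
  rintro s1 ⟨hD1, q1, e1⟩
  have hP1 := h.congr hD1
  have n1 : normals s1 = normals s := by unfold normals; rw [hD1.2.2.2]
  have d1 : s1.realArr 4 = s.realArr 4 := by rw [hD1.2.2.2]
  rw [← n1, ← d1, ← q1, ← e1]
  rw [← q1] at hw
  clear hD1 n1 d1 h ha hb hc
  refine Runs.seq ((runs_searchLeaf hU hP1 (by omega) hw).mono (by omega) fun _ => id) ?_
  rintro s2 ⟨hD2, r2, hlt, hcone⟩
  have hP2 := hP1.congr hD2
  obtain ⟨par, V, ch, rk, C, hpar, hT⟩ := hP2.climb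
  obtain ⟨hV, hch, hR0⟩ := C.leaf _ hlt
  have n2 : normals s2 = normals s1 := by unfold normals; rw [hD2.2.2.2]
  have q2 : queryNormal s2 = queryNormal s1 := by unfold queryNormal; rw [r2]
  rw [← n2, ← q2] at hcone
  rw [← n2, ← q2, ← r2, show s1.realArr 4 = s2.realArr 4 by rw [hD2.2.2.2]]
  clear n2 q2 hD2 r2 q1 e1 hw hP1
  have hcone' : InCone (normals s2 (ch (s2.natReg 2)).1) (normals s2 (ch (s2.natReg 2)).2)
      (queryNormal s2) := by rw [hch]; exact hcone
  refine Runs.ite hk (fun ht => ?_) fun ht => ?_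
  · simp only [Test.Holds, gapE_value, NatExp.value, RealExp.value, Rat.cast_zero] at ht
    refine Runs.of_wp hk ⟨Nat.zero_le _, hP2.congr ⟨by simp, by simp, rfl, rfl⟩, Or.inr ⟨by simp [NatExp.value],
      fun o r ho hq => C.nonpos_of_leaf hV hcone' hR0 ht ho hq⟩⟩
  · simp only [Test.Holds, gapE_value, NatExp.value, RealExp.value, Rat.cast_zero, not_le] at ht
    have hroot : s2.natArr 3 (s2.natReg 9 * (3 * n) + s2.natReg 2) =
      par^[2 ^ s2.natReg 9] (s2.natReg 2) := hT _ le_rfl _ (by omega)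
    have hrlt : par^[2 ^ s2.natReg 9] (s2.natReg 2) < 3 * n := by
      rw [← hroot]; exact hP2.bound _ _
    refine Runs.seq (Runs.of_wp hk (Q := fun s3 => SameData s2 s3 ∧ s3.realReg = s2.realReg ∧
      s3.natReg 2 = s2.natReg 2 ∧ s3.natReg 5 = par^[2 ^ s2.natReg 9] (s2.natReg 2)) ?_) ?_
    · simp only [Prog.wp, ancestorE, NatExp.value, hP2.size, hroot]
      refine ⟨by omega, ⟨by simp, by simp, rfl, rfl⟩, rfl, by simp, by simp⟩
    rintro s3 ⟨hD3, r3, k2, k5⟩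
    have hP3 := hP2.congr hD3
    obtain ⟨b0, b9, bN, bR⟩ := hD3
    have q3 : queryNormal s3 = queryNormal s2 := by unfold queryNormal; rw [r3]
    have c3 : centres s3 = centres s2 := by unfold centres; rw [bR]
    -- `2 ^ s2.natReg 9 ≥ 3 * n ≥ n + 2`, so the top row of the table leads to the root.
    have hfix := C.par_iterate hV (m := 2 ^ s2.natReg 9) (by have := hP2.le_pow_levels; omega)
    obtain ⟨hVr, -⟩ := C.iterate_spec hV hcone' (2 ^ s2.natReg 9)
    refine Runs.ite hk (fun hr => ?_) fun hr => ?_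
    · simp only [Test.Holds, gapE_value, NatExp.value, RealExp.value, Rat.cast_zero, k5, q3, c3,
        r3, bR] at hr
      have hg : (fun x => dot (queryNormal s3) (centres s3 x) + s3.realReg 6 - s3.realArr 7 x) =
          fun x => dot (queryNormal s2) (centres s2 x) + s2.realReg 6 - s2.realArr 7 x := by
        rw [q3, c3, r3, bR]
      refine Runs.seq ((runs_climbUp (n := n) (par := par) hP3.size
        (by have := hP3.levels_le; omega) (by omega) hpar
        (by rw [b9, bN]; exact hT) hg.symm k2 (by omega) ht (by rw [b9]; exact hr)).mono
        (by have := hP3.levels_le; omega) fun _ => id) ?_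
      rintro s4 ⟨hD4, r4, m, j2, jpos, jneg⟩
      have hP4 := hP3.congr hD4
      obtain ⟨x0, x9, xN, xR⟩ := hD4
      obtain ⟨hVm, hcm⟩ := C.iterate_spec hV hcone' m
      have hltm : par^[m] (s2.natReg 2) < 3 * n := by
        cases m with
        | zero => simp; omega
        | succ m => rw [Function.iterate_succ_apply']; exact hpar _
      have hpm : s4.natArr 3 (par^[m] (s2.natReg 2)) = par (par^[m] (s2.natReg 2)) := by
        have := hT 0 (Nat.zero_le _) _ hltm
        rw [xN, bN]; simpa using this
      have hlt' := hpar (par^[m] (s2.natReg 2))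
      have key := C.isBest_between hVm hcm rfl rfl jpos jneg rfl
      generalize par^[m] (s2.natReg 2) = u at *
      refine Runs.of_wp hk ?_
      simp only [reportBetween, Prog.wp, ancestorE, mixE, gapE_value, NatExp.value, RealExp.value]
      simp [j2, hpm, queryNormal, centres, xR, r4, bR, r3]
      refine ⟨by omega, by omega, hP4.congr ⟨by simp, by simp, rfl, rfl⟩, ?_⟩
      simpa [queryNormal, centres] using key
    · simp only [Test.Holds, gapE_value, NatExp.value, RealExp.value, Rat.cast_zero, k5, q3, c3,
        r3, bR, not_le] at hr
      have key := C.isBest_root hVr hfix hr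
      refine Runs.of_wp hk ?_
      simp only [reportRoot, Prog.wp, NatExp.value, RealExp.value]
      simp [k5, bR]
      refine ⟨by omega, hP3.congr ⟨by simp, by simp, rfl, rfl⟩, ?_⟩
      exact key

end CircleQuery

/-! ### From the input polygon to the main theorem. -/

namespace CircleQuery

open RealRAM

section Input

variable {n : ℕ} (v : Fin n → Plane)

theorem inputState_coord {i : ℕ} (hi : i < n) :
    ((inputState v).realArr 0 i, (inputState v).realArr 1 i) = (v ⟨i, hi⟩ 0, v ⟨i, hi⟩ 1) := by
  simp [inputState, hi]

/-- The orientation of the first three vertices. -/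
noncomputable def inputOrient : ℝ :=
  orient ((inputState v).realArr 0 0, (inputState v).realArr 1 0)
    ((inputState v).realArr 0 1, (inputState v).realArr 1 1)
    ((inputState v).realArr 0 2, (inputState v).realArr 1 2)

/-- The vertices in counterclockwise order. -/
noncomputable def ccwVertex : ℕ → ℝ × ℝ :=
  inputVertex n (inputOrient v) ((inputState v).realArr 0) ((inputState v).realArr 1)

variable {v}

theorem vertexIdx_lt {i : ℕ} (hi : i < n) (τ : ℝ) : vertexIdx n τ i < n := by
  unfold vertexIdx; split_ifs <;> omega

theorem ccwVertex_eq {i : ℕ} (hi : i < n) : ccwVertex v i =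
    (v ⟨vertexIdx n (inputOrient v) i, vertexIdx_lt hi _⟩ 0,
      v ⟨vertexIdx n (inputOrient v) i, vertexIdx_lt hi _⟩ 1) :=
  inputState_coord v (vertexIdx_lt hi _)

theorem turn_eq_orient (p q r : Plane) :
    turn p q r = orient (p 0, p 1) (q 0, q 1) (r 0, r 1) := by
  rw [orient_eq_sub]; rfl

/-- The sign of the first triangle tells the direction of the list; clockwise input is read
backwards. -/
theorem IsConvexPolygon.isCcw (hv : IsConvexPolygon v) : IsCcw n (ccwVertex v) := by
  obtain ⟨hn, hv⟩ := hv
  have hτ : inputOrient v = turn (v ⟨0, by omega⟩) (v ⟨1, by omega⟩) (v ⟨2, by omega⟩) := by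
    rw [turn_eq_orient, ← inputState_coord, ← inputState_coord, ← inputState_coord]; rfl
  refine ⟨hn, fun i j k hij hjk hk => ?_⟩
  rw [ccwVertex_eq (hij.trans (hjk.trans hk)), ccwVertex_eq (hjk.trans hk), ccwVertex_eq hk,
    ← turn_eq_orient]
  rcases hv with hv | hv
  · have h : 0 ≤ inputOrient v := by
      rw [hτ]; exact (hv _ _ _ (by simp) (by simp)).le
    have e : ∀ i, vertexIdx n (inputOrient v) i = i := fun i => if_pos h
    simp only [e]
    exact hv _ _ _ hij hjk
  · have h : ¬ 0 ≤ inputOrient v := by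
      rw [hτ, not_le]; exact hv _ _ _ (by simp) (by simp)
    have e : ∀ i, vertexIdx n (inputOrient v) i = n - 1 - i := fun i => if_neg h
    simp only [e]
    have := hv ⟨n - 1 - k, by omega⟩ ⟨n - 1 - j, by omega⟩ ⟨n - 1 - i, by omega⟩
      (Fin.mk_lt_mk.2 (by omega)) (Fin.mk_lt_mk.2 (by omega))
    unfold turn at *
    linarith

theorem mem_range_iff (p : Plane) :
    p ∈ Set.range v ↔ ∃ i < n, (p 0, p 1) = ccwVertex v i := by
  have ext_iff : ∀ q : Plane, p = q ↔ (p 0, p 1) = (q 0, q 1) := by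
    intro q
    refine ⟨fun h => by rw [h], fun h => ?_⟩
    ext i
    fin_cases i
    · exact congrArg Prod.fst h
    · exact congrArg Prod.snd h
  constructor
  · rintro ⟨i, rfl⟩
    refine ⟨vertexIdx n (inputOrient v) i, vertexIdx_lt i.2 _, ?_⟩
    -- Reversal of the indices is an involution.
    have e : vertexIdx n (inputOrient v) (vertexIdx n (inputOrient v) i) = i := by
      have := i.2
      unfold vertexIdx; split_ifs <;> omega
    rw [ccwVertex_eq (vertexIdx_lt i.2 _)]
    simp only [e]
  · rintro ⟨i, hi, h⟩
    rw [ccwVertex_eq hi, ← ext_iff] at h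
    exact ⟨_, h.symm⟩

end Input

theorem sameData_loadQuery (s : State) (a b c : ℝ) : SameData s (loadQuery s a b c) :=
  ⟨rfl, rfl, rfl, rfl⟩

theorem IsConvexPolygon.runs_preprocess {n : ℕ} {v : Fin n → Plane} (hv : IsConvexPolygon v)
    {W : ℕ} (hW : 3 * n * (Nat.log 2 n + 4) ≤ W) :
    Runs W preprocess (inputState v) (3 * n * (Nat.log 2 n + 4)) (Prepared n (ccwVertex v)) :=
  CircleQuery.runs_preprocess hW (by simp [inputState]) rfl
    (by funext i; simp [inputState]) (by funext i; simp [inputState]) rfl hv.isCcw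

theorem IsConvexPolygon.runs_answerQuery {n : ℕ} {v : Fin n → Plane} (hv : IsConvexPolygon v)
    {W : ℕ} (hW : 3 * n * (Nat.log 2 n + 4) ≤ W) {s : State} (hs : Prepared n (ccwVertex v) s)
    {a b c : ℝ} (hab : (a, b) ≠ (0, 0)) :
    Runs W answerQuery (loadQuery s a b c) (Nat.log 2 n + 4) fun s' =>
      Prepared n (ccwVertex v) s' ∧ IsAnswer (region v ∩ halfplane a b c) s' := by
  have hpos : 0 < a * a + b * b := by
    rcases eq_or_ne a 0 with rfl | ha
    · have hb : b ≠ 0 := fun h => hab (by rw [h])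
      have := mul_self_pos.2 hb
      linarith
    · have := mul_self_pos.2 ha
      have := mul_self_nonneg b
      linarith
  obtain ⟨l, hl⟩ : ∃ l, l = Real.sqrt (a * a + b * b) := ⟨_, rfl⟩
  have hl0 : 0 < l := by rw [hl]; exact Real.sqrt_pos.2 hpos
  have hll : l * l = a * a + b * b := by rw [hl]; exact Real.mul_self_sqrt hpos.le
  have hw : dot (a / l, b / l) (a / l, b / l) = 1 := by
    unfold dot
    field_simp
    linarith
  have hs' := hs.congr (sameData_loadQuery s a b c)
  have hiff := isCircleIn_iff hs'.sides hv.isCcw mem_range_iff (c := c) hl0 hw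
  refine (CircleQuery.runs_answerQuery hv.isCcw hs' hW (c := c) (by simp [loadQuery])
    (by simp [loadQuery]) (by simp [loadQuery]) hl hw).mono le_rfl ?_
  rintro s1 ⟨h1, h2⟩
  refine ⟨h1, h2.imp (fun ⟨hr, hb⟩ => ⟨hr, ?_⟩) fun ⟨hr, hb⟩ => ⟨hr, fun o r ho => ?_⟩⟩
  · exact ⟨(hiff _ _).2 ⟨hb.radius_pos, hb.feasible, hb.query⟩, fun o r ho =>
      hb.max _ _ ((hiff _ _).1 ho).2.1 ((hiff _ _).1 ho).2.2⟩
  · obtain ⟨h0, h3, h4⟩ := (hiff _ _).1 ho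
    exact h0.not_ge (hb _ _ h3 h4)

end CircleQuery

/-- There are fixed programs `pre` and `query` such that, on every convex `n`-gon, `pre` halts
within `O(n log n)` time and space in a memory from which any number of successive halfplane
queries are answered by `query`, each in `O(log n)` time and within the same memory bound. -/
theorem theorem4 :
    ∃ (pre query : RealRAM.Prog) (K : ℕ),
      ∀ (n : ℕ) (v : Fin n → CircleQuery.Plane), CircleQuery.IsConvexPolygon v →
        ∃ (t : ℕ) (s : RealRAM.State),
          RealRAM.Exec (K * (n * Nat.log 2 n)) pre (CircleQuery.inputState v) t s ∧
          t ≤ K * (n * Nat.log 2 n) ∧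
          ∃ Ready : RealRAM.State → Prop, Ready s ∧
            ∀ s₁ : RealRAM.State, Ready s₁ →
              CircleQuery.AnswersFrom v query (K * (n * Nat.log 2 n)) (K * Nat.log 2 n)
                Ready s₁ := by
  -- As `Nat.log 2 n ≥ 1`, the number of passes `Nat.log 2 n + 4` of a query is at most `5 * Nat.log
  -- 2 n`, which gives the `5` and, times `3 * n`, the `15`. The summand `1` makes the constant at
  -- least `15`, as the memory bound requires.
  refine ⟨CircleQuery.preprocess, CircleQuery.answerQuery,
    15 * (CircleQuery.preprocess.time + 1) + 5 * CircleQuery.answerQuery.time,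
    fun n v hv => ?_⟩
  have hlog : 1 ≤ Nat.log 2 n := Nat.log_pos one_lt_two (by have := hv.1; omega)
  have hsize : 3 * n * (Nat.log 2 n + 4) ≤ 15 * (n * Nat.log 2 n) := by nlinarith
  have hW : 3 * n * (Nat.log 2 n + 4) ≤
      (15 * (CircleQuery.preprocess.time + 1) + 5 * CircleQuery.answerQuery.time) *
        (n * Nat.log 2 n) :=
    hsize.trans (Nat.mul_le_mul_right _ (by omega))
  obtain ⟨t, s, hE, ht, hs⟩ := hv.runs_preprocess hW
  refine ⟨t, s, hE, ?_, CircleQuery.Prepared n (CircleQuery.ccwVertex v), hs,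
    fun s₁ hs₁ a b c hab => ?_⟩
  · calc t ≤ CircleQuery.preprocess.time * (15 * (n * Nat.log 2 n)) :=
        ht.trans (Nat.mul_le_mul_left _ hsize)
      _ = 15 * CircleQuery.preprocess.time * (n * Nat.log 2 n) := by ring
      _ ≤ _ := Nat.mul_le_mul_right _ (by omega)
  · obtain ⟨t', s', hE', ht', hs', hA⟩ := hv.runs_answerQuery hW hs₁ hab
    refine ⟨t', s', hE', ?_, hA, hs'⟩
    calc t' ≤ CircleQuery.answerQuery.time * (5 * Nat.log 2 n) :=
        ht'.trans (Nat.mul_le_mul_left _ (by omega))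
      _ = 5 * CircleQuery.answerQuery.time * Nat.log 2 n := by ring
      _ ≤ _ := Nat.mul_le_mul_right _ (by omega)
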